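/- **Setting.** Let $d\ge 2$, let $e_1$ be the first vector of the canonical basis of $\mathbb R^d$, and let $\mathcal S_0(x)=x-2(x\cdot e_1)e_1$. The particles live in the half-space $\{x\cdot e_1>0\}$. A configuration of $n$ particles is $Z_n=(x_i,v_i)_{1\le i\le n}$ with $x_i,v_i\in\mathbb R^d$, and $|V_n|=(\sum_i|v_i|^2)^{1/2}$. The phase space of $n$ hard spheres of radius $\varepsilon/2$ is $$\mathcal D^\varepsilon_n=\{Z_n:\ x_i\cdot e_1\ge\varepsilon/2\ \ \forall i,\quad |x_i-x_j|\ge\varepsilon\ \ \forall i\ne j\}.$$ The set $\Omega_s$ consists of the configurations $Z_s$ such that $x_i\cdot e_1>0$ and $v_i\cdot e_1\neq0$ for all $i$, and $x_i\ne x_j$, $v_j\notin v_i+\mathrm{Vect}(x_i-x_j)$ and $v_j\notin\mathcal S_0(v_i)+\mathrm{Vect}(\mathcal S_0(x_i)-x_j)$ for all $i\neq j$. The set $\Delta_s=\Delta_s(\varepsilon,R,\varepsilon_0,\alpha,\gamma)$ consists of the $Z_s\in\mathcal D^\varepsilon_s$ such that $x_i\cdot e_1>\varepsilon/2$ and $|v_i\cdot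 e_1|\ge\alpha$ for all $i$, $|V_s|\le R$, and, for all $i<j$, $|x_i-x_j|\ge\varepsilon_0$, $d(v_j,v_i+\mathrm{Vect}(x_i-x_j))\ge\gamma$ and $d(v_j,\mathcal S_0(v_i)+\mathrm{Vect}(\mathcal S_0(x_i)-x_j))\ge\gamma$. *Dynamics.* Under the backward free flow $T^{n,0}_{-\tau}$ ($\tau\ge0$) each particle moves in a straight line, $x_i\mapsto x_i-\tau v_i$, with specular reflection at $x\cdot e_1=0$. Under the backward hard-sphere dynamics the particles move in straight lines and stay in $\mathcal D^\varepsilon_n$; the events do not accumulate; there is specular reflection $v_i\mapsto\mathcal S_0(v_i)$ when $x_i\cdot e_1=\varepsilon/2$ and elastic collision when $|x_i-x_j|=\varepsilon$; at any instant each particle takes part in at most one event. *Adjunction.* For $\varepsilon\ge0$, adjoining to $Z_n$ a particle next to the particle $j$ with parameters $(\omega,v)\in\mathbb S^{d-1}\times\mathbb R^d$ means adding an $(n+1)$-st particle at position $x_j+\varepsilon\omega$ with velocity $v$. If moreover $\omega\cdot(v-v_j)>0$, then $v_j$ is replaced by $v_j-((v_j-v)\cdot\omega)\,\omega$ and $v$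 by $v+((v_j-v)\cdot\omega)\,\omega$. *Pseudo-trajectories.* Let $Z_s$ be an initial configuration, $t_0\ge t_1\ge\dots\ge t_k\ge t_{k+1}=0$ times, $J_k=(j_1,\dots,j_k)$ with $1\le j_l\le s+l-1$, and $A_k=((\omega_l,v_{s+l}))_{1\le l\le k}$ with $(\omega_l,v_{s+l})\in\mathbb S^{d-1}\times\mathbb R^d$. The Boltzmann pseudo-trajectory $Z^0_{s,l}(\tau)$, $\tau\in[t_{l+1},t_l]$, $0\le l\le k$, starts from $Z^0_{s,0}(t_0)=Z_s$ and follows the backward free flow on each $[t_{l+1},t_l]$; $Z^0_{s,l}(t_l)$ is obtained from $Z^0_{s,l-1}(t_l)$ by adjoining a particle next to $j_l$ with parameters $(\omega_l,v_{s+l})$ and $\varepsilon=0$. A BBGKY pseudo-trajectory $Z^\varepsilon_{s,l}$ is defined in the same way, with the backward hard-sphere dynamics in place of the free flow and the adjunctions at distance $\varepsilon>0$. The positions are denoted by $x^{0,m}_{s,l}(\tau)$ and $x^{\varepsilon,m}_{s,l}(\tau)$. On $[0,T]$, $|\cdot|$ is the Lebesgue measure; on $\mathbb S^{d-1}\times\mathbb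 R^d$ it is the product of the surface measure and the Lebesgue measure. **Proposition.** (1) Let $s\ge1$ and let $K\subset\Omega_s$ be compact. There are strictly positive numbers $\overline\varepsilon,\overline\varepsilon_0,\overline\alpha,\overline\gamma,\overline R$ such that $K\subset\Delta_s(\varepsilon,R,\varepsilon_0,\alpha,\gamma)$ for all positive $\varepsilon\le\overline\varepsilon$, $\varepsilon_0\le\overline\varepsilon_0$, $\alpha\le\overline\alpha$, $\gamma\le\overline\gamma$ and all $R\ge\overline R$. (2) There are constants $C(d)>0$ and $c(d)>0$, depending only on $d$, such that the following holds for all integers $s,k\ge1$ and all positive $T,\varepsilon,\varepsilon_0,\alpha,\gamma,R,\eta,a,\delta,\rho$ with $$R\ge1,\quad \eta\le1,\quad 2k\varepsilon\le a,\quad 4\sqrt3\,a\le\varepsilon_0,\quad \varepsilon_0\le\eta\delta,\quad 3a\le\rho,\quad \alpha\le c(d),\quad \max\Big(\frac{\varepsilon_0}{\delta},\frac{16Ra}{\varepsilon_0}\Big)\le\gamma .$$ There are measurable sets of pathological adjunction times and of pathological adjunction parameters $$U_{l}=U_{j_l}\big(t_{l-1},Z^0_{s,l-1}(t_{l-1})\big)\subset[0,T],\qquad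 E_l=E_{j_l}\big(Z^0_{s,l-1}(t_l)\big)\subset\mathbb S^{d-1}\times\mathbb R^d\qquad(1\le l\le k),$$ given by functions of the displayed arguments only (the chosen particle $j_l$, the configuration of the Boltzmann pseudo-trajectory and, for $U_l$, the time $t_{l-1}$ at which this configuration is taken), hence defined recursively along the pseudo-trajectory, such that for all $1\le l\le k$ and all values of these arguments $$|U_l|\le 2\frac\rho\alpha,$$ $$|E_l|\le C(d)\Big(\eta^d+R^d\Big(\frac a\rho\Big)^{d-1}+(s+l-1)R^{2d-1}\Big(\frac a{\varepsilon_0}\Big)^{d-3/2}+(s+l-1)R^{d+1/2}\Big(\frac{\varepsilon_0}\delta\Big)^{d-3/2}+R^{d-1}\alpha+R^d\alpha^{1/8}\Big),$$ and such that the following holds for all $Z_s\in\Delta_s(\varepsilon,R,\varepsilon_0,\alpha,\gamma)$, all $t_0\le T$, all $t_1,\dots,t_k\ge0$ with $t_{l-1}-t_l\ge\delta$ for $1\le l\le k$, $t_{k+1}=0$, all $J_k$ as above, and all $A_k$ with $|V_s|^2+\sum_{l=1}^k|v_{s+l}|^2\le R^2$. If $t_l\notin U_l$ and $(\omega_l,v_{s+l})\notin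 E_l$ for all $1\le l\le k$, then a BBGKY pseudo-trajectory associated with $(Z_s,(t_l),J_k,A_k)$ exists, and every such pseudo-trajectory satisfies: * (no recollision) $\big|x^{\varepsilon,m}_{s,l}(\tau)-x^{\varepsilon,m'}_{s,l}(\tau)\big|>\varepsilon$ for all $0\le l\le k$, $\tau\in[t_{l+1},t_l]$ and $1\le m\ne m'\le s+l$, except for the pair $\{m,m'\}=\{j_l,s+l\}$ at the instant $\tau=t_l$ of its adjunction ($l\ge1$), when the distance equals $\varepsilon$; * (closeness) $\big|x^{\varepsilon,m}_{s,k}(0)-x^{0,m}_{s,k}(0)\big|\le2k\varepsilon$ for all $1\le m\le s+k$. -/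

import Mathlib

open MeasureTheory Set

noncomputable section

namespace HalfSpace

/-- The Euclidean space `ℝ^d`. -/
abbrev Vec (d : ℕ) : Type := EuclideanSpace ℝ (Fin d)

/-- A configuration of `n` particles: the pair (positions, velocities). -/
abbrev Config (d n : ℕ) : Type := (Fin n → Vec d) × (Fin n → Vec d)

/-- The parameters `(ω, v)` of an adjunction: `S^{d-1} × ℝ^d`. -/
abbrev AdjParam (d : ℕ) : Type := Metric.sphere (0 : Vec d) 1 × Vec d

/-- The product of the surface measure of the unit sphere and of the Lebesgue measure. -/
def adjMeasure (d : ℕ) : Measure (AdjParam d) :=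
  (volume : Measure (Vec d)).toSphere.prod volume

variable {d : ℕ} [NeZero d]

/-- The first vector of the canonical basis; thus `x ⬝ e₁` is the coordinate `x 0`. -/
def e₁ : Vec d := EuclideanSpace.single 0 1

/-- The orthogonal symmetry `x ↦ x - 2 (x ⬝ e₁) e₁` with respect to the wall. -/
def symm₀ (x : Vec d) : Vec d := x - (2 * x 0) • e₁

/-- The norm of the vector of all velocities in `ℝ^{dn}`. -/
def velNorm {n : ℕ} (Z : Config d n) : ℝ := Real.sqrt (∑ i, ‖Z.2 i‖ ^ 2)

/-- The phase space of `n` hard spheres of radius `ε / 2` in the half-space. -/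
def phaseSpace (ε : ℝ) (n : ℕ) : Set (Config d n) :=
  {Z | (∀ i, ε / 2 ≤ Z.1 i 0) ∧ ∀ i j, i ≠ j → ε ≤ ‖Z.1 i - Z.1 j‖}

/-- The distance from `w` to the affine line (or point) `v + Vect(y)`. -/
def distLine (w v y : Vec d) : ℝ :=
  Metric.infDist w {u | ∃ c : ℝ, u = v + c • y}

/-- The domain of local uniform convergence `Ω_s`; positions lie in the open half-space. -/
def convDomain (s : ℕ) : Set (Config d s) :=
  {Z | (∀ i, 0 < Z.1 i 0) ∧
    (∀ i j, i ≠ j → Z.1 i ≠ Z.1 j) ∧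
    (∀ i, Z.2 i 0 ≠ 0) ∧
    (∀ i j, i ≠ j → ¬ ∃ c : ℝ, Z.2 j = Z.2 i + c • (Z.1 i - Z.1 j)) ∧
    (∀ i j, i ≠ j →
      ¬ ∃ c : ℝ, Z.2 j = symm₀ (Z.2 i) + c • (symm₀ (Z.1 i) - Z.1 j))}

/-- The set `Δ_s(ε, R, ε₀, α, γ)` of initial configurations, inside the phase space. -/
def goodInit (s : ℕ) (ε R ε₀ α γ : ℝ) : Set (Config d s) :=
  {Z | Z ∈ phaseSpace ε s ∧
    (∀ i, ε / 2 < Z.1 i 0) ∧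
    velNorm Z ≤ R ∧
    (∀ i j, i < j → ε₀ ≤ ‖Z.1 i - Z.1 j‖) ∧
    (∀ i, α ≤ |Z.2 i 0|) ∧
    (∀ i j, i < j → γ ≤ distLine (Z.2 j) (Z.2 i) (Z.1 i - Z.1 j)) ∧
    (∀ i j, i < j →
      γ ≤ distLine (Z.2 j) (symm₀ (Z.2 i)) (symm₀ (Z.1 i) - Z.1 j))}

/-- The backward free flow `T^{n,0}_{-τ}` (`τ ≥ 0`) with specular reflection at the wall.  A particle
of the half-space bounces at most once under this flow. -/
def freeFlow {n : ℕ} (τ : ℝ) (Z : Config d n) : Config d n :=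
  (fun i => if (Z.1 i - τ • Z.2 i) 0 < 0 then symm₀ (Z.1 i - τ • Z.2 i) else Z.1 i - τ • Z.2 i,
   fun i => if (Z.1 i - τ • Z.2 i) 0 < 0 then symm₀ (Z.2 i) else Z.2 i)

/-- The specular reflections and the elastic collisions at an instant: `V` and `W` are the families
of velocities on the two sides of an instant at which the positions are `X`.  At such an
instant a particle takes part in at most one event (a bounce or a collision with one particle). -/
def IsJump {n : ℕ} (ε : ℝ) (X V W : Fin n → Vec d) : Prop :=
  ∀ i,
    (X i 0 = ε / 2 → (∀ j, j ≠ i → ‖X i - X j‖ ≠ ε) ∧ W i = symm₀ (V i)) ∧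
    (∀ j, j ≠ i → ‖X i - X j‖ = ε →
      (∀ m, m ≠ i → m ≠ j → ‖X i - X m‖ ≠ ε) ∧
      W i = V i - ((1 / ε ^ 2) * inner ℝ (V i - V j) (X i - X j)) • (X i - X j)) ∧
    (X i 0 ≠ ε / 2 → (∀ j, j ≠ i → ‖X i - X j‖ ≠ ε) → W i = V i)

/-- `Z` is a trajectory of the hard sphere dynamics on `[a, b]`, run backwards from the time `b`:
it stays in the phase space, it is free between the events, which do not accumulate, and at each
event the velocities change by specular reflection or elastic collision.  At the time of an event
the value of `Z` carries the velocities that hold just before this time, so that the velocities of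
`Z b` are those with which the backward evolution starts. -/
def IsHardSphereTrajectory {n : ℕ} (ε : ℝ) (Z : ℝ → Config d n) (a b : ℝ) : Prop :=
  (∀ τ ∈ Icc a b, Z τ ∈ phaseSpace ε n) ∧
  (∀ τ ∈ Ioc a b, ∃ h > 0, ∀ u ∈ Ioo (τ - h) τ, a ≤ u →
    Z u = (fun i => (Z τ).1 i - (τ - u) • (Z τ).2 i, (Z τ).2)) ∧
  (∀ τ ∈ Ico a b, ∃ h > 0, ∃ V : Fin n → Vec d,
    (∀ u ∈ Ioo τ (τ + h), u ≤ b → Z u = (fun i => (Z τ).1 i + (u - τ) • V i, V)) ∧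
    IsJump ε (Z τ).1 V (Z τ).2)

open Classical in
/-- Adjunction of a particle next to the particle `j`, with parameters `p = (ω, v)`: the new particle
is at `x_j + ε ω` with velocity `v`; if the pair is post-collisional, i.e. `ω ⬝ (v - v_j) > 0`, then
the scattering is applied to it. -/
def adjoin {n : ℕ} (ε : ℝ) (Z : Config d n) (j : Fin n) (p : AdjParam d) : Config d (n + 1) :=
  (Fin.snoc (α := fun _ => Vec d) Z.1 (Z.1 j + ε • (p.1 : Vec d)),
   if 0 < inner ℝ (p.1 : Vec d) (p.2 - Z.2 j) then
     Fin.snoc (α := fun _ => Vec d)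
       (Function.update Z.2 j
         (Z.2 j - (inner ℝ (Z.2 j - p.2) (p.1 : Vec d) : ℝ) • (p.1 : Vec d)))
       (p.2 + (inner ℝ (Z.2 j - p.2) (p.1 : Vec d) : ℝ) • (p.1 : Vec d))
   else Fin.snoc (α := fun _ => Vec d) Z.2 p.2)

/-- The configuration of the Boltzmann pseudo-trajectory just after its first `l` adjunctions, that
is `Z⁰_{s,l}(t_l)`.  The pseudo-trajectory starts at time `t 0` from `Z`; the `(l+1)`-st adjunction
takes place at time `t (l + 1)`, next to the particle `J l`, with parameters `A l`. -/
def boltzmannAt {s : ℕ} (Z : Config d s) (t : ℕ → ℝ) (J : (l : ℕ) → Fin (s + l))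
    (A : ℕ → AdjParam d) : (l : ℕ) → Config d (s + l)
  | 0 => Z
  | l + 1 => adjoin 0 (freeFlow (t l - t (l + 1)) (boltzmannAt Z t J A l)) (J l) (A l)

/-- The Boltzmann pseudo-trajectory `Z⁰_{s,l}(τ)` with `l` adjunctions performed, at a time
`τ ≤ t l`. -/
def boltzmann {s : ℕ} (Z : Config d s) (t : ℕ → ℝ) (J : (l : ℕ) → Fin (s + l))
    (A : ℕ → AdjParam d) (l : ℕ) (τ : ℝ) : Config d (s + l) :=
  freeFlow (t l - τ) (boltzmannAt Z t J A l)

/-- `Y` is the BBGKY pseudo-trajectory with `k` adjunctions: `Y l τ = Z^ε_{s,l}(τ)` for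
`τ ∈ [t (l + 1), t l]` and `l ≤ k`.  It follows the backward hard sphere dynamics between the
adjunctions; the final time is `t (k + 1)`. -/
def IsBBGKYPseudoTrajectory {s : ℕ} (ε : ℝ) (k : ℕ) (Z : Config d s) (t : ℕ → ℝ)
    (J : (l : ℕ) → Fin (s + l)) (A : ℕ → AdjParam d)
    (Y : (l : ℕ) → ℝ → Config d (s + l)) : Prop :=
  Y 0 (t 0) = Z ∧
  (∀ l, l ≤ k → IsHardSphereTrajectory ε (Y l) (t (l + 1)) (t l)) ∧
  (∀ l, l < k → Y (l + 1) (t (l + 1)) = adjoin ε (Y l (t (l + 1))) (J l) (A l))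

end HalfSpace

end

open HalfSpace

set_option linter.unusedSectionVars false

noncomputable section

namespace HalfSpace

variable {d : ℕ} [NeZero d]

/-! The reflection at the wall is unfolded. Up to the symmetry `symm₀`, a free particle of the
half-space moves on a straight line, so two particles stay apart as soon as one of them stays apart,
in the whole space, from the other and from its mirror image (`Apart`, `KeepsFrom`). Each bad event
then concerns a single straight relative motion: a relative velocity that brings two distant points
close together lies in a thin cylinder around their relative position.

The induction along the Boltzmann pseudo-trajectory uses two distances. After an adjunction, all
pairs stay at distance `3 * a` of each other and of the mirror images, except that the new pair
starts from a common point; and from the time `δ' = max δ (ρ / α)` on, all pairs stay at a larger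
distance `F` (`IsSafe`). The removed times force a gap of at least `ρ / α` between adjunctions and
put the host at distance `ρ / 2` from the wall, so the next adjunction starts from a configuration
separated by `F` at all later steps of the backward motion (`IsReady`).

The parameters that break safety are measured in `exists_adjMeasure_not_isSafe_le`. The scattered
velocities involve the component of `v - v_j` along `ω`, treated by polar coordinates, and the
component orthogonal to `ω`, treated by integrating in `ω` for fixed `v`. Both are singular for
small components, which are cut off at `μ * R`. Up to constants and simpler terms, `n` particles
cost `R^d (μ + n (a/F)^(d-1) μ^(-κ) + n (F/(δ' R))^(d-1) μ^(-(d-2+κ)))`. With `F = ε₀` the last term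
would be too large in general; `exists_separation` chooses a smaller `F` that does not depend on
`n`, and `μ` is taken equal to the announced bound divided by `R^d`. The factor `n` is absorbed
because the energy bound and `|v_i ⬝ e₁| ≥ α` give `n α² ≤ R²`.

The hard spheres, shifted by `ε / 2` so that they bounce at coordinate zero, follow the Boltzmann
particles up to reflection, with an error that grows by at most `ε` at each adjunction (`Follows`).
The margin `3 * a` then excludes every contact, except within the new pair, which moves apart
because its velocities are pre-collisional. The same induction yields the existence of the
trajectory and the properties of all of them.

The first assertion is a compactness argument: the quantities in the definition of `goodInit` are
bounded below by positive continuous functions, the distance to a line being replaced by the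
explicit `lineGap`. -/

/-! ### Volumes of tubes and slabs, and integration over the sphere. -/

/-- Coordinates adapted to a unit vector, as a measure preserving map. -/
lemma exists_adapted_coordinates {n : ℕ} (e : Vec (n + 1)) (he : ‖e‖ = 1) :
    ∃ Φ : Vec (n + 1) → ℝ × (Fin n → ℝ), MeasurePreserving Φ volume volume ∧
      (∀ h, (Φ h).1 = inner ℝ e h) ∧
      ∀ h c k, |(Φ h).2 k - (Φ c).2 k| ≤ ‖h - inner ℝ e h • e - c‖ := by
  obtain ⟨b, hb⟩ := Orthonormal.exists_orthonormalBasis_extension_of_card_eq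
    (𝕜 := ℝ) (E := Vec (n + 1)) (ι := Fin (n + 1)) (by simp) (v := fun _ => e) (s := {0})
    (by
      rw [orthonormal_iff_ite]
      rintro ⟨i, rfl⟩ ⟨j, rfl⟩
      simp [he])
  have hb0 : b 0 = e := hb 0 rfl
  refine ⟨fun h => MeasurableEquiv.piFinSuccAbove (fun _ => ℝ) 0
      ((MeasurableEquiv.toLp 2 (Fin (n + 1) → ℝ)).symm (b.repr h)), ?_, ?_, ?_⟩
  · exact (volume_preserving_piFinSuccAbove (fun _ : Fin (n + 1) => ℝ) 0).comp
      ((EuclideanSpace.volume_preserving_symm_measurableEquiv_toLp (Fin (n + 1))).comp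
        b.measurePreserving_repr)
  · intro h
    change b.repr h 0 = _
    rw [b.repr_apply_apply, hb0]
  · intro h c k
    change |b.repr h ((0 : Fin (n + 1)).succAbove k) - b.repr c ((0 : Fin (n + 1)).succAbove k)| ≤ _
    set k' := (0 : Fin (n + 1)).succAbove k with hk'
    have h0 : inner ℝ (b k') e = (0 : ℝ) := by
      rw [← hb0]
      exact b.orthonormal.2 (by simp [hk'])
    have : b.repr h k' - b.repr c k' = inner ℝ (b k') (h - inner ℝ e h • e - c) := by
      rw [b.repr_apply_apply, b.repr_apply_apply, inner_sub_right, inner_sub_right,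
        inner_smul_right, h0]
      ring
    rw [this]
    refine (abs_real_inner_le_norm _ _).trans ?_
    rw [b.orthonormal.1, one_mul]

/-- Fubini bound for the integral of a function of the coordinate along `e`, over a tube around
the direction `e` whose radius depends on this coordinate. -/
lemma lintegral_tube_le {d : ℕ} [NeZero d] (e : Vec d) (he : ‖e‖ = 1) (c : Vec d)
    {G : ℝ → ENNReal} (hG : Measurable G) {r : ℝ → ℝ} (hr : Measurable r)
    {f : Vec d → ENNReal}
    (hf : ∀ h, f h ≠ 0 → ‖h - inner ℝ e h • e - c‖ ≤ r (inner ℝ e h) ∧ f h ≤ G (inner ℝ e h)) :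
    ∫⁻ h, f h ≤ ∫⁻ t, G t * ENNReal.ofReal (2 * r t) ^ (d - 1) := by
  obtain ⟨n, rfl⟩ : ∃ n, d = n + 1 := Nat.exists_eq_succ_of_ne_zero (NeZero.ne d)
  obtain ⟨Φ, hΦ, h1, h2⟩ := exists_adapted_coordinates e he
  let A : Set (ℝ × (Fin n → ℝ)) := {p | ∀ k, |p.2 k - (Φ c).2 k| ≤ r p.1}
  have hA : MeasurableSet A := by
    have : A = ⋂ k, {p | |p.2 k - (Φ c).2 k| ≤ r p.1} := by ext; simp [A]
    rw [this]
    refine MeasurableSet.iInter fun k => measurableSet_le ?_ ?_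
    · have : Measurable fun p : ℝ × (Fin n → ℝ) => p.2 k - (Φ c).2 k := by fun_prop
      exact this.abs
    · fun_prop
  let g : ℝ × (Fin n → ℝ) → ENNReal := A.indicator fun p => G p.1
  have hg : Measurable g := (hG.comp measurable_fst).indicator hA
  calc ∫⁻ h, f h ≤ ∫⁻ h, g (Φ h) := by
        refine lintegral_mono fun h => ?_
        by_cases h0 : f h = 0
        · simp [h0]
        · obtain ⟨h3, h4⟩ := hf h h0
          have : Φ h ∈ A := fun k => by rw [h1]; exact (h2 h c k).trans h3
          simpa only [g, indicator_of_mem this, h1] using h4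
    _ = ∫⁻ p, g p := hΦ.lintegral_comp hg
    _ = ∫⁻ t, ∫⁻ w, g (t, w) := by
        rw [Measure.volume_eq_prod, lintegral_prod _ hg.aemeasurable]
    _ ≤ ∫⁻ t, G t * ENNReal.ofReal (2 * r t) ^ n := by
        refine lintegral_mono fun t => ?_
        -- The section at abscissa `t` is enclosed in a cube of half-side `r t`, which gives the
        -- power of `2 * r t` without the constant of the ball.
        have : ∀ w, g (t, w) = (Set.pi univ fun k => Icc ((Φ c).2 k - r t) ((Φ c).2 k + r t)).indicator
            (fun _ => G t) w := by
          intro w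
          have : (t, w) ∈ A ↔ w ∈ Set.pi univ
              fun k => Icc ((Φ c).2 k - r t) ((Φ c).2 k + r t) := by
            simp only [A, mem_ofPred_eq, mem_pi, mem_univ, forall_true_left, mem_Icc, abs_le]
            refine forall_congr' fun k => ⟨fun h => ⟨by linarith [h.1], by linarith [h.2]⟩,
              fun h => ⟨by linarith [h.1], by linarith [h.2]⟩⟩
          by_cases h : (t, w) ∈ A
          · rw [indicator_of_mem (this.1 h)]; exact indicator_of_mem h _
          · rw [indicator_of_notMem (fun h' => h (this.2 h'))]; exact indicator_of_notMem h _
        simp_rw [this]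
        rw [lintegral_indicator (MeasurableSet.univ_pi fun k => measurableSet_Icc),
          setLIntegral_const, volume_pi_pi]
        simp only [Real.volume_Icc]
        refine mul_le_mul_right (le_of_eq ?_) _
        rw [Finset.prod_congr rfl fun k _ => by
          rw [show (Φ c).2 k + r t - ((Φ c).2 k - r t) = 2 * r t by ring]]
        simp
    _ = _ := by simp

/-- Volume of a tube of constant radius over a set of abscissae. -/
lemma volume_tube_le {d : ℕ} [NeZero d] (e : Vec d) (he : ‖e‖ = 1) (c : Vec d)
    {Λ : Set ℝ} (hΛ : MeasurableSet Λ) (r : ℝ) {s : Set (Vec d)}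
    (hs : ∀ h ∈ s, ‖h - inner ℝ e h • e - c‖ ≤ r ∧ inner ℝ e h ∈ Λ) :
    volume s ≤ volume Λ * ENNReal.ofReal (2 * r) ^ (d - 1) := by
  let T : Set (Vec d) := {h | ‖h - inner ℝ e h • e - c‖ ≤ r} ∩ {h | inner ℝ e h ∈ Λ}
  have hT : MeasurableSet T := by
    refine MeasurableSet.inter (measurableSet_le (by fun_prop) measurable_const) ?_
    exact (by fun_prop : Measurable fun h : Vec d => (inner ℝ e h : ℝ)) hΛ
  calc volume s ≤ volume T := measure_mono hs
    _ = ∫⁻ h, T.indicator 1 h := (lintegral_indicator_one hT).symm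
    _ ≤ ∫⁻ t, Λ.indicator 1 t * ENNReal.ofReal (2 * r) ^ (d - 1) := by
        refine lintegral_tube_le e he c (measurable_one.indicator hΛ) measurable_const ?_
        intro h h0
        have hm : h ∈ T := by
          by_contra h'
          exact h0 (indicator_of_notMem h' _)
        exact ⟨hm.1, by
          rw [indicator_of_mem hm, indicator_of_mem (show inner ℝ e h ∈ Λ from hm.2)]; rfl⟩
    _ = _ := by
        rw [lintegral_mul_const _ (measurable_one.indicator hΛ), lintegral_indicator_one hΛ]

lemma norm_sub_inner_smul_le {d : ℕ} {e : Vec d} (he : ‖e‖ = 1) (h : Vec d) :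
    ‖h - inner ℝ e h • e‖ ≤ ‖h‖ := by
  have : ‖h - inner ℝ e h • e‖ ^ 2 = ‖h‖ ^ 2 - inner ℝ e h ^ 2 := by
    rw [norm_sub_sq_real, norm_smul, he, inner_smul_right, real_inner_comm, Real.norm_eq_abs,
      mul_one, sq_abs]
    ring
  nlinarith [norm_nonneg (h - inner ℝ e h • e), norm_nonneg h, sq_nonneg (inner ℝ e h : ℝ)]

/-- Volume of the part of a ball in which the coordinate along `e` belongs to `Λ`. -/
lemma volume_slab_le {d : ℕ} [NeZero d] {e : Vec d} (he : ‖e‖ = 1) (c : Vec d)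
    {Λ : Set ℝ} (hΛ : MeasurableSet Λ) (R : ℝ) :
    volume {v : Vec d | ‖v - c‖ ≤ R ∧ inner ℝ e (v - c) ∈ Λ} ≤
      volume Λ * ENNReal.ofReal (2 * R) ^ (d - 1) := by
  have h1 : {v : Vec d | ‖v - c‖ ≤ R ∧ inner ℝ e (v - c) ∈ Λ} =
      (fun v => v + -c) ⁻¹' {v : Vec d | ‖v‖ ≤ R ∧ inner ℝ e v ∈ Λ} := by
    simp only [← sub_eq_add_neg]; rfl
  rw [h1, measure_preimage_add_right]
  refine volume_tube_le e he 0 hΛ R fun h hh => ⟨?_, hh.2⟩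
  rw [sub_zero]
  exact (norm_sub_inner_smul_le he h).trans hh.1

/-- Volume of the intersection of a ball and a cylinder. -/
lemma volume_cylinder_le {d : ℕ} [NeZero d] {e : Vec d} (he : ‖e‖ = 1) (c w : Vec d)
    (R r : ℝ) :
    volume {v : Vec d | ‖v - c‖ ≤ R ∧ ‖(v - w) - inner ℝ e (v - w) • e‖ ≤ r} ≤
      ENNReal.ofReal (2 * R) * ENNReal.ofReal (2 * r) ^ (d - 1) := by
  have h0 : volume (Icc (-R + inner ℝ e c) (R + inner ℝ e c)) = ENNReal.ofReal (2 * R) := by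
    rw [Real.volume_Icc]; congr 1; ring
  rw [← h0]
  refine volume_tube_le e he (w - inner ℝ e w • e) measurableSet_Icc r fun h hh => ⟨?_, ?_⟩
  · refine le_trans (le_of_eq ?_) hh.2
    rw [inner_sub_right]
    congr 1
    module
  · have h1 := abs_real_inner_le_norm e (h - c)
    rw [he, one_mul, inner_sub_right] at h1
    have := abs_le.1 (h1.trans hh.1)
    constructor <;> linarith

lemma volume_ball_le {d : ℕ} [NeZero d] (c : Vec d) (r : ℝ) :
    volume {v : Vec d | ‖v - c‖ ≤ r} ≤ ENNReal.ofReal (2 * r) ^ d := by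
  have he : ‖(e₁ : Vec d)‖ = 1 := by simp [e₁]
  have := volume_cylinder_le he c c r r
  have h2 : ENNReal.ofReal (2 * r) * ENNReal.ofReal (2 * r) ^ (d - 1) = ENNReal.ofReal (2 * r) ^ d := by
    rw [← pow_succ', Nat.sub_add_cancel (Nat.one_le_iff_ne_zero.2 (NeZero.ne d))]
  rw [← h2]
  refine le_trans (measure_mono ?_) this
  exact fun v hv => ⟨hv, (norm_sub_inner_smul_le he _).trans hv⟩

/-- Integral of a function in polar coordinates. -/
lemma lintegral_polar {d : ℕ} [NeZero d] {f : Vec d → ENNReal} (hf : Measurable f) :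
    ∫⁻ ω, (∫⁻ t in Ioi (0 : ℝ), ENNReal.ofReal (t ^ (d - 1)) * f (t • (ω : Vec d)))
      ∂((volume : Measure (Vec d)).toSphere) = ∫⁻ y, f y := by
  have hmp := (volume : Measure (Vec d)).measurePreserving_homeomorphUnitSphereProd
  have hfin : Module.finrank ℝ (Vec d) = d := by simp
  rw [hfin] at hmp
  have hme := (homeomorphUnitSphereProd (Vec d)).measurableEmbedding
  let g : Metric.sphere (0 : Vec d) 1 × Ioi (0 : ℝ) → ENNReal := fun p => f (p.2.1 • p.1.1)
  have hg : Measurable g := hf.comp (by fun_prop)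
  have h1 : ∫⁻ y, f y = ∫⁻ y : ({0}ᶜ : Set (Vec d)), f y ∂(Measure.comap Subtype.val volume) := by
    rw [lintegral_subtype_comap (measurableSet_singleton _).compl]
    rw [restrict_compl_singleton]
  rw [h1]
  have h2 : ∀ y : ({0}ᶜ : Set (Vec d)), f y = g (homeomorphUnitSphereProd (Vec d) y) := by
    intro y
    simp only [g]
    congr 1
    exact congrArg Subtype.val ((homeomorphUnitSphereProd (Vec d)).symm_apply_apply y).symm
  simp_rw [h2]
  rw [hmp.lintegral_comp hg, lintegral_prod _ hg.aemeasurable]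
  refine lintegral_congr fun ω => ?_
  rw [Measure.volumeIoiPow, lintegral_withDensity_eq_lintegral_mul _ (by fun_prop) (by fun_prop)]
  rw [← lintegral_subtype_comap measurableSet_Ioi]
  rfl

lemma norm_sphere (ω : Metric.sphere (0 : Vec d) 1) : ‖(ω : Vec d)‖ = 1 := by
  simp

open scoped Pointwise in
/-- The surface measure of the slab of half-width `τ` of the sphere. -/
lemma toSphere_slab_le {e : Vec d} (he : ‖e‖ = 1) {τ : ℝ} :
    (volume : Measure (Vec d)).toSphere {ω | |inner ℝ e (ω : Vec d)| ≤ τ} ≤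
      ENNReal.ofReal (d * 2 ^ d * τ) := by
  have hm : MeasurableSet {ω : Metric.sphere (0 : Vec d) 1 | |inner ℝ e (ω : Vec d)| ≤ τ} := by
    refine measurableSet_le ?_ measurable_const
    have : Measurable fun ω : Metric.sphere (0 : Vec d) 1 => (inner ℝ e (ω : Vec d) : ℝ) := by
      fun_prop
    exact this.abs
  rcases lt_or_ge τ 0 with hτ | hτ
  · have : {ω : Metric.sphere (0 : Vec d) 1 | |inner ℝ e (ω : Vec d)| ≤ τ} = ∅ := by
      ext ω
      simp only [mem_ofPred_eq, mem_empty_iff_false, iff_false, not_le]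
      exact hτ.trans_le (abs_nonneg _)
    rw [this]; simp
  -- The surface measure is `d` times the volume of the cone over the set, and this cone lies in a
  -- slab of the unit ball.
  rw [Measure.toSphere_apply' _ hm]
  have h1 : Ioo (0 : ℝ) 1 • (Subtype.val '' {ω : Metric.sphere (0 : Vec d) 1 |
      |inner ℝ e (ω : Vec d)| ≤ τ}) ⊆
      {v : Vec d | ‖v - 0‖ ≤ 1 ∧ inner ℝ e (v - 0) ∈ Icc (-τ) τ} := by
    rintro _ ⟨t, ht, _, ⟨ω, hω, rfl⟩, rfl⟩
    simp only [sub_zero, mem_ofPred_eq, norm_smul, norm_sphere, inner_smul_right] at hω ⊢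
    have ht' : |t| = t := abs_of_pos ht.1
    refine ⟨by simpa [ht'] using ht.2.le, ?_⟩
    rw [mem_Icc, ← abs_le, abs_mul, ht']
    nlinarith [abs_nonneg (inner ℝ e (ω : Vec d)), ht.1, ht.2]
  calc _ ≤ (d : ENNReal) * (volume (Icc (-τ) τ) * ENNReal.ofReal (2 * 1) ^ (d - 1)) := by
        gcongr
        · simp
        · exact (measure_mono h1).trans (volume_slab_le he 0 measurableSet_Icc 1)
    _ = ENNReal.ofReal (d * ((2 * τ) * 2 ^ (d - 1))) := by
        rw [Real.volume_Icc, mul_one, ENNReal.ofReal_mul (by positivity),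
          ENNReal.ofReal_mul (by positivity),
          ENNReal.ofReal_natCast, ENNReal.ofReal_pow (by norm_num)]
        congr 3
        ring
    _ = _ := by
        congr 1
        have : (2 : ℝ) ^ d = 2 * 2 ^ (d - 1) := by
          rw [← pow_succ', Nat.sub_add_cancel (Nat.one_le_iff_ne_zero.2 (NeZero.ne d))]
        rw [this]; ring

lemma toSphere_univ_le :
    (volume : Measure (Vec d)).toSphere univ ≤ ENNReal.ofReal (d * 2 ^ d) := by
  have he : ‖(e₁ : Vec d)‖ = 1 := by simp [e₁]
  refine le_trans (measure_mono fun ω _ => ?_) ((toSphere_slab_le he (τ := 1)).trans (by simp))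
  have := abs_real_inner_le_norm (e₁ : Vec d) ω
  rwa [he, norm_sphere, one_mul] at this

/-- A set of adjunction parameters is measured by its sections. -/
lemma adjMeasure_le_lintegral {A : Set (AdjParam d)} (hA : MeasurableSet A)
    {B : Metric.sphere (0 : Vec d) 1 → ENNReal} (h : ∀ ω, volume {v | (ω, v) ∈ A} ≤ B ω) :
    adjMeasure d A ≤ ∫⁻ ω, B ω ∂((volume : Measure (Vec d)).toSphere) := by
  rw [adjMeasure, Measure.prod_apply hA]
  exact lintegral_mono h

lemma adjMeasure_le_const {A : Set (AdjParam d)} (hA : MeasurableSet A)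
    {B : ENNReal} (h : ∀ ω, volume {v | (ω, v) ∈ A} ≤ B) :
    adjMeasure d A ≤ ENNReal.ofReal (d * 2 ^ d) * B := by
  refine (adjMeasure_le_lintegral hA h).trans ?_
  rw [lintegral_const, mul_comm]
  exact mul_le_mul_left toSphere_univ_le B

lemma adjMeasure_prod_le (s : Set (Metric.sphere (0 : Vec d) 1)) (t : Set (Vec d)) :
    adjMeasure d (s ×ˢ t) ≤ (volume : Measure (Vec d)).toSphere s * volume t :=
  (Measure.prod_prod s t).le

lemma adjMeasure_univ_prod_le (t : Set (Vec d)) :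
    adjMeasure d {p | p.2 ∈ t} ≤ ENNReal.ofReal (d * 2 ^ d) * volume t := by
  have : {p : AdjParam d | p.2 ∈ t} = univ ×ˢ t := by ext; simp
  rw [this]
  exact (adjMeasure_prod_le _ _).trans (mul_le_mul_left toSphere_univ_le _)

/-! ### Parameters for which a component of the relative velocity lies in a given set. -/

/-- Measure of the parameters for which the component of `v - c` along `ω` lies in `Q`: the bound
is the integral over `Q` of `‖y‖ ^ (1 - d)`, or of anything larger. -/
lemma adjMeasure_component_le (c : Vec d) (H : ℝ) {w : Vec d → ENNReal} (hw : Measurable w)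
    {Q : Set (Vec d)} (hQ : ∀ y ∈ Q, 1 ≤ ENNReal.ofReal (‖y‖ ^ (d - 1)) * w y) :
    adjMeasure d {p | ‖p.2 - c‖ ≤ H ∧ 0 < inner ℝ (p.1 : Vec d) (p.2 - c) ∧
      inner ℝ (p.1 : Vec d) (p.2 - c) • (p.1 : Vec d) ∈ Q} ≤
      ENNReal.ofReal (2 * H) ^ (d - 1) * ∫⁻ y, w y := by
  -- `Q` need not be measurable; it is replaced by the measurable condition supplied by `hQ`.
  let A : Set (AdjParam d) := {p | ‖p.2 - c‖ ≤ H ∧ (0 < inner ℝ (p.1 : Vec d) (p.2 - c) ∧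
      1 ≤ ENNReal.ofReal (inner ℝ (p.1 : Vec d) (p.2 - c) ^ (d - 1)) *
        w (inner ℝ (p.1 : Vec d) (p.2 - c) • (p.1 : Vec d)))}
  have hi : Measurable fun p : AdjParam d => (inner ℝ (p.1 : Vec d) (p.2 - c) : ℝ) :=
    Measurable.inner (by fun_prop) (by fun_prop)
  have hA : MeasurableSet A := by
    have h1 : Measurable fun p : AdjParam d => ‖p.2 - c‖ := by fun_prop
    have h2 := (ENNReal.measurable_ofReal.comp (hi.pow_const (d - 1))).mul
      (hw.comp (hi.smul (measurable_subtype_coe.comp measurable_fst)))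
    exact (measurableSet_le h1 measurable_const).inter
      ((measurableSet_lt measurable_const hi).inter
        (measurableSet_le (measurable_const (a := (1 : ENNReal))) h2))
  have hsub : {p : AdjParam d | ‖p.2 - c‖ ≤ H ∧ 0 < inner ℝ (p.1 : Vec d) (p.2 - c) ∧
      inner ℝ (p.1 : Vec d) (p.2 - c) • (p.1 : Vec d) ∈ Q} ⊆ A := by
    rintro p ⟨h1, h2, h3⟩
    refine ⟨h1, h2, ?_⟩
    have := hQ _ h3
    rwa [norm_smul, norm_sphere, mul_one, Real.norm_of_nonneg h2.le] at this
  refine (measure_mono hsub).trans ?_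
  have hΛ : ∀ ω : Metric.sphere (0 : Vec d) 1, MeasurableSet {t : ℝ | 0 < t ∧
      1 ≤ ENNReal.ofReal (t ^ (d - 1)) * w (t • (ω : Vec d))} := by
    intro ω
    have h2 := (ENNReal.measurable_ofReal.comp (measurable_id.pow_const (d - 1))).mul
      (hw.comp (measurable_id.smul (measurable_const (a := (ω : Vec d)))))
    exact (measurableSet_lt measurable_const measurable_id).inter
      (measurableSet_le (measurable_const (a := (1 : ENNReal))) h2)
  refine (adjMeasure_le_lintegral hA fun ω =>
    volume_slab_le (norm_sphere ω) c (hΛ ω) H).trans ?_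
  rw [lintegral_mul_const'' , mul_comm, ← lintegral_polar hw]
  · refine mul_le_mul_right (lintegral_mono fun ω => ?_) _
    -- Where `t` is admissible, `t^(d-1) * w (t ω)` is at least one, so its integral bounds the
    -- length of the admissible set. Integrating over `ω` then recovers the integral of `w` in polar
    -- coordinates.
    rw [← lintegral_indicator_one (hΛ ω), ← lintegral_indicator measurableSet_Ioi]
    refine lintegral_mono fun t => ?_
    by_cases ht : t ∈ {t : ℝ | 0 < t ∧ 1 ≤ ENNReal.ofReal (t ^ (d - 1)) * w (t • (ω : Vec d))}
    · rw [indicator_of_mem ht, indicator_of_mem (show t ∈ Ioi (0:ℝ) from ht.1)]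
      exact ht.2
    · rw [indicator_of_notMem ht]; exact zero_le
  · refine Measurable.aemeasurable ?_
    refine measurable_measure_prodMk_left (s := {q : Metric.sphere (0 : Vec d) 1 × ℝ | 0 < q.2 ∧
      1 ≤ ENNReal.ofReal (q.2 ^ (d - 1)) * w (q.2 • (q.1 : Vec d))}) ?_
    have h2 := (ENNReal.measurable_ofReal.comp
      ((measurable_snd (α := Metric.sphere (0 : Vec d) 1) (β := ℝ)).pow_const (d - 1))).mul
      (hw.comp (measurable_snd.smul (measurable_subtype_coe.comp measurable_fst)))
    exact (measurableSet_lt measurable_const measurable_snd).inter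
      (measurableSet_le (measurable_const (a := (1 : ENNReal))) h2)

/-- Stretching a set along a direction multiplies its volume. -/
lemma volume_stretch_le {ω : Vec d} (hω : ‖ω‖ = 1) (A : Set (Vec d)) {H τ : ℝ} (hH : 0 < H)
    (hτ : 0 < τ) :
    volume {W : Vec d | |inner ℝ ω W| ≤ H ∧ W - inner ℝ ω W • ω ∈ A} ≤
      ENNReal.ofReal (H / τ) *
        volume {W : Vec d | |inner ℝ ω W| ≤ τ ∧ W - inner ℝ ω W • ω ∈ A} := by
  -- `L` contracts the direction `ω` by the factor `τ / H` and fixes the orthogonal part, so its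
  -- determinant is `τ / H`.
  let L : Vec d →ₗ[ℝ] Vec d := LinearMap.transvection (innerₛₗ ℝ ω) ((τ / H - 1) • ω)
  have hL : ∀ W, L W = W + inner ℝ ω W • (τ / H - 1) • ω := fun W => rfl
  have hωω : inner ℝ ω ω = (1 : ℝ) := by rw [real_inner_self_eq_norm_sq, hω]; norm_num
  have hdet : LinearMap.det L = τ / H := by
    rw [LinearMap.transvection.det]
    simp [hω]
  have hi : ∀ W, inner ℝ ω (L W) = τ / H * inner ℝ ω W := by
    intro W
    rw [hL, inner_add_right, inner_smul_right, inner_smul_right, hωω]; ring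
  have hsub : {W : Vec d | |inner ℝ ω W| ≤ H ∧ W - inner ℝ ω W • ω ∈ A} ⊆
      L ⁻¹' {W : Vec d | |inner ℝ ω W| ≤ τ ∧ W - inner ℝ ω W • ω ∈ A} := by
    rintro W ⟨h1, h2⟩
    constructor
    · rw [hi, abs_mul, abs_of_pos (div_pos hτ hH)]
      calc τ / H * |inner ℝ ω W| ≤ τ / H * H := by gcongr
        _ = τ := by field_simp
    · have : L W - inner ℝ ω (L W) • ω = W - inner ℝ ω W • ω := by
        rw [hi, hL]; module
      rwa [this]
  refine (measure_mono hsub).trans (le_of_eq ?_)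
  rw [Measure.addHaar_preimage_linearMap _ (by rw [hdet]; positivity), hdet, inv_div,
    abs_of_pos (div_pos hH hτ)]

lemma lintegral_rpow_Ioc_le {H κ : ℝ} (hH : 0 < H) (hκ : 0 < κ) :
    ∫⁻ t in Ioc 0 H, ENNReal.ofReal t ^ (κ - 1) ≤ ENNReal.ofReal (H ^ κ / κ) := by
  have h1 : ∀ t ∈ Ioc 0 H, ENNReal.ofReal t ^ (κ - 1) = ENNReal.ofReal (t ^ (κ - 1)) :=
    fun t ht => ENNReal.ofReal_rpow_of_pos ht.1
  rw [setLIntegral_congr_fun measurableSet_Ioc h1]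
  have hi : IntervalIntegrable (fun t : ℝ => t ^ (κ - 1)) volume 0 H :=
    intervalIntegral.intervalIntegrable_rpow' (by linarith)
  rw [← ofReal_integral_eq_lintegral_ofReal
    ((intervalIntegrable_iff_integrableOn_Ioc_of_le hH.le).1 hi)
    ((ae_restrict_mem measurableSet_Ioc).mono fun t ht => Real.rpow_nonneg ht.1.le _),
    ← intervalIntegral.integral_of_le hH.le, integral_rpow (Or.inl (by linarith))]
  apply ENNReal.ofReal_le_ofReal
  rw [sub_add_cancel, Real.zero_rpow hκ.ne', sub_zero]

/-- The weight `|t| ^ (κ - 1)` on `[-H, H]`. -/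
def powWeight (H κ : ℝ) : ℝ → ENNReal :=
  (Icc (-H) H).indicator fun t => ENNReal.ofReal |t| ^ (κ - 1)

lemma measurable_powWeight (H κ : ℝ) : Measurable (powWeight H κ) := by
  refine Measurable.indicator ?_ measurableSet_Icc
  exact (ENNReal.measurable_ofReal.comp measurable_norm).pow_const _

lemma lintegral_powWeight_le {H κ : ℝ} (hH : 0 < H) (hκ : 0 < κ) :
    ∫⁻ t, powWeight H κ t ≤ ENNReal.ofReal (2 * H ^ κ / κ) := by
  have h0 : ∫⁻ t in Ioc 0 H, ENNReal.ofReal |t| ^ (κ - 1) ≤ ENNReal.ofReal (H ^ κ / κ) := by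
    refine le_trans (le_of_eq ?_) (lintegral_rpow_Ioc_le hH hκ)
    refine setLIntegral_congr_fun measurableSet_Ioc fun t ht => ?_
    rw [abs_of_pos ht.1]
  have h2 : ∫⁻ t in Icc (-H) 0, ENNReal.ofReal |t| ^ (κ - 1) ≤ ENNReal.ofReal (H ^ κ / κ) := by
    have := (Measure.measurePreserving_neg (volume : Measure ℝ)).setLIntegral_comp_preimage
      (measurableSet_Icc (a := 0) (b := H)) (f := fun t => ENNReal.ofReal |t| ^ (κ - 1))
      ((ENNReal.measurable_ofReal.comp measurable_norm).pow_const _)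
    simp only [Set.neg_preimage, Set.neg_Icc, neg_zero, abs_neg] at this
    rw [this, setLIntegral_congr Ioc_ae_eq_Icc.symm]
    exact h0
  rw [powWeight, lintegral_indicator measurableSet_Icc, ← Icc_union_Ioc_eq_Icc (b := 0)
    (by linarith) hH.le]
  refine (lintegral_union_le _ _ _).trans ((add_le_add h2 h0).trans (le_of_eq ?_))
  rw [← ENNReal.ofReal_add (by positivity) (by positivity)]
  congr 1
  ring

/-- A point of norm at least `m` whose component along a unit vector is `t`: negative powers of
the norm are controlled by the integrable weight. -/
lemma one_le_mul_powWeight {m H κ p x t : ℝ} (hm : 0 < m) (hκ1 : κ < 1)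
    (hp : 1 - κ ≤ p) (hx : m ≤ x) (ht : |t| ≤ x) (hH : |t| ≤ H) :
    1 ≤ ENNReal.ofReal (x ^ p) * (ENNReal.ofReal (m ^ (-(p - 1 + κ))) * powWeight H κ t) := by
  have hx0 : 0 < x := hm.trans_le hx
  rw [powWeight, indicator_of_mem (show t ∈ Icc (-H) H from abs_le.1 hH)]
  -- For `t = 0` the weight is a negative power of zero, which is infinite in `ENNReal`, and the
  -- inequality is trivial.
  rcases eq_or_lt_of_le (abs_nonneg t) with h0 | h0
  · rw [← h0, ENNReal.ofReal_zero, ENNReal.zero_rpow_of_neg (by linarith), ENNReal.mul_top,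
      ENNReal.mul_top]
    · exact le_top
    · simpa using Real.rpow_pos_of_pos hx0 p
    · simpa using Real.rpow_pos_of_pos hm _
  · rw [ENNReal.ofReal_rpow_of_pos h0, ← ENNReal.ofReal_mul (by positivity),
      ← ENNReal.ofReal_mul (by positivity), ← ENNReal.ofReal_one]
    apply ENNReal.ofReal_le_ofReal
    -- The power of `x` is shared: the exponent `p - 1 + κ` is bounded below through `m`, and the
    -- exponent `1 - κ` through `|t|`.
    have h1 : x ^ p = x ^ (p - 1 + κ) * x ^ (1 - κ) := by
      rw [← Real.rpow_add hx0]; congr 1; ring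
    have h2 : m ^ (p - 1 + κ) ≤ x ^ (p - 1 + κ) := Real.rpow_le_rpow hm.le hx (by linarith)
    have h3 : |t| ^ (1 - κ) ≤ x ^ (1 - κ) := Real.rpow_le_rpow h0.le ht (by linarith)
    calc (1 : ℝ) = (m ^ (p - 1 + κ) * |t| ^ (1 - κ)) * (m ^ (-(p - 1 + κ)) * |t| ^ (κ - 1)) := by
          rw [mul_mul_mul_comm, ← Real.rpow_add hm, ← Real.rpow_add h0]; simp
      _ ≤ x ^ p * (m ^ (-(p - 1 + κ)) * |t| ^ (κ - 1)) := by
          rw [h1]; gcongr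

/-- The component of `v - c` along `ω` lies in a cylinder, away from the origin. -/
lemma adjMeasure_component_cylinder_le (c q : Vec d) {e : Vec d} (he : ‖e‖ = 1)
    (hd : 2 ≤ d) {H m τ κ : ℝ} (hm : 0 < m) (hH : 0 < H) (hκ : 0 < κ) (hκ1 : κ < 1) (hτ : 0 ≤ τ) :
    adjMeasure d {p | ‖p.2 - c‖ ≤ H ∧ 0 < inner ℝ (p.1 : Vec d) (p.2 - c) ∧
      inner ℝ (p.1 : Vec d) (p.2 - c) • (p.1 : Vec d) ∈
        {y | m ≤ ‖y‖ ∧ ‖y‖ ≤ H ∧ ‖(y - q) - inner ℝ e (y - q) • e‖ ≤ τ}} ≤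
      ENNReal.ofReal ((2 * H) ^ (d - 1) *
        (m ^ (-((d : ℝ) - 2 + κ)) * (2 * H ^ κ / κ * (2 * τ) ^ (d - 1)))) := by
  let T : Set (Vec d) := {y | ‖(y - q) - inner ℝ e (y - q) • e‖ ≤ τ}
  have hT : MeasurableSet T := measurableSet_le (by fun_prop) measurable_const
  -- The polar weight `‖y‖^(1-d)` is split: the power `κ - 1` is charged to the coordinate along the
  -- axis, where it is integrable, and the remaining power costs only a negative power of `m`.
  let M : ENNReal := ENNReal.ofReal (m ^ (-((d : ℝ) - 2 + κ)))
  let w : Vec d → ENNReal := T.indicator fun y => M * powWeight H κ (inner ℝ e y)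
  have hw : Measurable w := by
    refine Measurable.indicator ?_ hT
    exact ((measurable_powWeight H κ).comp (by fun_prop)).const_mul _
  have hd' : ((d - 1 : ℕ) : ℝ) = (d : ℝ) - 1 := by
    rw [Nat.cast_sub (by omega), Nat.cast_one]
  have hd2 : (2 : ℝ) ≤ d := by exact_mod_cast hd
  refine (adjMeasure_component_le c H hw ?_).trans ?_
  · rintro y ⟨h1, h2, h3⟩
    have hi : |inner ℝ e y| ≤ ‖y‖ := by simpa [he] using abs_real_inner_le_norm e y
    have := one_le_mul_powWeight (p := (d : ℝ) - 1) hm hκ1 (by linarith) h1 hi (hi.trans h2)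
    rw [← hd', Real.rpow_natCast] at this
    simp only [w]
    rw [indicator_of_mem (show y ∈ T from h3)]
    have h4 : ((d - 1 : ℕ) : ℝ) - 1 + κ = (d : ℝ) - 2 + κ := by rw [hd']; ring
    rwa [h4] at this
  · have h5 : ∫⁻ y, w y ≤ ∫⁻ t, (M * powWeight H κ t) * ENNReal.ofReal (2 * τ) ^ (d - 1) := by
      refine lintegral_tube_le e he (q - inner ℝ e q • e)
        ((measurable_powWeight H κ).const_mul _) measurable_const fun y hy => ?_
      have hyT : y ∈ T := by
        by_contra h'
        exact hy (indicator_of_notMem h' _)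
      refine ⟨le_trans (le_of_eq ?_) hyT, by simp only [w]; rw [indicator_of_mem hyT]⟩
      rw [inner_sub_right]
      congr 1
      module
    rw [lintegral_mul_const _ ((measurable_powWeight H κ).const_mul _),
      lintegral_const_mul _ (measurable_powWeight H κ)] at h5
    calc _ ≤ ENNReal.ofReal (2 * H) ^ (d - 1) * ((M * ENNReal.ofReal (2 * H ^ κ / κ)) *
          ENNReal.ofReal (2 * τ) ^ (d - 1)) := by
            refine mul_le_mul_right (h5.trans ?_) _
            refine mul_le_mul_left (mul_le_mul_right (lintegral_powWeight_le hH hκ) _) _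
      _ = _ := by
        rw [← ENNReal.ofReal_pow (by positivity), ← ENNReal.ofReal_pow (by positivity),
          ← ENNReal.ofReal_mul (by positivity), ← ENNReal.ofReal_mul (by positivity),
          ← ENNReal.ofReal_mul (by positivity)]
        congr 1; ring

lemma measurableSet_cylinder_shell (q e : Vec d) (m H τ : ℝ) :
    MeasurableSet {y : Vec d | m ≤ ‖y‖ ∧ ‖y‖ ≤ H ∧ ‖(y - q) - inner ℝ e (y - q) • e‖ ≤ τ} := by
  have h1 : Measurable fun y : Vec d => ‖y‖ := by fun_prop
  have h2 : Measurable fun y : Vec d => ‖(y - q) - inner ℝ e (y - q) • e‖ := by fun_prop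
  exact (measurableSet_le measurable_const h1).inter
    ((measurableSet_le h1 measurable_const).inter (measurableSet_le h2 measurable_const))

/-- The component of `v - c` orthogonal to `ω` lies in a cylinder, away from the origin. -/
lemma adjMeasure_orthogonal_cylinder_le (c q : Vec d) {e : Vec d} (he : ‖e‖ = 1)
    {H m τ κ : ℝ} (hm : 0 < m) (hκ : 0 < κ) (hκ1 : κ < 1) (hτ : 0 < τ) (hτH : τ ≤ H) :
    adjMeasure d {p | ‖p.2 - c‖ ≤ H ∧
      (p.2 - c) - inner ℝ (p.1 : Vec d) (p.2 - c) • (p.1 : Vec d) ∈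
        {y | m ≤ ‖y‖ ∧ ‖(y - q) - inner ℝ e (y - q) • e‖ ≤ τ}} ≤
      ENNReal.ofReal (H * (d * 2 ^ d) *
        (m ^ (-κ) * (2 * (2 * H) ^ κ / κ * (4 * τ) ^ (d - 1)))) := by
  have hH : 0 < H := hτ.trans_le hτH
  let A : Set (Vec d) := {y | m ≤ ‖y‖ ∧ ‖y‖ ≤ H ∧ ‖(y - q) - inner ℝ e (y - q) • e‖ ≤ τ}
  have hA : MeasurableSet A := measurableSet_cylinder_shell _ _ _ _ _
  let pr : AdjParam d → Vec d := fun p => p.2 - inner ℝ (p.1 : Vec d) p.2 • (p.1 : Vec d)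
  have hω : Measurable fun p : AdjParam d => (p.1 : Vec d) :=
    measurable_subtype_coe.comp measurable_fst
  have hi : Measurable fun p : AdjParam d => (inner ℝ (p.1 : Vec d) p.2 : ℝ) :=
    hω.inner measurable_snd
  have hpr : Measurable pr := measurable_snd.sub (hi.smul hω)
  let A1 : Set (AdjParam d) := {p | |inner ℝ (p.1 : Vec d) (p.2 - c)| ≤ H ∧
    (p.2 - c) - inner ℝ (p.1 : Vec d) (p.2 - c) • (p.1 : Vec d) ∈ A}
  have hsh : Measurable fun p : AdjParam d => ((p.1, p.2 - c) : AdjParam d) := by fun_prop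
  have hA1 : MeasurableSet A1 :=
    (measurableSet_le (hi.comp hsh).norm measurable_const).inter ((hpr.comp hsh) hA)
  let A2 : Set (AdjParam d) := {p | |inner ℝ (p.1 : Vec d) p.2| ≤ τ ∧ pr p ∈ A}
  have hA2 : MeasurableSet A2 := (measurableSet_le hi.norm measurable_const).inter (hpr hA)
  have hprn : ∀ p : AdjParam d, ‖pr p‖ ≤ ‖p.2‖ := fun p =>
    norm_sub_inner_smul_le (norm_sphere p.1) p.2
  have step1 : adjMeasure d {p | ‖p.2 - c‖ ≤ H ∧
      (p.2 - c) - inner ℝ (p.1 : Vec d) (p.2 - c) • (p.1 : Vec d) ∈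
        {y | m ≤ ‖y‖ ∧ ‖(y - q) - inner ℝ e (y - q) • e‖ ≤ τ}} ≤ adjMeasure d A1 := by
    refine measure_mono fun p hp => ⟨?_, hp.2.1, ?_, hp.2.2⟩
    · have := abs_real_inner_le_norm (p.1 : Vec d) (p.2 - c)
      rw [norm_sphere, one_mul] at this
      exact this.trans hp.1
    · exact (norm_sub_inner_smul_le (norm_sphere p.1) _).trans hp.1
  -- The condition concerns only the part of `v - c` orthogonal to `ω`. Shrinking the component
  -- along `ω` from `H` to `τ` costs the factor `H / τ`, and brings the whole vector within `2 * τ`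
  -- of the axis of the cylinder.
  have step2 : adjMeasure d A1 ≤ ENNReal.ofReal (H / τ) * adjMeasure d A2 := by
    refine (adjMeasure_le_lintegral hA1 (B := fun ω => ENNReal.ofReal (H / τ) *
      volume {v | (ω, v) ∈ A2}) fun ω => ?_).trans (le_of_eq ?_)
    · have h1 : {v : Vec d | (ω, v) ∈ A1} = (fun v => v + -c) ⁻¹'
          {W : Vec d | |inner ℝ (ω : Vec d) W| ≤ H ∧ W - inner ℝ (ω : Vec d) W • (ω : Vec d) ∈ A} := by
        simp only [A1, ← sub_eq_add_neg]; rfl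
      rw [h1, measure_preimage_add_right]
      exact volume_stretch_le (norm_sphere ω) A hH hτ
    · rw [adjMeasure, Measure.prod_apply hA2]
      exact lintegral_const_mul _ (measurable_measure_prodMk_left hA2)
  let T : Set (Vec d) := {y | m ≤ ‖y‖ ∧ ‖y‖ ≤ 2 * H ∧ ‖(y - q) - inner ℝ e (y - q) • e‖ ≤ 2 * τ}
  have hT : MeasurableSet T := measurableSet_cylinder_shell _ _ _ _ _
  let K : ENNReal := ENNReal.ofReal (d * 2 ^ d * τ)
  let M : ENNReal := ENNReal.ofReal (m ^ (-κ))
  let w : Vec d → ENNReal := T.indicator fun y => K * (M * powWeight (2 * H) κ (inner ℝ e y))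
  -- Fubini in the other order: for fixed `y` the condition `|⟪ω, y⟫| ≤ τ` defines a slab of the
  -- sphere of measure of order `τ / ‖y‖`. This `τ` compensates the loss `H / τ` of the stretching.
  have step3 : adjMeasure d A2 ≤ ∫⁻ y, w y := by
    rw [adjMeasure, Measure.prod_apply_symm hA2]
    refine lintegral_mono fun y => ?_
    rcases (((fun ω : Metric.sphere (0 : Vec d) 1 => (ω, y)) ⁻¹' A2)).eq_empty_or_nonempty with h | ⟨ω, hy⟩
    · rw [h]; simp
    · have hdec : y = pr (ω, y) + inner ℝ (ω : Vec d) y • (ω : Vec d) := by simp [pr]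
      have hn : ‖inner ℝ (ω : Vec d) y • (ω : Vec d)‖ ≤ τ := by
        rw [norm_smul, norm_sphere, mul_one]; exact hy.1
      have hym : m ≤ ‖y‖ := hy.2.1.trans (hprn (ω, y))
      have hyT : y ∈ T := by
        refine ⟨hym, ?_, ?_⟩
        · rw [hdec]
          refine (norm_add_le _ _).trans ?_
          linarith [hy.2.2.1]
        · have h1 : y - q = (pr (ω, y) - q) + inner ℝ (ω : Vec d) y • (ω : Vec d) := by
            rw [add_comm, ← add_sub_assoc, add_comm, ← hdec]
          have h2 : (y - q) - inner ℝ e (y - q) • e =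
              ((pr (ω, y) - q) - inner ℝ e (pr (ω, y) - q) • e) +
              (inner ℝ (ω : Vec d) y • (ω : Vec d) -
                inner ℝ e (inner ℝ (ω : Vec d) y • (ω : Vec d)) • e) := by
            rw [h1, inner_add_right]; module
          rw [h2]
          refine (norm_add_le _ _).trans ?_
          linarith [hy.2.2.2, (norm_sub_inner_smul_le he (inner ℝ (ω : Vec d) y • (ω : Vec d))).trans hn]
      have hy0 : 0 < ‖y‖ := hm.trans_le hym
      have h3 : (volume : Measure (Vec d)).toSphere ((fun ω => (ω, y)) ⁻¹' A2) ≤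
          ENNReal.ofReal (d * 2 ^ d * (τ / ‖y‖)) := by
        refine le_trans (measure_mono ?_) (toSphere_slab_le (e := ‖y‖⁻¹ • y) ?_)
        · intro ω' hω'
          have := hω'.1
          simp only [mem_ofPred_eq, inner_smul_left, RCLike.conj_to_real, abs_mul, abs_inv, abs_norm]
          rw [real_inner_comm, inv_mul_eq_div]
          gcongr
        · rw [norm_smul, norm_inv, norm_norm, inv_mul_cancel₀ hy0.ne']
      refine h3.trans ?_
      simp only [w]
      rw [indicator_of_mem hyT]
      have hi : |inner ℝ e y| ≤ ‖y‖ := by simpa [he] using abs_real_inner_le_norm e y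
      have h4 := one_le_mul_powWeight (p := 1) hm hκ1 (by linarith) hym hi (hi.trans hyT.2.1)
      rw [Real.rpow_one, show (1 : ℝ) - 1 + κ = κ by ring] at h4
      calc ENNReal.ofReal (d * 2 ^ d * (τ / ‖y‖)) = ENNReal.ofReal (d * 2 ^ d * (τ / ‖y‖)) * 1 := by
            rw [mul_one]
        _ ≤ ENNReal.ofReal (d * 2 ^ d * (τ / ‖y‖)) * (ENNReal.ofReal ‖y‖ *
              (M * powWeight (2 * H) κ (inner ℝ e y))) := by
            exact mul_le_mul_right h4 _
        _ = _ := by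
            rw [← mul_assoc, ← ENNReal.ofReal_mul (by positivity)]
            congr 2
            field_simp
  have step4 : ∫⁻ y, w y ≤ ∫⁻ t, (K * (M * powWeight (2 * H) κ t)) *
      ENNReal.ofReal (2 * (2 * τ)) ^ (d - 1) := by
    refine lintegral_tube_le e he (q - inner ℝ e q • e)
      (((measurable_powWeight _ κ).const_mul _).const_mul _) measurable_const fun y hy => ?_
    have hyT : y ∈ T := by
      by_contra h'
      exact hy (indicator_of_notMem h' _)
    refine ⟨le_trans (le_of_eq ?_) hyT.2.2, by simp only [w]; rw [indicator_of_mem hyT]⟩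
    rw [inner_sub_right]
    congr 1
    module
  rw [lintegral_mul_const _ (((measurable_powWeight _ κ).const_mul _).const_mul _),
    lintegral_const_mul _ ((measurable_powWeight _ κ).const_mul _),
    lintegral_const_mul _ (measurable_powWeight _ κ)] at step4
  calc _ ≤ ENNReal.ofReal (H / τ) * (K * (M * ENNReal.ofReal (2 * (2 * H) ^ κ / κ)) *
        ENNReal.ofReal (2 * (2 * τ)) ^ (d - 1)) := by
        refine step1.trans (step2.trans (mul_le_mul_right (step3.trans (step4.trans ?_)) _))
        refine mul_le_mul_left (mul_le_mul_right (mul_le_mul_right ?_ _) _) _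
        exact lintegral_powWeight_le (by positivity) hκ
    _ = _ := by
        rw [← ENNReal.ofReal_pow (by positivity), ← ENNReal.ofReal_mul (by positivity),
          ← ENNReal.ofReal_mul (by positivity), ← ENNReal.ofReal_mul (by positivity),
          ← ENNReal.ofReal_mul (by positivity)]
        congr 1
        field_simp
        ring

/-! ### Relative velocities that lead to an encounter or to the wall. -/

lemma norm_inv_norm_smul {p : Vec d} (hp : 0 < ‖p‖) : ‖‖p‖⁻¹ • p‖ = 1 := by
  rw [norm_smul, norm_inv, norm_norm, inv_mul_cancel₀ hp.ne']

lemma inner_self_eq_one {e : Vec d} (he : ‖e‖ = 1) : inner ℝ e e = (1 : ℝ) := by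
  rw [real_inner_self_eq_norm_sq, he, one_pow]

/-- The part of `p - u • h` orthogonal to `p`. -/
lemma norm_orthogonal_le {p h : Vec d} (hp : 0 < ‖p‖) {u D : ℝ} (hu : 0 ≤ u)
    (hD : ‖p - u • h‖ ≤ D) :
    u * ‖h - inner ℝ (‖p‖⁻¹ • p) h • ‖p‖⁻¹ • p‖ ≤ D := by
  set e := ‖p‖⁻¹ • p with he'
  have he : ‖e‖ = 1 := norm_inv_norm_smul hp
  have hpe : p = ‖p‖ • e := by rw [he', smul_smul, mul_inv_cancel₀ hp.ne', one_smul]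
  have h1 : (p - u • h) - inner ℝ e (p - u • h) • e = (-u) • (h - inner ℝ e h • e) := by
    have : inner ℝ e (p - u • h) = ‖p‖ - u * inner ℝ e h := by
      rw [inner_sub_right, inner_smul_right]
      nth_rw 1 [hpe]
      rw [inner_smul_right, inner_self_eq_one he, mul_one]
    rw [this]
    nth_rw 1 [hpe]
    module
  have h2 := (norm_sub_inner_smul_le he (p - u • h)).trans hD
  rwa [h1, norm_smul, norm_neg, Real.norm_of_nonneg hu] at h2

/-- A relative velocity that leads close to the origin belongs to a thin cylinder. -/
lemma norm_orthogonal_le_of_close {p h : Vec d} {u D H : ℝ} (hu : 0 ≤ u) (hD0 : 0 < D)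
    (hp : 2 * D ≤ ‖p‖) (hH : ‖h‖ ≤ H) (hD : ‖p - u • h‖ ≤ D) :
    ‖h - inner ℝ (‖p‖⁻¹ • p) h • ‖p‖⁻¹ • p‖ ≤ 2 * D * H / ‖p‖ := by
  have hp0 : 0 < ‖p‖ := by linarith
  have h1 := norm_orthogonal_le hp0 hu hD
  -- Coming within `D` from a distance of at least `2 * D` means travelling at least half of the
  -- initial distance, so `u` is bounded below.
  have h2 : ‖p‖ / 2 ≤ u * H := by
    have h3 : ‖p‖ ≤ ‖p - u • h‖ + ‖u • h‖ := by
      simpa using norm_add_le (p - u • h) (u • h)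
    rw [norm_smul, Real.norm_of_nonneg hu] at h3
    nlinarith [mul_le_mul_of_nonneg_left hH hu]
  rw [le_div_iff₀ hp0]
  have hH0 : 0 ≤ H := (norm_nonneg h).trans hH
  set y := ‖h - inner ℝ (‖p‖⁻¹ • p) h • ‖p‖⁻¹ • p‖
  have hy : 0 ≤ y := norm_nonneg _
  calc y * ‖p‖ ≤ y * (2 * (u * H)) := by gcongr; linarith
    _ = 2 * (u * y) * H := by ring
    _ ≤ 2 * D * H := by gcongr

lemma norm_orthogonal_le_of_late {p h : Vec d} (hp : 0 < ‖p‖) {u D δ : ℝ} (hδ : 0 < δ) (hu : δ ≤ u)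
    (hD : ‖p - u • h‖ ≤ D) :
    ‖h - inner ℝ (‖p‖⁻¹ • p) h • ‖p‖⁻¹ • p‖ ≤ D / δ := by
  have h1 := norm_orthogonal_le hp (hδ.le.trans hu) hD
  rw [le_div_iff₀ hδ]
  have := norm_nonneg (h - inner ℝ (‖p‖⁻¹ • p) h • ‖p‖⁻¹ • p)
  nlinarith

/-- The relative velocity `w + y`, where `y` is the component of `v - c` along `ω`, leads to a
distance smaller than `D`, whereas the relative velocity `w` keeps the distance above `F`. -/
lemma adjMeasure_component_close_le (c p w : Vec d) {H H' D F : ℝ} (hD0 : 0 < D)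
    (hDF : 2 * D ≤ F) (hF : ∀ u : ℝ, 0 ≤ u → F ≤ ‖p - u • w‖) :
    adjMeasure d {q | ‖q.2 - c‖ ≤ H ∧ 0 < inner ℝ (q.1 : Vec d) (q.2 - c) ∧
      inner ℝ (q.1 : Vec d) (q.2 - c) • (q.1 : Vec d) ∈
        {y | ‖w + y‖ ≤ H' ∧ ∃ u : ℝ, 0 ≤ u ∧ ‖p - u • (w + y)‖ ≤ D}} ≤
      ENNReal.ofReal (2 * H) ^ (d - 1) * ENNReal.ofReal (H' * (16 * D / F) ^ (d - 1)) := by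
  have hpF : F ≤ ‖p‖ := by simpa using hF 0 le_rfl
  have hF0 : 0 < F := by linarith
  have hp : 0 < ‖p‖ := by linarith
  set P := ‖p‖ with hP
  set e := P⁻¹ • p with he'
  have he : ‖e‖ = 1 := norm_inv_norm_smul hp
  let G : ℝ → ENNReal := (Ioc 0 H').indicator fun t => ENNReal.ofReal ((4 * P / (F * t)) ^ (d - 1))
  have hG : Measurable G := by
    refine Measurable.indicator ?_ measurableSet_Ioc
    fun_prop
  let T : Set (Vec d) := {h | ‖h - inner ℝ e h • e‖ ≤ 2 * D * inner ℝ e h / P}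
  have hT : MeasurableSet T := measurableSet_le (by fun_prop) (by fun_prop)
  let w' : Vec d → ENNReal := T.indicator fun h => G (inner ℝ e h)
  have hw' : Measurable w' := (hG.comp (by fun_prop)).indicator hT
  have hw'' : Measurable fun y => w' (w + y) := hw'.comp (by fun_prop)
  refine (adjMeasure_component_le c H (w := fun y => w' (w + y)) hw'' ?_).trans ?_
  · rintro y ⟨h1, u, hu, h2⟩
    set h := w + y with hh
    set t : ℝ := inner ℝ e h with ht
    have hu0 : 0 < u := by
      rcases hu.eq_or_lt with h0 | h0
      · rw [← h0, zero_smul, sub_zero] at h2; linarith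
      · exact h0
    have hpe : p = P • e := by rw [he', smul_smul, mul_inv_cancel₀ hp.ne', one_smul]
    have h3 : |P - u * t| ≤ D := by
      have h4 := abs_real_inner_le_norm e (p - u • h)
      rw [inner_sub_right, inner_smul_right, he, one_mul] at h4
      have h5 : inner ℝ e p = P := by
        nth_rw 1 [hpe]; rw [inner_smul_right, inner_self_eq_one he, mul_one]
      rw [h5] at h4
      exact h4.trans h2
    have h3' := abs_le.1 h3
    have ht0 : 0 < t := by
      by_contra h'
      have : u * t ≤ 0 := mul_nonpos_of_nonneg_of_nonpos hu (not_lt.1 h')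
      linarith
    have htH : t ≤ H' := by
      have := abs_real_inner_le_norm e h
      rw [he, one_mul] at this
      exact (le_abs_self _).trans (this.trans h1)
    have h4 := norm_orthogonal_le hp hu h2
    have hyT : h ∈ T := by
      change ‖h - inner ℝ e h • e‖ ≤ 2 * D * t / P
      rw [le_div_iff₀ hp]
      have h6 : P ≤ 2 * (u * t) := by linarith
      calc _ ≤ ‖h - inner ℝ e h • e‖ * (2 * (u * t)) := by gcongr
        _ = 2 * (u * ‖h - inner ℝ e h • e‖) * t := by ring
        _ ≤ 2 * D * t := by gcongr
    -- At the time `u` of the encounter, the motions of velocities `w` and `w + y` are at distance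
    -- at least `F - D ≥ F / 2`, so `u * ‖y‖ ≥ F / 2`; and `u * t ≤ 2 * P`. The lower bound on `‖y‖`
    -- is thus proportional to `t`, and no cutoff is needed.
    have hy : F * t / (4 * P) ≤ ‖y‖ := by
      have h7 := hF u hu
      have h8 : ‖p - u • w‖ ≤ ‖p - u • h‖ + ‖u • y‖ := by
        have : p - u • w = (p - u • h) + u • y := by rw [hh]; module
        rw [this]; exact norm_add_le _ _
      rw [norm_smul, Real.norm_of_nonneg hu] at h8
      have h9 : F / 2 ≤ u * ‖y‖ := by linarith
      rw [div_le_iff₀ (by positivity)]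
      have h10 : u * t ≤ 2 * P := by linarith
      have h11 : u * (F * t) ≤ u * (‖y‖ * (4 * P)) := by
        calc u * (F * t) = F * (u * t) := by ring
          _ ≤ F * (2 * P) := by gcongr
          _ ≤ (2 * (u * ‖y‖)) * (2 * P) := by gcongr; linarith
          _ = _ := by ring
      exact le_of_mul_le_mul_left h11 hu0
    have hw1 : w' h = ENNReal.ofReal ((4 * P / (F * t)) ^ (d - 1)) := by
      simp only [w', G]
      rw [indicator_of_mem hyT, indicator_of_mem (show inner ℝ e h ∈ Ioc 0 H' from ⟨ht0, htH⟩)]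
    change 1 ≤ ENNReal.ofReal (‖y‖ ^ (d - 1)) * w' h
    rw [hw1, ← ENNReal.ofReal_mul (by positivity), ← mul_pow, ← ENNReal.ofReal_one]
    apply ENNReal.ofReal_le_ofReal
    apply one_le_pow₀
    calc (1 : ℝ) = F * t / (4 * P) * (4 * P / (F * t)) := by field_simp
      _ ≤ _ := by gcongr
  · refine mul_le_mul_right ?_ _
    rw [lintegral_add_left_eq_self w' w]
    have h5 : ∫⁻ y, w' y ≤ ∫⁻ t, G t * ENNReal.ofReal (2 * (2 * D * t / P)) ^ (d - 1) := by
      refine lintegral_tube_le e he 0 hG (by fun_prop) fun y hy => ?_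
      have hyT : y ∈ T := by
        by_contra h'
        exact hy (indicator_of_notMem h' _)
      refine ⟨by rw [sub_zero]; exact hyT, by simp only [w']; rw [indicator_of_mem hyT]⟩
    refine h5.trans ?_
    -- The velocities fill a cone, whose radius is proportional to `t`; this cancels exactly the
    -- singularity of the weight `G` at `t = 0`.
    have h6 : ∀ t, G t * ENNReal.ofReal (2 * (2 * D * t / P)) ^ (d - 1) =
        (Ioc 0 H').indicator (fun _ => ENNReal.ofReal ((16 * D / F) ^ (d - 1))) t := by
      intro t
      by_cases ht : t ∈ Ioc 0 H'
      · simp only [G]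
        have ht0 : 0 < t := ht.1
        rw [indicator_of_mem ht, indicator_of_mem ht, ← ENNReal.ofReal_pow (by positivity),
          ← ENNReal.ofReal_mul (by positivity), ← mul_pow]
        congr 2
        field_simp
        ring
      · simp only [G]
        rw [indicator_of_notMem ht, indicator_of_notMem ht, zero_mul]
    simp_rw [h6]
    rw [lintegral_indicator measurableSet_Ioc, setLIntegral_const, Real.volume_Ioc, sub_zero,
      ← ENNReal.ofReal_mul (by positivity), mul_comm]

lemma inner_e₁ (v : Vec d) : inner ℝ (e₁ : Vec d) v = v 0 := by
  simp [e₁, EuclideanSpace.inner_single_left]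

lemma norm_e₁ : ‖(e₁ : Vec d)‖ = 1 := by simp [e₁]

lemma measurable_inner_adj (c : Vec d) :
    Measurable fun q : AdjParam d => (inner ℝ (q.1 : Vec d) (q.2 - c) : ℝ) :=
  Measurable.inner (by fun_prop) (by fun_prop)

lemma volume_Icc_slab_le {b s α : ℝ} (hs : 0 < s) (hb : s ≤ |b|) (x : ℝ) (hα : 0 ≤ α) :
    volume {t : ℝ | |x + t * b| ≤ α} ≤ ENNReal.ofReal (2 * α / s) := by
  have hb0 : b ≠ 0 := by rintro rfl; simp at hb; linarith
  have hb1 : 0 < |b| := hs.trans_le hb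
  have : {t : ℝ | |x + t * b| ≤ α} ⊆ Icc (-(x / b) - α / s) (-(x / b) + α / s) := by
    intro t ht
    have h1 : |t + x / b| ≤ α / s := by
      have h2 : t + x / b = (x + t * b) / b := by field_simp; ring
      rw [h2, abs_div]
      calc |x + t * b| / |b| ≤ α / |b| := by gcongr; exact ht
        _ ≤ α / s := by gcongr
    have := abs_le.1 h1
    constructor <;> linarith
  refine (measure_mono this).trans ?_
  rw [Real.volume_Icc]
  apply ENNReal.ofReal_le_ofReal
  apply le_of_eq; ring

lemma measurableSet_slab (b x α : ℝ) : MeasurableSet {t : ℝ | |x + t * b| ≤ α} := by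
  have : Measurable fun t : ℝ => x + t * b := by fun_prop
  exact measurableSet_le this.norm measurable_const

/-- The scattered velocity `c + ⟪ω, v - c⟫ ω` is nearly parallel to the wall. -/
lemma adjMeasure_component_grazing_le (c : Vec d) {H α s : ℝ} (hs : 0 < s) (hα : 0 ≤ α)
    (x : ℝ) :
    adjMeasure d {q | ‖q.2 - c‖ ≤ H ∧
      |x + inner ℝ (q.1 : Vec d) (q.2 - c) * (q.1 : Vec d) 0| ≤ α} ≤
      ENNReal.ofReal (d * 2 ^ d) * (ENNReal.ofReal s * ENNReal.ofReal (2 * H) ^ d +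
        ENNReal.ofReal (2 * α / s) * ENNReal.ofReal (2 * H) ^ (d - 1)) := by
  let A : Set (AdjParam d) := {q | ‖q.2 - c‖ ≤ H ∧ (s ≤ |(q.1 : Vec d) 0| ∧
    |x + inner ℝ (q.1 : Vec d) (q.2 - c) * (q.1 : Vec d) 0| ≤ α)}
  have hω : Measurable fun q : AdjParam d => (q.1 : Vec d) 0 := by fun_prop
  have hA : MeasurableSet A := by
    have h1 : Measurable fun q : AdjParam d => ‖q.2 - c‖ := by fun_prop
    exact (measurableSet_le h1 measurable_const).inter
      ((measurableSet_le measurable_const hω.norm).inter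
        (measurableSet_le (measurable_const.add ((measurable_inner_adj c).mul hω)).norm
          measurable_const))
  -- When `|ω 0| ≥ s`, the component along `ω` is confined to an interval of length `2 * α / s`; the
  -- other `ω` form a slab of the sphere of measure of order `s`.
  have hsub : {q : AdjParam d | ‖q.2 - c‖ ≤ H ∧
      |x + inner ℝ (q.1 : Vec d) (q.2 - c) * (q.1 : Vec d) 0| ≤ α} ⊆
      ({ω : Metric.sphere (0 : Vec d) 1 | |inner ℝ (e₁ : Vec d) (ω : Vec d)| ≤ s} ×ˢ {v | ‖v - c‖ ≤ H}) ∪ A := by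
    rintro q ⟨h1, h2⟩
    rcases le_total s |(q.1 : Vec d) 0| with h | h
    · exact Or.inr ⟨h1, h, h2⟩
    · exact Or.inl ⟨by simpa only [mem_ofPred_eq, inner_e₁] using h, h1⟩
  refine (measure_mono hsub).trans ((measure_union_le _ _).trans ?_)
  rw [mul_add]
  refine add_le_add ?_ (adjMeasure_le_const hA fun ω => ?_)
  · refine (adjMeasure_prod_le _ _).trans ?_
    rw [← mul_assoc, ← ENNReal.ofReal_mul (by positivity)]
    exact mul_le_mul' (toSphere_slab_le norm_e₁) (volume_ball_le c H)
  · rcases le_or_gt s |(ω : Vec d) 0| with h | h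
    · refine le_trans (measure_mono fun v hv => ?_)
        ((volume_slab_le (norm_sphere ω) c (measurableSet_slab ((ω : Vec d) 0) x α) H).trans
          (mul_le_mul_left (volume_Icc_slab_le hs h x hα) _))
      exact ⟨hv.1, hv.2.2⟩
    · have : {v | (ω, v) ∈ A} = ∅ := by
        ext v
        simp only [mem_ofPred_eq, mem_empty_iff_false, iff_false]
        exact fun hv => absurd hv.2.1 (not_le.2 h)
      rw [this]; simp

/-- The scattered velocity `v - ⟪ω, v - c⟫ ω` is nearly parallel to the wall. -/
lemma adjMeasure_orthogonal_grazing_le (hd : 2 ≤ d) (c : Vec d) {H α s : ℝ} (hs : 0 < s)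
    (hα : 0 ≤ α) (x : ℝ) :
    adjMeasure d {q | ‖q.2 - c‖ ≤ H ∧
      |x + ((q.2 - c) 0 - inner ℝ (q.1 : Vec d) (q.2 - c) * (q.1 : Vec d) 0)| ≤ α} ≤
      ENNReal.ofReal (d * 2 ^ d) * (ENNReal.ofReal s * ENNReal.ofReal (2 * H) ^ d +
        ENNReal.ofReal (2 * α / s) * ENNReal.ofReal (2 * H) ^ (d - 1)) := by
  let g : Metric.sphere (0 : Vec d) 1 → Vec d := fun ω => e₁ - (ω : Vec d) 0 • (ω : Vec d)
  have hgi : ∀ ω W, inner ℝ (g ω) W = W 0 - inner ℝ (ω : Vec d) W * (ω : Vec d) 0 := by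
    intro ω W
    rw [inner_sub_left, inner_e₁, inner_smul_left, RCLike.conj_to_real, mul_comm]
  have hgm : Measurable g := by
    have hω : Measurable fun ω : Metric.sphere (0 : Vec d) 1 => (ω : Vec d) 0 := by fun_prop
    exact measurable_const.sub (hω.smul measurable_subtype_coe)
  let A : Set (AdjParam d) := {q | ‖q.2 - c‖ ≤ H ∧ (s ≤ ‖g q.1‖ ∧ |x + inner ℝ (g q.1) (q.2 - c)| ≤ α)}
  have hA : MeasurableSet A := by
    have h1 : Measurable fun q : AdjParam d => ‖q.2 - c‖ := by fun_prop
    have h2 : Measurable fun q : AdjParam d => (inner ℝ (g q.1) (q.2 - c) : ℝ) :=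
      (hgm.comp measurable_fst).inner (by fun_prop)
    exact (measurableSet_le h1 measurable_const).inter
      ((measurableSet_le measurable_const (hgm.comp measurable_fst).norm).inter
        (measurableSet_le (measurable_const.add h2).norm measurable_const))
  -- `g ω` is the part of `e₁` orthogonal to `ω`, of squared norm `1 - (ω 0)²`. It dominates any
  -- other coordinate of `ω`, and `d ≥ 2` provides one, so that `g ω` is small only in a thin slab
  -- of the sphere.
  let i1 : Fin d := ⟨1, by omega⟩
  have hi1 : i1 ≠ 0 := by
    intro h
    have := congrArg Fin.val h
    simp [i1] at this
  have he2 : ‖(EuclideanSpace.single i1 (1 : ℝ) : Vec d)‖ = 1 := by simp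
  have hg2 : ∀ ω : Metric.sphere (0 : Vec d) 1, |inner ℝ (EuclideanSpace.single i1 (1 : ℝ) : Vec d) (ω : Vec d)| ≤ ‖g ω‖ := by
    intro ω
    have h1 : ‖g ω‖ ^ 2 = 1 - (ω : Vec d) 0 ^ 2 := by
      have h3 : inner ℝ (e₁ : Vec d) ((ω : Vec d) 0 • (ω : Vec d)) = (ω : Vec d) 0 ^ 2 := by
        rw [inner_smul_right, inner_e₁]; ring
      rw [norm_sub_sq_real, h3, norm_smul, norm_sphere, norm_e₁, Real.norm_eq_abs, mul_one, sq_abs]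
      ring
    have h2 : (ω : Vec d) 0 ^ 2 + (ω : Vec d) i1 ^ 2 ≤ 1 := by
      have h3 : ‖(ω : Vec d)‖ ^ 2 = ∑ i, (ω : Vec d) i ^ 2 := by
        rw [EuclideanSpace.norm_sq_eq]; simp
      rw [norm_sphere, one_pow] at h3
      refine le_trans ?_ h3.ge
      rw [← Finset.sum_pair hi1.symm (f := fun i => (ω : Vec d) i ^ 2)]
      exact Finset.sum_le_sum_of_subset_of_nonneg (Finset.subset_univ _) fun _ _ _ => sq_nonneg _
    have h4 : inner ℝ (EuclideanSpace.single i1 (1 : ℝ) : Vec d) (ω : Vec d) = (ω : Vec d) i1 := by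
      simp [EuclideanSpace.inner_single_left]
    rw [h4]
    exact abs_le_of_sq_le_sq (by linarith) (norm_nonneg _)
  have hsub : {q : AdjParam d | ‖q.2 - c‖ ≤ H ∧
      |x + ((q.2 - c) 0 - inner ℝ (q.1 : Vec d) (q.2 - c) * (q.1 : Vec d) 0)| ≤ α} ⊆
      ({ω : Metric.sphere (0 : Vec d) 1 | |inner ℝ (EuclideanSpace.single i1 (1 : ℝ) : Vec d) (ω : Vec d)| ≤ s} ×ˢ
        {v | ‖v - c‖ ≤ H}) ∪ A := by
    rintro q ⟨h1, h2⟩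
    rcases le_total s ‖g q.1‖ with h | h
    · exact Or.inr ⟨h1, h, by rw [hgi]; exact h2⟩
    · exact Or.inl ⟨(hg2 q.1).trans h, h1⟩
  refine (measure_mono hsub).trans ((measure_union_le _ _).trans ?_)
  rw [mul_add]
  refine add_le_add ?_ (adjMeasure_le_const hA fun ω => ?_)
  · refine (adjMeasure_prod_le _ _).trans ?_
    rw [← mul_assoc, ← ENNReal.ofReal_mul (by positivity)]
    exact mul_le_mul' (toSphere_slab_le he2) (volume_ball_le c H)
  · rcases le_or_gt s ‖g ω‖ with h | h
    · have hg0 : 0 < ‖g ω‖ := hs.trans_le h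
      have h' : s ≤ |‖g ω‖| := by rwa [abs_norm]
      refine le_trans (measure_mono fun v hv => ?_)
        ((volume_slab_le (norm_inv_norm_smul hg0) c (measurableSet_slab ‖g ω‖ x α) H).trans
          (mul_le_mul_left (volume_Icc_slab_le hs h' x hα) _))
      refine ⟨hv.1, ?_⟩
      have h5 : inner ℝ (‖g ω‖⁻¹ • g ω) (v - c) * ‖g ω‖ = inner ℝ (g ω) (v - c) := by
        rw [inner_smul_left, RCLike.conj_to_real]; field_simp
      change |x + inner ℝ (‖g ω‖⁻¹ • g ω) (v - c) * ‖g ω‖| ≤ α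
      rw [h5]
      exact hv.2.2
    · have : {v | (ω, v) ∈ A} = ∅ := by
        ext v
        simp only [mem_ofPred_eq, mem_empty_iff_false, iff_false]
        exact fun hv => absurd hv.2.1 (not_le.2 h)
      rw [this]; simp

/-! ### Reflection at the wall and separation of particles up to reflection. -/

lemma symm₀_zero_coord (x : Vec d) : symm₀ x 0 = -x 0 := by
  simp [symm₀, e₁]; ring

lemma symm₀_sub (x y : Vec d) : symm₀ (x - y) = symm₀ x - symm₀ y := by
  simp only [symm₀, PiLp.sub_apply]; module

lemma symm₀_smul (c : ℝ) (x : Vec d) : symm₀ (c • x) = c • symm₀ x := by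
  simp only [symm₀, PiLp.smul_apply, smul_eq_mul]; module

@[simp] lemma symm₀_symm₀ (x : Vec d) : symm₀ (symm₀ x) = x := by
  have : (symm₀ x) 0 = - x 0 := symm₀_zero_coord x
  rw [symm₀, this, symm₀]; module

lemma norm_sq_symm₀_sub (x y : Vec d) : ‖x - symm₀ y‖ ^ 2 = ‖x - y‖ ^ 2 + 4 * (x 0 * y 0) := by
  have h : x - symm₀ y = (x - y) + (2 * y 0) • e₁ := by rw [symm₀]; module
  have hi : ∀ v : Vec d, inner ℝ v (e₁ : Vec d) = v 0 := fun v => by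
    simp [e₁, EuclideanSpace.inner_single_right]
  have he : ‖(e₁ : Vec d)‖ = 1 := by simp [e₁]
  rw [h, norm_add_sq_real, inner_smul_right, hi, norm_smul, he, mul_one, Real.norm_eq_abs, sq_abs,
    PiLp.sub_apply]
  ring

@[simp] lemma norm_symm₀ (x : Vec d) : ‖symm₀ x‖ = ‖x‖ := by
  have h := norm_sq_symm₀_sub 0 x
  simp only [zero_sub, norm_neg, PiLp.zero_apply, zero_mul, mul_zero, add_zero] at h
  exact (sq_eq_sq₀ (norm_nonneg _) (norm_nonneg _)).1 h

lemma norm_symm₀_sub_symm₀ (x y : Vec d) : ‖symm₀ x - symm₀ y‖ = ‖x - y‖ := by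
  rw [← symm₀_sub, norm_symm₀]

lemma norm_symm₀_sub (x y : Vec d) : ‖symm₀ x - y‖ = ‖x - symm₀ y‖ := by
  rw [← norm_symm₀_sub_symm₀, symm₀_symm₀]

/-- The squares of the two sides differ by `4 * (x 0 * y 0)`. Inside the half-space, closeness up to
reflection is therefore genuine closeness. -/
lemma norm_sub_le_norm_sub_symm₀ {x y : Vec d} (hx : 0 ≤ x 0) (hy : 0 ≤ y 0) :
    ‖x - y‖ ≤ ‖x - symm₀ y‖ := by
  have h := norm_sq_symm₀_sub x y
  have := mul_nonneg hx hy
  exact le_of_sq_le_sq (by linarith) (norm_nonneg _)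

lemma symm₀_of_zero {x : Vec d} (hx : x 0 = 0) : symm₀ x = x := by
  rw [symm₀, hx]; simp

lemma abs_coord_zero_le (x : Vec d) : |x 0| ≤ ‖x‖ := by
  simpa using PiLp.norm_apply_le x 0

/-- Free motion, backwards in time, in the whole space. -/
def freeMove (u : ℝ) (P : Vec d × Vec d) : Vec d × Vec d := (P.1 - u • P.2, P.2)

/-- The image of a particle by the reflection. -/
def mirror (P : Vec d × Vec d) : Vec d × Vec d := (symm₀ P.1, symm₀ P.2)

/-- Up to the reflection, two particles have the same velocity and positions at distance at most
`c`. -/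
def Close (c : ℝ) (P Q : Vec d × Vec d) : Prop :=
  (P.2 = Q.2 ∧ ‖P.1 - Q.1‖ ≤ c) ∨ (P.2 = symm₀ Q.2 ∧ ‖P.1 - symm₀ Q.1‖ ≤ c)

/-- Two particles are at distance at least `D` of each other and of each other's mirror image. -/
def Apart (D : ℝ) (P Q : Vec d × Vec d) : Prop :=
  D ≤ ‖P.1 - Q.1‖ ∧ D ≤ ‖P.1 - symm₀ Q.1‖

/-- Two particles are apart at all times `u ≥ Δ` of their backward free motion. -/
def ApartFrom (Δ D : ℝ) (P Q : Vec d × Vec d) : Prop :=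
  ∀ u, Δ ≤ u → Apart D (freeMove u P) (freeMove u Q)

lemma freeMove_mirror (u : ℝ) (P : Vec d × Vec d) :
    freeMove u (mirror P) = mirror (freeMove u P) := by
  simp [mirror, freeMove, symm₀_sub, symm₀_smul]

lemma freeMove_freeMove (u v : ℝ) (P : Vec d × Vec d) :
    freeMove u (freeMove v P) = freeMove (v + u) P := by
  simp only [freeMove, Prod.mk.injEq, and_true]; module

lemma freeMove_zero (P : Vec d × Vec d) : freeMove 0 P = P := by simp [freeMove]

lemma Close.refl (P : Vec d × Vec d) : Close 0 P P := Or.inl (by simp)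

lemma close_mirror (P : Vec d × Vec d) : Close 0 (mirror P) P := Or.inr (by simp [mirror])

lemma Close.eq_or_eq {P Q : Vec d × Vec d} (h : Close 0 P Q) : P = Q ∨ P = mirror Q := by
  rcases h with ⟨h1, h2⟩ | ⟨h1, h2⟩
  · exact Or.inl (Prod.ext (sub_eq_zero.1 (norm_le_zero_iff.1 h2)) h1)
  · exact Or.inr (Prod.ext (sub_eq_zero.1 (norm_le_zero_iff.1 h2)) h1)

lemma Close.mono {c c' : ℝ} (hc : c ≤ c') {P Q : Vec d × Vec d} (h : Close c P Q) :
    Close c' P Q := by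
  rcases h with ⟨h1, h2⟩ | ⟨h1, h2⟩
  · exact Or.inl ⟨h1, h2.trans hc⟩
  · exact Or.inr ⟨h1, h2.trans hc⟩

lemma Close.symm {c : ℝ} {P Q : Vec d × Vec d} (h : Close c P Q) : Close c Q P := by
  rcases h with ⟨h1, h2⟩ | ⟨h1, h2⟩
  · exact Or.inl ⟨h1.symm, by rwa [norm_sub_rev]⟩
  · refine Or.inr ⟨by rw [h1, symm₀_symm₀], ?_⟩
    rwa [← norm_symm₀_sub, norm_sub_rev]

lemma Close.trans {c c' : ℝ} {P Q T : Vec d × Vec d} (h : Close c P Q) (h' : Close c' Q T) :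
    Close (c + c') P T := by
  have key : ∀ x y z : Vec d, ‖x - y‖ ≤ c → ‖y - z‖ ≤ c' → ‖x - z‖ ≤ c + c' := fun x y z h h' =>
    (norm_sub_le_norm_sub_add_norm_sub x y z).trans (add_le_add h h')
  rcases h with ⟨h1, h2⟩ | ⟨h1, h2⟩ <;> rcases h' with ⟨h3, h4⟩ | ⟨h3, h4⟩
  · exact Or.inl ⟨h1.trans h3, key _ _ _ h2 h4⟩
  · exact Or.inr ⟨h1.trans h3, key _ _ _ h2 h4⟩
  · exact Or.inr ⟨by rw [h1, h3], key _ _ _ h2 (by rwa [norm_symm₀_sub_symm₀])⟩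
  · exact Or.inl ⟨by rw [h1, h3, symm₀_symm₀],
      key _ _ _ h2 (by rwa [norm_symm₀_sub])⟩

lemma Close.freeMove {c : ℝ} {P Q : Vec d × Vec d} (h : Close c P Q) (u : ℝ) :
    Close c (freeMove u P) (freeMove u Q) := by
  rcases h with ⟨h1, h2⟩ | ⟨h1, h2⟩
  · refine Or.inl ⟨h1, ?_⟩
    simpa [HalfSpace.freeMove, h1] using h2
  · refine Or.inr ⟨h1, ?_⟩
    simpa [HalfSpace.freeMove, h1, symm₀_sub, symm₀_smul] using h2

/-- Two close particles of the half-space are at distance at most `c`. -/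
lemma Close.norm_sub_le {c : ℝ} {P Q : Vec d × Vec d} (h : Close c P Q) (hP : 0 ≤ P.1 0)
    (hQ : 0 ≤ Q.1 0) : ‖P.1 - Q.1‖ ≤ c := by
  rcases h with ⟨-, h2⟩ | ⟨-, h2⟩
  · exact h2
  · exact (norm_sub_le_norm_sub_symm₀ hP hQ).trans h2

/-- Away from the wall, two close particles have the same velocity. -/
lemma Close.eq_of_far {c : ℝ} {P Q : Vec d × Vec d} (h : Close c P Q) (hP : 0 ≤ P.1 0)
    (hQ : c < Q.1 0) : P.2 = Q.2 ∧ ‖P.1 - Q.1‖ ≤ c := by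
  rcases h with h | ⟨-, h2⟩
  · exact h
  · have h3 := (abs_coord_zero_le _).trans h2
    rw [PiLp.sub_apply, symm₀_zero_coord] at h3
    have := (le_abs_self _).trans h3
    linarith

lemma Apart.symm {D : ℝ} {P Q : Vec d × Vec d} (h : Apart D P Q) : Apart D Q P :=
  ⟨by rw [norm_sub_rev]; exact h.1, by rw [← norm_symm₀_sub, norm_sub_rev]; exact h.2⟩

lemma Apart.mono {D D' : ℝ} (hD : D' ≤ D) {P Q : Vec d × Vec d} (h : Apart D P Q) :
    Apart D' P Q := ⟨hD.trans h.1, hD.trans h.2⟩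

lemma Apart.of_close_left {D c : ℝ} {P P' Q : Vec d × Vec d} (h : Apart D P Q)
    (hP : Close c P' P) : Apart (D - c) P' Q := by
  have key : ∀ x y z : Vec d, D ≤ ‖y - z‖ → ‖x - y‖ ≤ c → D - c ≤ ‖x - z‖ := fun x y z h h' => by
    have := norm_sub_le_norm_sub_add_norm_sub y x z
    rw [norm_sub_rev y x] at this
    linarith
  rcases hP with ⟨-, h2⟩ | ⟨-, h2⟩
  · exact ⟨key _ _ _ h.1 h2, key _ _ _ h.2 h2⟩
  · refine ⟨key _ _ _ ?_ h2, key _ _ _ ?_ h2⟩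
    · rw [norm_symm₀_sub]; exact h.2
    · rw [norm_symm₀_sub_symm₀]; exact h.1

lemma Apart.of_close {D c c' : ℝ} {P P' Q Q' : Vec d × Vec d} (h : Apart D P Q)
    (hP : Close c P' P) (hQ : Close c' Q' Q) : Apart (D - c - c') P' Q' :=
  ((h.of_close_left hP).symm.of_close_left hQ).symm

lemma ApartFrom.symm {Δ D : ℝ} {P Q : Vec d × Vec d} (h : ApartFrom Δ D P Q) :
    ApartFrom Δ D Q P := fun u hu => (h u hu).symm

lemma ApartFrom.mono {Δ Δ' D D' : ℝ} {P Q : Vec d × Vec d} (h : ApartFrom Δ D P Q)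
    (hΔ : Δ ≤ Δ') (hD : D' ≤ D) : ApartFrom Δ' D' P Q := fun u hu => (h u (hΔ.trans hu)).mono hD

lemma ApartFrom.of_close {Δ D c c' : ℝ} {P P' Q Q' : Vec d × Vec d} (h : ApartFrom Δ D P Q)
    (hP : Close c P' P) (hQ : Close c' Q' Q) : ApartFrom Δ (D - c - c') P' Q' :=
  fun u hu => (h u hu).of_close (hP.freeMove u) (hQ.freeMove u)

lemma ApartFrom.freeMove {Δ D τ : ℝ} {P Q : Vec d × Vec d} (h : ApartFrom Δ D P Q) :
    ApartFrom (Δ - τ) D (freeMove τ P) (freeMove τ Q) := by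
  intro u hu
  rw [freeMove_freeMove, freeMove_freeMove]
  exact h _ (by linarith)

/-- The `i`-th particle of a configuration. -/
def particle {n : ℕ} (Z : Config d n) (i : Fin n) : Vec d × Vec d := (Z.1 i, Z.2 i)

lemma close_freeFlow {n : ℕ} (τ : ℝ) (Z : Config d n) (i : Fin n) :
    Close 0 (particle (freeFlow τ Z) i) (freeMove τ (particle Z i)) := by
  by_cases h : (Z.1 i - τ • Z.2 i) 0 < 0
  · have : particle (freeFlow τ Z) i = mirror (freeMove τ (particle Z i)) := by
      simp only [particle, freeFlow, if_pos h, mirror, freeMove]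
    rw [this]; exact close_mirror _
  · have : particle (freeFlow τ Z) i = freeMove τ (particle Z i) := by
      simp only [particle, freeFlow, if_neg h, freeMove]
    rw [this]; exact Close.refl _

lemma freeFlow_pos_nonneg {n : ℕ} (τ : ℝ) (Z : Config d n) (i : Fin n) :
    0 ≤ (freeFlow τ Z).1 i 0 := by
  simp only [freeFlow]
  split_ifs with h
  · rw [symm₀_zero_coord]; linarith
  · exact not_lt.1 h

lemma freeFlow_vel {n : ℕ} (τ : ℝ) (Z : Config d n) (i : Fin n) :
    (freeFlow τ Z).2 i = Z.2 i ∨ (freeFlow τ Z).2 i = symm₀ (Z.2 i) := by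
  simp only [freeFlow]
  split_ifs with h
  · exact Or.inr rfl
  · exact Or.inl rfl

lemma norm_freeFlow_vel {n : ℕ} (τ : ℝ) (Z : Config d n) (i : Fin n) :
    ‖(freeFlow τ Z).2 i‖ = ‖Z.2 i‖ := by
  rcases freeFlow_vel τ Z i with h | h <;> rw [h]
  exact norm_symm₀ _

lemma abs_freeFlow_vel_zero {n : ℕ} (τ : ℝ) (Z : Config d n) (i : Fin n) :
    |(freeFlow τ Z).2 i 0| = |Z.2 i 0| := by
  rcases freeFlow_vel τ Z i with h | h <;> rw [h]
  rw [symm₀_zero_coord, abs_neg]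

lemma velNorm_sq {n : ℕ} (Z : Config d n) : velNorm Z ^ 2 = ∑ i, ‖Z.2 i‖ ^ 2 :=
  Real.sq_sqrt (Finset.sum_nonneg fun _ _ => sq_nonneg _)

lemma norm_vel_le_velNorm {n : ℕ} (Z : Config d n) (i : Fin n) : ‖Z.2 i‖ ≤ velNorm Z := by
  refine le_of_sq_le_sq ?_ (Real.sqrt_nonneg _)
  rw [velNorm_sq]
  exact Finset.single_le_sum (f := fun i => ‖Z.2 i‖ ^ 2) (fun _ _ => sq_nonneg _)
    (Finset.mem_univ i)

lemma velNorm_freeFlow {n : ℕ} (τ : ℝ) (Z : Config d n) :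
    velNorm (freeFlow τ Z) = velNorm Z := by
  simp only [velNorm, norm_freeFlow_vel]

/-- The distance of the particle `P` to the particle `Q` remains at least `D` from the time `Δ` on,
along the backward free motion without reflection. -/
def KeepsFrom (Δ D : ℝ) (P Q : Vec d × Vec d) : Prop :=
  ∀ u : ℝ, Δ ≤ u → D ≤ ‖(P.1 - Q.1) - u • (P.2 - Q.2)‖

/-- Free motion commutes with the reflection, so the separation up to reflection reduces to two
straight relative motions, which can be estimated separately. -/
lemma apartFrom_iff {Δ D : ℝ} {P Q : Vec d × Vec d} :
    ApartFrom Δ D P Q ↔ KeepsFrom Δ D P Q ∧ KeepsFrom Δ D P (mirror Q) := by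
  have h1 : ∀ u : ℝ, (freeMove u P).1 - (freeMove u Q).1 = (P.1 - Q.1) - u • (P.2 - Q.2) := by
    intro u; simp only [freeMove]; module
  have h2 : ∀ u : ℝ, (freeMove u P).1 - symm₀ (freeMove u Q).1 =
      (P.1 - (mirror Q).1) - u • (P.2 - (mirror Q).2) := by
    intro u; simp only [freeMove, mirror, symm₀_sub, symm₀_smul]; module
  simp only [ApartFrom, Apart, KeepsFrom, h1, h2]
  exact ⟨fun h => ⟨fun u hu => (h u hu).1, fun u hu => (h u hu).2⟩,
    fun h u hu => ⟨h.1 u hu, h.2 u hu⟩⟩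

/-! ### Velocities after an adjunction, and the conditions carried by the induction. -/

open Classical in
/-- Velocity of the particle of velocity `w` after the adjunction of a particle next to it. -/
def hostVel (w : Vec d) (p : AdjParam d) : Vec d :=
  if 0 < inner ℝ (p.1 : Vec d) (p.2 - w) then w + inner ℝ (p.1 : Vec d) (p.2 - w) • (p.1 : Vec d)
  else w

open Classical in
/-- Velocity of the particle adjoined next to a particle of velocity `w`. -/
def guestVel (w : Vec d) (p : AdjParam d) : Vec d :=
  if 0 < inner ℝ (p.1 : Vec d) (p.2 - w) then p.2 - inner ℝ (p.1 : Vec d) (p.2 - w) • (p.1 : Vec d)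
  else p.2

section adjoin
variable {n : ℕ} (ε : ℝ) (Z : Config d n) (j : Fin n) (p : AdjParam d)

lemma adjoin_pos_castSucc (i : Fin n) : (adjoin ε Z j p).1 i.castSucc = Z.1 i := by
  simp only [adjoin]; exact Fin.snoc_castSucc (α := fun _ => Vec d) _ _ _

lemma adjoin_pos_last : (adjoin ε Z j p).1 (Fin.last n) = Z.1 j + ε • (p.1 : Vec d) := by
  simp only [adjoin]; exact Fin.snoc_last (α := fun _ => Vec d) _ _

lemma inner_sub_comm_neg (w : Vec d) :
    (inner ℝ (w - p.2) (p.1 : Vec d) : ℝ) = -inner ℝ (p.1 : Vec d) (p.2 - w) := by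
  rw [real_inner_comm, ← neg_sub, inner_neg_right]

lemma adjoin_vel_last : (adjoin ε Z j p).2 (Fin.last n) = guestVel (Z.2 j) p := by
  simp only [adjoin, guestVel]
  split_ifs
  · rw [Fin.snoc_last (α := fun _ => Vec d), inner_sub_comm_neg]; module
  · exact Fin.snoc_last (α := fun _ => Vec d) _ _

lemma adjoin_vel_host : (adjoin ε Z j p).2 j.castSucc = hostVel (Z.2 j) p := by
  simp only [adjoin, hostVel]
  split_ifs
  · rw [Fin.snoc_castSucc (α := fun _ => Vec d), Function.update_self, inner_sub_comm_neg]; module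
  · exact Fin.snoc_castSucc (α := fun _ => Vec d) _ _ _

lemma adjoin_vel_of_ne {i : Fin n} (hi : i ≠ j) : (adjoin ε Z j p).2 i.castSucc = Z.2 i := by
  simp only [adjoin]
  split_ifs
  · rw [Fin.snoc_castSucc (α := fun _ => Vec d), Function.update_of_ne hi]
  · exact Fin.snoc_castSucc (α := fun _ => Vec d) _ _ _

end adjoin

lemma norm_sq_hostVel_add (w : Vec d) (p : AdjParam d) :
    ‖hostVel w p‖ ^ 2 + ‖guestVel w p‖ ^ 2 = ‖w‖ ^ 2 + ‖p.2‖ ^ 2 := by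
  simp only [hostVel, guestVel]
  split_ifs
  · rw [norm_add_sq_real, norm_sub_sq_real, inner_smul_right, inner_smul_right, norm_smul,
      norm_sphere, mul_one, Real.norm_eq_abs, sq_abs, inner_sub_right,
      real_inner_comm w, real_inner_comm p.2]
    ring
  · rfl

/-- Scattering reverses the component along `ω` of the relative velocity, which is a reflection. -/
lemma norm_guestVel_sub_hostVel (w : Vec d) (p : AdjParam d) :
    ‖guestVel w p - hostVel w p‖ = ‖p.2 - w‖ := by
  refine (sq_eq_sq₀ (norm_nonneg _) (norm_nonneg _)).1 ?_
  simp only [hostVel, guestVel]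
  split_ifs
  · set l : ℝ := inner ℝ (p.1 : Vec d) (p.2 - w) with hl
    have : p.2 - l • (p.1 : Vec d) - (w + l • (p.1 : Vec d)) = (p.2 - w) - (2 * l) • (p.1 : Vec d) := by
      module
    rw [this, norm_sub_sq_real, inner_smul_right, real_inner_comm, ← hl, norm_smul, norm_sphere,
      mul_one, Real.norm_eq_abs, sq_abs]
    ring
  · rfl

/-- The velocities after the adjunction are pre-collisional in either case; this is why the new pair
separates when the motion is run backwards. -/
lemma inner_guestVel_sub_hostVel_nonpos (w : Vec d) (p : AdjParam d) :
    inner ℝ (p.1 : Vec d) (guestVel w p - hostVel w p) ≤ 0 := by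
  simp only [hostVel, guestVel]
  split_ifs with h
  · have hω : inner ℝ (p.1 : Vec d) (p.1 : Vec d) = (1 : ℝ) := by
      rw [real_inner_self_eq_norm_sq, norm_sphere, one_pow]
    simp only [inner_sub_right, inner_add_right, inner_smul_right, hω] at h ⊢
    linarith
  · exact not_lt.1 h

lemma velNorm_adjoin {n : ℕ} (ε : ℝ) (Z : Config d n) (j : Fin n) (p : AdjParam d) :
    velNorm (adjoin ε Z j p) ^ 2 = velNorm Z ^ 2 + ‖p.2‖ ^ 2 := by
  rw [velNorm_sq, velNorm_sq, Fin.sum_univ_castSucc, adjoin_vel_last,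
    ← Finset.add_sum_erase _ _ (Finset.mem_univ j), ← Finset.add_sum_erase _ (fun i => ‖Z.2 i‖ ^ 2)
    (Finset.mem_univ j), adjoin_vel_host]
  have : ∑ i ∈ Finset.univ.erase j, ‖(adjoin ε Z j p).2 i.castSucc‖ ^ 2 =
      ∑ i ∈ Finset.univ.erase j, ‖Z.2 i‖ ^ 2 :=
    Finset.sum_congr rfl fun i hi => by rw [adjoin_vel_of_ne _ _ _ _ (Finset.ne_of_mem_erase hi)]
  rw [this]
  linarith [norm_sq_hostVel_add (Z.2 j) p]

/-- The condition on the configuration that follows an adjunction next to the particle `j`, under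
which neither a recollision nor a loss of the separation `F` takes place later. -/
structure IsSafe {n : ℕ} (α δ F D : ℝ) (j : Fin n) (Z : Config d (n + 1)) : Prop where
  vel_zero : ∀ i, α ≤ |Z.2 i 0|
  late : ∀ i i', i ≠ i' → ApartFrom δ F (particle Z i) (particle Z i')
  apart : ∀ i i', i ≠ i' → ¬(i = j.castSucc ∧ i' = Fin.last n) →
    ¬(i' = j.castSucc ∧ i = Fin.last n) → ApartFrom 0 D (particle Z i) (particle Z i')
  pair : KeepsFrom 0 D (particle Z j.castSucc) (mirror (particle Z (Fin.last n)))
  vel_ne : Z.2 (Fin.last n) ≠ Z.2 j.castSucc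

/-- The condition on a configuration under which an adjunction next to `j` is considered. -/
structure IsReady {n : ℕ} (α F R r : ℝ) (j : Fin n) (Z : Config d n) : Prop where
  apart : ∀ i i', i ≠ i' → ApartFrom 0 F (particle Z i) (particle Z i')
  vel_le : ∀ i, ‖Z.2 i‖ ≤ R
  vel_zero : ∀ i, α ≤ |Z.2 i 0|
  far : r ≤ Z.1 j 0
  card_le : n * α ^ 2 ≤ R ^ 2

/-- The adjoined particle and its host behave well with respect to a particle `Q`. -/
def GoodFor (δ F D : ℝ) (x w : Vec d) (Q : Vec d × Vec d) (p : AdjParam d) : Prop :=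
  (KeepsFrom 0 D (x, hostVel w p) Q ∧ KeepsFrom δ F (x, hostVel w p) Q) ∧
    (KeepsFrom 0 D (x, guestVel w p) Q ∧ KeepsFrom δ F (x, guestVel w p) Q)

/-- The adjoined particle and its host behave well with respect to each other and to the wall. -/
structure GoodPair (α η δ F D : ℝ) (x w : Vec d) (p : AdjParam d) : Prop where
  vel_sub : η < ‖p.2 - w‖
  host : α ≤ |hostVel w p 0|
  guest : α ≤ |guestVel w p 0|
  apart : KeepsFrom 0 D (x, hostVel w p) (mirror (x, guestVel w p))
  late : KeepsFrom δ F (x, hostVel w p) (mirror (x, guestVel w p))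

/-- Pairs without the host and the guest inherit the separation `F` from `IsReady`, and pairs with
one of the two are covered by `GoodFor`. The host and the guest leave the same point with relative
speed above `η`, so after the time `δ` their distance is at least `η * δ ≥ F`. -/
lemma isSafe_adjoin {n : ℕ} {α δ F D R r η : ℝ} {j : Fin n} {Z : Config d n}
    (hZ : IsReady α F R r j Z) (hδ : 0 ≤ δ) (hη : 0 ≤ η) (hDF : D ≤ F) (hF : F ≤ η * δ)
    {p : AdjParam d} (hp : GoodPair α η δ F D (Z.1 j) (Z.2 j) p)
    (hi : ∀ i, i ≠ j → GoodFor δ F D (Z.1 j) (Z.2 j) (particle Z i) p ∧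
      GoodFor δ F D (Z.1 j) (Z.2 j) (mirror (particle Z i)) p) :
    IsSafe α δ F D j (adjoin 0 Z j p) := by
  set Y := adjoin 0 Z j p with hY
  have hold : ∀ i, i ≠ j → particle Y i.castSucc = particle Z i := fun i hi => by
    simp only [particle, hY, adjoin_pos_castSucc, adjoin_vel_of_ne _ _ _ _ hi]
  have hhost : particle Y j.castSucc = (Z.1 j, hostVel (Z.2 j) p) := by
    simp only [particle, hY, adjoin_pos_castSucc, adjoin_vel_host]
  have hguest : particle Y (Fin.last n) = (Z.1 j, guestVel (Z.2 j) p) := by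
    simp only [particle, hY, adjoin_pos_last, adjoin_vel_last, zero_smul, add_zero]
  have h1 : ∀ i, i ≠ j → ApartFrom 0 D (particle Y j.castSucc) (particle Y i.castSucc) ∧
      ApartFrom δ F (particle Y j.castSucc) (particle Y i.castSucc) ∧
      ApartFrom 0 D (particle Y (Fin.last n)) (particle Y i.castSucc) ∧
      ApartFrom δ F (particle Y (Fin.last n)) (particle Y i.castSucc) := by
    intro i hij
    obtain ⟨ha, hb⟩ := hi i hij
    rw [hold i hij, hhost, hguest]
    simp only [apartFrom_iff]
    exact ⟨⟨ha.1.1, hb.1.1⟩, ⟨ha.1.2, hb.1.2⟩, ⟨ha.2.1, hb.2.1⟩, ⟨ha.2.2, hb.2.2⟩⟩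
  have h2 : ∀ i i', i ≠ i' → i ≠ j → i' ≠ j →
      ApartFrom 0 F (particle Y i.castSucc) (particle Y i'.castSucc) := by
    intro i i' hne hi hi'
    rw [hold i hi, hold i' hi']
    exact hZ.apart i i' hne
  have h3 : ApartFrom δ F (particle Y j.castSucc) (particle Y (Fin.last n)) := by
    rw [hhost, hguest, apartFrom_iff]
    refine ⟨fun u hu => ?_, hp.late⟩
    rw [sub_self, zero_sub, norm_neg, norm_smul, norm_sub_rev, norm_guestVel_sub_hostVel,
      Real.norm_of_nonneg (hδ.trans hu)]
    calc F ≤ η * δ := hF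
      _ ≤ ‖p.2 - Z.2 j‖ * u := mul_le_mul hp.vel_sub.le hu hδ (norm_nonneg _)
      _ = _ := mul_comm _ _
  refine ⟨?_, ?_, ?_, ?_, ?_⟩
  · intro i
    refine Fin.lastCases ?_ (fun i => ?_) i
    · rw [adjoin_vel_last]; exact hp.guest
    · by_cases hij : i = j
      · rw [hij, adjoin_vel_host]; exact hp.host
      · rw [adjoin_vel_of_ne _ _ _ _ hij]; exact hZ.vel_zero i
  · intro i i'
    refine Fin.lastCases ?_ (fun i => ?_) i <;> refine Fin.lastCases ?_ (fun i' => ?_) i'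
    · exact fun h => absurd rfl h
    · intro _
      by_cases hij : i' = j
      · rw [hij]; exact h3.symm
      · exact (h1 i' hij).2.2.2
    · intro _
      by_cases hij : i = j
      · rw [hij]; exact h3
      · exact (h1 i hij).2.2.2.symm
    · intro hne
      have hne' : i ≠ i' := fun h => hne (by rw [h])
      by_cases hij : i = j
      · rw [hij]; exact (h1 i' (fun h => hne' (hij.trans h.symm))).2.1
      · by_cases hij' : i' = j
        · rw [hij']; exact (h1 i hij).2.1.symm
        · exact (h2 i i' hne' hij hij').mono hδ le_rfl
  · intro i i'
    refine Fin.lastCases ?_ (fun i => ?_) i <;> refine Fin.lastCases ?_ (fun i' => ?_) i'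
    · exact fun h => absurd rfl h
    · intro _ _ h
      by_cases hij : i' = j
      · exact absurd ⟨by rw [hij], rfl⟩ h
      · exact (h1 i' hij).2.2.1
    · intro _ h _
      by_cases hij : i = j
      · exact absurd ⟨by rw [hij], rfl⟩ h
      · exact (h1 i hij).2.2.1.symm
    · intro hne _ _
      have hne' : i ≠ i' := fun h => hne (by rw [h])
      by_cases hij : i = j
      · rw [hij]; exact (h1 i' (fun h => hne' (hij.trans h.symm))).1
      · by_cases hij' : i' = j
        · rw [hij']; exact (h1 i hij).1.symm
        · exact (h2 i i' hne' hij hij').mono le_rfl hDF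
  · rw [hhost, hguest]; exact hp.apart
  · rw [adjoin_vel_last, adjoin_vel_host]
    intro h
    have := norm_guestVel_sub_hostVel (Z.2 j) p
    rw [h, sub_self, norm_zero] at this
    linarith [hp.vel_sub]

/-! ### Measure of the adjunction parameters that break safety. -/

lemma ofReal_mul_ofReal_pow {x y : ℝ} (hx : 0 ≤ x) (hy : 0 ≤ y) (n : ℕ) :
    ENNReal.ofReal x * ENNReal.ofReal y ^ n = ENNReal.ofReal (x * y ^ n) := by
  rw [ENNReal.ofReal_mul hx, ENNReal.ofReal_pow hy]

/-- The parameters for which the velocities `v - w`, `⟪ω, v - w⟫` or `v - w - ⟪ω, v - w⟫ ω` of the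
scattering are small. -/
def grazingSet (w : Vec d) (R m : ℝ) : Set (AdjParam d) :=
  {p | ‖p.2‖ ≤ R ∧ 0 < inner ℝ (p.1 : Vec d) (p.2 - w) ∧
    (inner ℝ (p.1 : Vec d) (p.2 - w) ≤ m ∨
      ‖p.2 - w - inner ℝ (p.1 : Vec d) (p.2 - w) • (p.1 : Vec d)‖ ≤ m)}

lemma norm_sub_le_two_mul {w v : Vec d} {R : ℝ} (hw : ‖w‖ ≤ R) (hv : ‖v‖ ≤ R) :
    ‖v - w‖ ≤ 2 * R := (norm_sub_le _ _).trans (by linarith)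

lemma adjMeasure_grazingSet_le {w : Vec d} {R m : ℝ} (hw : ‖w‖ ≤ R) (hm : 0 ≤ m) :
    adjMeasure d (grazingSet w R m) ≤ ENNReal.ofReal (d * 2 ^ d * (m * (4 * R) ^ (d - 1)) +
      d * 2 ^ d * (4 * R * (2 * m) ^ (d - 1))) := by
  have hR : 0 ≤ R := (norm_nonneg w).trans hw
  let A : Set (AdjParam d) := {p | ‖p.2 - w‖ ≤ 2 * R ∧ inner ℝ (p.1 : Vec d) (p.2 - w) ∈ Icc 0 m}
  let B : Set (AdjParam d) := {p | ‖p.2 - w‖ ≤ 2 * R ∧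
    ‖p.2 - w - inner ℝ (p.1 : Vec d) (p.2 - w) • (p.1 : Vec d)‖ ≤ m}
  have hi := measurable_inner_adj w
  have hn : Measurable fun p : AdjParam d => ‖p.2 - w‖ := by fun_prop
  have hA : MeasurableSet A := (measurableSet_le hn measurable_const).inter (hi measurableSet_Icc)
  have hB : MeasurableSet B := by
    have h1 : Measurable fun p : AdjParam d =>
        p.2 - w - inner ℝ (p.1 : Vec d) (p.2 - w) • (p.1 : Vec d) :=
      (measurable_snd.sub measurable_const).sub
        (hi.smul (measurable_subtype_coe.comp measurable_fst))
    exact (measurableSet_le hn measurable_const).inter (measurableSet_le h1.norm measurable_const)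
  have hsub : grazingSet w R m ⊆ A ∪ B := by
    rintro p ⟨h1, h2, h3⟩
    have h4 := norm_sub_le_two_mul hw h1
    rcases h3 with h3 | h3
    · exact Or.inl ⟨h4, h2.le, h3⟩
    · exact Or.inr ⟨h4, h3⟩
  refine (measure_mono hsub).trans ((measure_union_le _ _).trans ?_)
  rw [ENNReal.ofReal_add (by positivity) (by positivity)]
  refine add_le_add ?_ ?_
  · refine (adjMeasure_le_const hA fun ω =>
      volume_slab_le (norm_sphere ω) w measurableSet_Icc (2 * R)).trans (le_of_eq ?_)
    rw [Real.volume_Icc, sub_zero, ofReal_mul_ofReal_pow hm (by positivity),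
      ← ENNReal.ofReal_mul (by positivity)]
    congr 3; ring
  · refine (adjMeasure_le_const hB fun ω =>
      volume_cylinder_le (norm_sphere ω) w w (2 * R) m).trans (le_of_eq ?_)
    rw [ofReal_mul_ofReal_pow (by positivity) (by positivity), ← ENNReal.ofReal_mul (by positivity)]
    congr 2; ring

lemma norm_hostVel_le {w : Vec d} {p : AdjParam d} {R : ℝ} (hw : ‖w‖ ≤ R) (hp : ‖p.2‖ ≤ R) :
    ‖hostVel w p‖ ≤ 2 * R ∧ ‖guestVel w p‖ ≤ 2 * R := by
  have h := norm_sq_hostVel_add w p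
  have hR : 0 ≤ R := (norm_nonneg w).trans hw
  have h1 : ‖w‖ ^ 2 ≤ R ^ 2 := by gcongr
  have h2 : ‖p.2‖ ^ 2 ≤ R ^ 2 := by gcongr
  constructor
  · exact le_of_sq_le_sq (by nlinarith [sq_nonneg ‖guestVel w p‖]) (by positivity)
  · exact le_of_sq_le_sq (by nlinarith [sq_nonneg ‖hostVel w p‖]) (by positivity)

/-- Measure of the parameters for which the adjunction behaves badly with respect to a particle. -/
lemma adjMeasure_not_goodFor_le (hd : 2 ≤ d) {x w : Vec d} {Q : Vec d × Vec d} {R D F δ m κ : ℝ}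
    (hD : 0 < D) (hDF : 4 * D ≤ F) (hδ : 0 < δ) (hFR : F ≤ δ * R) (hw : ‖w‖ ≤ R) (hQ : ‖Q.2‖ ≤ R)
    (hm : 0 < m) (hκ : 0 < κ) (hκ1 : κ < 1) (hk : KeepsFrom 0 F (x, w) Q) :
    adjMeasure d ({p | ‖p.2‖ ≤ R ∧ ¬ GoodFor δ F D x w Q p} \ grazingSet w R m) ≤
      ENNReal.ofReal (
        d * 2 ^ d * (4 * R * (2 * max (8 * D * R / F) (F / δ)) ^ (d - 1)) +
        (4 * R) ^ (d - 1) * (4 * R * (16 * D / F) ^ (d - 1)) +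
        (4 * R) ^ (d - 1) *
          (m ^ (-((d : ℝ) - 2 + κ)) * (2 * (2 * R) ^ κ / κ * (2 * (F / δ)) ^ (d - 1))) +
        2 * R * (d * 2 ^ d) * (m ^ (-κ) * (2 * (2 * (2 * R)) ^ κ / κ *
          (4 * max (8 * D * R / F) (F / δ)) ^ (d - 1)))) := by
  have hF : 0 < F := by linarith
  have hR : 0 < R := by
    by_contra h
    have : δ * R ≤ 0 := mul_nonpos_of_nonneg_of_nonpos hδ.le (not_lt.1 h)
    linarith
  set τ := max (8 * D * R / F) (F / δ) with hτ
  have hτ0 : 0 < τ := lt_max_of_lt_right (by positivity)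
  have hτR : τ ≤ 2 * R := by
    refine max_le ?_ ?_
    · rw [div_le_iff₀ hF]; nlinarith
    · rw [div_le_iff₀ hδ]; nlinarith
  set P := x - Q.1 with hP
  have hPF : F ≤ ‖P‖ := by simpa using hk 0 le_rfl
  have hP0 : 0 < ‖P‖ := hF.trans_le hPF
  set e := ‖P‖⁻¹ • P with he'
  have he : ‖e‖ = 1 := norm_inv_norm_smul hP0
  have hclose : ∀ h : Vec d, ‖h‖ ≤ 4 * R → ∀ u : ℝ, 0 ≤ u → ‖P - u • h‖ ≤ D →
      ‖h - inner ℝ e h • e‖ ≤ τ := by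
    intro h hh u hu hD'
    refine (norm_orthogonal_le_of_close hu hD (by linarith) hh hD').trans (le_max_of_le_left ?_)
    rw [show 8 * D * R = 2 * D * (4 * R) by ring]
    gcongr
  have hlate : ∀ h : Vec d, ∀ u : ℝ, δ ≤ u → ‖P - u • h‖ ≤ F →
      ‖h - inner ℝ e h • e‖ ≤ F / δ := fun h u hu hF' => norm_orthogonal_le_of_late hP0 hδ hu hF'
  have hnot : ∀ V : Vec d, ‖V - Q.2‖ ≤ 4 * R →
      ¬ (KeepsFrom 0 D (x, V) Q ∧ KeepsFrom δ F (x, V) Q) →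
      ‖(V - Q.2) - inner ℝ e (V - Q.2) • e‖ ≤ τ := by
    intro V hV h
    by_cases h1 : KeepsFrom 0 D (x, V) Q
    · have h2 : ¬ KeepsFrom δ F (x, V) Q := fun h2 => h ⟨h1, h2⟩
      simp only [KeepsFrom, not_forall, not_le] at h2
      obtain ⟨u, hu, h3⟩ := h2
      exact (hlate _ u hu h3.le).trans (le_max_right _ _)
    · simp only [KeepsFrom, not_forall, not_le] at h1
      obtain ⟨u, hu, h3⟩ := h1
      exact hclose _ hV u hu h3.le
  let q := Q.2 - w
  -- `S7`: no scattering, so the guest keeps its velocity `v`. `S8` and `S9`: scattering makes the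
  -- host come within `D`, or within `F` after the time `δ`. `S10`: scattering makes the guest do
  -- either. For `S8`, the separation `F` kept by the old velocity `w` spares the negative power of
  -- `m` that a cylinder estimate as in `S9` would cost.
  let S7 : Set (AdjParam d) := {p | p.2 ∈ {v : Vec d | ‖v - w‖ ≤ 2 * R ∧
    ‖(v - Q.2) - inner ℝ e (v - Q.2) • e‖ ≤ τ}}
  let S8 : Set (AdjParam d) := {p | ‖p.2 - w‖ ≤ 2 * R ∧ 0 < inner ℝ (p.1 : Vec d) (p.2 - w) ∧
      inner ℝ (p.1 : Vec d) (p.2 - w) • (p.1 : Vec d) ∈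
        {y | ‖(w - Q.2) + y‖ ≤ 4 * R ∧ ∃ u : ℝ, 0 ≤ u ∧ ‖P - u • ((w - Q.2) + y)‖ ≤ D}}
  let S9 : Set (AdjParam d) := {p | ‖p.2 - w‖ ≤ 2 * R ∧ 0 < inner ℝ (p.1 : Vec d) (p.2 - w) ∧
      inner ℝ (p.1 : Vec d) (p.2 - w) • (p.1 : Vec d) ∈
        {y | m ≤ ‖y‖ ∧ ‖y‖ ≤ 2 * R ∧ ‖(y - q) - inner ℝ e (y - q) • e‖ ≤ F / δ}}
  let S10 : Set (AdjParam d) := {p | ‖p.2 - w‖ ≤ 2 * R ∧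
      (p.2 - w) - inner ℝ (p.1 : Vec d) (p.2 - w) • (p.1 : Vec d) ∈
        {y | m ≤ ‖y‖ ∧ ‖(y - q) - inner ℝ e (y - q) • e‖ ≤ τ}}
  have hsub : {p | ‖p.2‖ ≤ R ∧ ¬ GoodFor δ F D x w Q p} \ grazingSet w R m ⊆
      S7 ∪ S8 ∪ S9 ∪ S10 := by
    rintro p ⟨⟨hp, hbad⟩, hg⟩
    have h2R := norm_sub_le_two_mul hw hp
    obtain ⟨hh, hg'⟩ := norm_hostVel_le (p := p) hw hp
    have hh4 : ‖hostVel w p - Q.2‖ ≤ 4 * R := (norm_sub_le _ _).trans (by linarith)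
    have hg4 : ‖guestVel w p - Q.2‖ ≤ 4 * R := (norm_sub_le _ _).trans (by linarith)
    by_cases hs : 0 < inner ℝ (p.1 : Vec d) (p.2 - w)
    · set l : ℝ := inner ℝ (p.1 : Vec d) (p.2 - w) with hl
      have hm1 : m < l := by
        by_contra h'
        exact hg ⟨hp, hs, Or.inl (not_lt.1 h')⟩
      have hm2 : m < ‖p.2 - w - l • (p.1 : Vec d)‖ := by
        by_contra h'
        exact hg ⟨hp, hs, Or.inr (not_lt.1 h')⟩
      have hhost : hostVel w p = w + l • (p.1 : Vec d) := by rw [hostVel, if_pos hs]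
      have hguest : guestVel w p = p.2 - l • (p.1 : Vec d) := by rw [guestVel, if_pos hs]
      have hlω : ‖l • (p.1 : Vec d)‖ = l := by
        rw [norm_smul, norm_sphere, mul_one, Real.norm_of_nonneg hs.le]
      by_cases hb : KeepsFrom 0 D (x, guestVel w p) Q ∧ KeepsFrom δ F (x, guestVel w p) Q
      · have hb' : ¬ (KeepsFrom 0 D (x, hostVel w p) Q ∧ KeepsFrom δ F (x, hostVel w p) Q) :=
          fun h' => hbad ⟨h', hb⟩
        have hrel : hostVel w p - Q.2 = (w - Q.2) + l • (p.1 : Vec d) := by rw [hhost]; module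
        by_cases hc : KeepsFrom 0 D (x, hostVel w p) Q
        · have hc' : ¬ KeepsFrom δ F (x, hostVel w p) Q := fun h' => hb' ⟨hc, h'⟩
          simp only [KeepsFrom, not_forall, not_le] at hc'
          obtain ⟨u, hu, h3⟩ := hc'
          refine Or.inl (Or.inr ⟨h2R, hs, ?_, ?_, ?_⟩)
          · rw [hlω]; exact hm1.le
          · rw [hlω]
            have := abs_real_inner_le_norm (p.1 : Vec d) (p.2 - w)
            rw [norm_sphere, one_mul] at this
            exact (le_abs_self _).trans (this.trans h2R)
          · have h4 := hlate _ u hu h3.le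
            have h5 : l • (p.1 : Vec d) - q = hostVel w p - Q.2 := by rw [hrel]; simp only [q]; module
            rw [h5]; exact h4
        · simp only [KeepsFrom, not_forall, not_le] at hc
          obtain ⟨u, hu, h3⟩ := hc
          refine Or.inl (Or.inl (Or.inr ⟨h2R, hs, ?_, u, hu, ?_⟩))
          · rw [← hrel]; exact hh4
          · rw [← hrel]; exact h3.le
      · have h4 := hnot _ hg4 hb
        refine Or.inr ⟨h2R, hm2.le, ?_⟩
        have h5 : (p.2 - w - l • (p.1 : Vec d)) - q = guestVel w p - Q.2 := by
          rw [hguest]; simp only [q]; module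
        rw [h5]; exact h4
    · have hhost : hostVel w p = w := by rw [hostVel, if_neg hs]
      have hguest : guestVel w p = p.2 := by rw [guestVel, if_neg hs]
      rw [GoodFor, hhost, hguest] at hbad
      have hgood : KeepsFrom 0 D (x, w) Q ∧ KeepsFrom δ F (x, w) Q :=
        ⟨fun u hu => le_trans (by linarith) (hk u hu), fun u hu => hk u (hδ.le.trans hu)⟩
      have h4 := hnot p.2 (by rw [← hguest]; exact hg4) (fun h' => hbad ⟨hgood, h'⟩)
      exact Or.inl (Or.inl (Or.inl ⟨h2R, h4⟩))
  refine (measure_mono hsub).trans ((measure_union_le _ _).trans ?_)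
  have h7 : adjMeasure d S7 ≤ ENNReal.ofReal (d * 2 ^ d * (4 * R * (2 * τ) ^ (d - 1))) := by
    refine (adjMeasure_univ_prod_le _).trans ((mul_le_mul_right
      (volume_cylinder_le he w Q.2 (2 * R) τ) _).trans (le_of_eq ?_))
    rw [ofReal_mul_ofReal_pow (by positivity) (by positivity), ← ENNReal.ofReal_mul (by positivity)]
    congr 2; ring
  have h8 : adjMeasure d S8 ≤ ENNReal.ofReal ((4 * R) ^ (d - 1) *
      (4 * R * (16 * D / F) ^ (d - 1))) := by
    refine (adjMeasure_component_close_le w P (w - Q.2) (H := 2 * R) (H' := 4 * R) hD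
      (by linarith : 2 * D ≤ F) fun u hu => hk u hu).trans (le_of_eq ?_)
    rw [← ENNReal.ofReal_pow (by positivity), ← ENNReal.ofReal_mul (by positivity)]
    congr 3; ring
  have h9 : adjMeasure d S9 ≤ ENNReal.ofReal ((4 * R) ^ (d - 1) *
      (m ^ (-((d : ℝ) - 2 + κ)) * (2 * (2 * R) ^ κ / κ * (2 * (F / δ)) ^ (d - 1)))) := by
    refine (adjMeasure_component_cylinder_le w q he hd hm (by positivity : 0 < 2 * R) hκ hκ1
      (by positivity : 0 ≤ F / δ)).trans (le_of_eq ?_)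
    congr 3; ring
  have h10 := adjMeasure_orthogonal_cylinder_le w q he (H := 2 * R) (τ := τ) hm hκ hκ1 hτ0 hτR
  rw [ENNReal.ofReal_add (by positivity) (by positivity),
    ENNReal.ofReal_add (by positivity) (by positivity),
    ENNReal.ofReal_add (by positivity) (by positivity)]
  refine add_le_add ((measure_union_le _ _).trans (add_le_add ((measure_union_le _ _).trans
    (add_le_add h7 h8)) h9)) h10

lemma symm₀_sub_self (x : Vec d) : x - symm₀ x = (2 * x 0) • e₁ := by
  rw [symm₀]; module

/-- The reflection changes only the component along `e₁`. Since `x - symm₀ x` is also along `e₁`,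
the encounter of the host with the mirror image of the guest is controlled by the tangential part of
their relative velocity. -/
lemma orthogonal_sub_symm₀ (v w : Vec d) :
    (v - symm₀ w) - inner ℝ (e₁ : Vec d) (v - symm₀ w) • (e₁ : Vec d) =
      (v - w) - inner ℝ (e₁ : Vec d) (v - w) • (e₁ : Vec d) := by
  rw [inner_e₁, inner_e₁, PiLp.sub_apply, PiLp.sub_apply, symm₀_zero_coord, symm₀]
  module

lemma norm_reflect (ω : Metric.sphere (0 : Vec d) 1) (v : Vec d) :
    ‖v - (2 * inner ℝ (ω : Vec d) v) • (ω : Vec d)‖ = ‖v‖ := by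
  refine (sq_eq_sq₀ (norm_nonneg _) (norm_nonneg _)).1 ?_
  rw [norm_sub_sq_real, inner_smul_right, real_inner_comm, norm_smul, norm_sphere, mul_one,
    Real.norm_eq_abs, sq_abs]
  ring

/-- Measure of the parameters for which the adjoined pair does not behave well. -/
lemma adjMeasure_not_goodPair_le (hd : 2 ≤ d) {x w : Vec d} {R D F δ ρ α η s : ℝ}
    (hD : 0 < D) (hF : 0 < F) (hδ : 0 < δ) (hρ : 4 * D ≤ ρ) (hx : ρ ≤ 2 * x 0)
    (hw : ‖w‖ ≤ R) (hα : 0 ≤ α) (hwα : α ≤ |w 0|) (hs : 0 < s) (hη : 0 ≤ η) :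
    adjMeasure d {p | ‖p.2‖ ≤ R ∧ ¬ GoodPair α η δ F D x w p} ≤
      ENNReal.ofReal (d * 2 ^ d * (2 * η) ^ d + d * 2 ^ d * (2 * α * (2 * R) ^ (d - 1)) +
        (d * 2 ^ d) * (s * (4 * R) ^ d + 2 * α / s * (4 * R) ^ (d - 1)) +
        (d * 2 ^ d) * (s * (4 * R) ^ d + 2 * α / s * (4 * R) ^ (d - 1)) +
        d * 2 ^ d * (4 * R * (2 * max (8 * D * R / ρ) (F / δ)) ^ (d - 1)) +
        d * 2 ^ d * (4 * R * (2 * max (8 * D * R / ρ) (F / δ)) ^ (d - 1))) := by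
  have hR : 0 ≤ R := (norm_nonneg w).trans hw
  have hρ0 : 0 < ρ := by linarith
  set τ := max (8 * D * R / ρ) (F / δ) with hτ
  have hτ0 : 0 < τ := lt_max_of_lt_right (by positivity)
  have hP : ‖x - symm₀ x‖ = 2 * x 0 := by
    rw [symm₀_sub_self, norm_smul, norm_e₁, mul_one, Real.norm_of_nonneg (by linarith)]
  have hP0 : 0 < ‖x - symm₀ x‖ := by rw [hP]; linarith
  have hPe : ‖x - symm₀ x‖⁻¹ • (x - symm₀ x) = e₁ := by
    rw [hP, symm₀_sub_self, smul_smul, inv_mul_cancel₀ (by linarith), one_smul]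
  have hnot : ∀ V V' : Vec d, ‖V - symm₀ V'‖ ≤ 4 * R →
      ¬ (KeepsFrom 0 D (x, V) (mirror (x, V')) ∧ KeepsFrom δ F (x, V) (mirror (x, V'))) →
      ‖(V - V') - inner ℝ (e₁ : Vec d) (V - V') • (e₁ : Vec d)‖ ≤ τ := by
    intro V V' hV h
    rw [← orthogonal_sub_symm₀, ← hPe]
    by_cases h1 : KeepsFrom 0 D (x, V) (mirror (x, V'))
    · have h2 : ¬ KeepsFrom δ F (x, V) (mirror (x, V')) := fun h2 => h ⟨h1, h2⟩
      simp only [KeepsFrom, not_forall, not_le, mirror] at h2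
      obtain ⟨u, hu, h3⟩ := h2
      exact (norm_orthogonal_le_of_late hP0 hδ hu h3.le).trans (le_max_right _ _)
    · simp only [KeepsFrom, not_forall, not_le, mirror] at h1
      obtain ⟨u, hu, h3⟩ := h1
      refine (norm_orthogonal_le_of_close hu hD (by rw [hP]; linarith) hV h3.le).trans
        (le_max_of_le_left ?_)
      rw [hP, show 8 * D * R = 2 * D * (4 * R) by ring]
      gcongr
  let S1 : Set (AdjParam d) := {p | p.2 ∈ {v : Vec d | ‖v - w‖ ≤ η}}
  let S2 : Set (AdjParam d) := {p | p.2 ∈ {v : Vec d | ‖v - 0‖ ≤ R ∧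
    inner ℝ (e₁ : Vec d) (v - 0) ∈ Icc (-α) α}}
  let S3 : Set (AdjParam d) := {q | ‖q.2 - w‖ ≤ 2 * R ∧
      |w 0 + inner ℝ (q.1 : Vec d) (q.2 - w) * (q.1 : Vec d) 0| ≤ α}
  let S4 : Set (AdjParam d) := {q | ‖q.2 - w‖ ≤ 2 * R ∧
      |w 0 + ((q.2 - w) 0 - inner ℝ (q.1 : Vec d) (q.2 - w) * (q.1 : Vec d) 0)| ≤ α}
  let S5 : Set (AdjParam d) := {p | p.2 ∈ {v : Vec d | ‖v - w‖ ≤ 2 * R ∧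
    ‖(v - w) - inner ℝ (e₁ : Vec d) (v - w) • (e₁ : Vec d)‖ ≤ τ}}
  -- `f ω` is the image of `e₁` under the reflection of direction `ω`. This reflection maps the
  -- relative velocity before scattering to the one after it, so the part orthogonal to `e₁`
  -- afterwards has the norm of the part orthogonal to `f ω` beforehand.
  let f : Metric.sphere (0 : Vec d) 1 → Vec d :=
    fun ω => e₁ - (2 * inner ℝ (ω : Vec d) (e₁ : Vec d)) • (ω : Vec d)
  have hf : ∀ ω, ‖f ω‖ = 1 := fun ω => by rw [norm_reflect, norm_e₁]
  have hfm : Measurable f := by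
    have h1 : Measurable fun ω : Metric.sphere (0 : Vec d) 1 => (2 * inner ℝ (ω : Vec d) (e₁ : Vec d) : ℝ) := by
      fun_prop
    exact measurable_const.sub (h1.smul measurable_subtype_coe)
  let S6 : Set (AdjParam d) := {p | ‖p.2 - w‖ ≤ 2 * R ∧
    ‖(p.2 - w) - inner ℝ (f p.1) (p.2 - w) • f p.1‖ ≤ τ}
  have hS6 : MeasurableSet S6 := by
    have hn : Measurable fun p : AdjParam d => ‖p.2 - w‖ := by fun_prop
    have h0 : Measurable fun p : AdjParam d => p.2 - w := by fun_prop
    have hf1 : Measurable fun p : AdjParam d => f p.1 := hfm.comp measurable_fst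
    have hin : Measurable fun p : AdjParam d => (inner ℝ (f p.1) (p.2 - w) : ℝ) := hf1.inner h0
    have h1 : Measurable fun p : AdjParam d =>
        p.2 - w - (inner ℝ (f p.1) (p.2 - w) : ℝ) • f p.1 := h0.sub (hin.smul hf1)
    exact (measurableSet_le hn measurable_const).inter (measurableSet_le h1.norm measurable_const)
  have hsub : {p | ‖p.2‖ ≤ R ∧ ¬ GoodPair α η δ F D x w p} ⊆ S1 ∪ S2 ∪ S3 ∪ S4 ∪ S5 ∪ S6 := by
    rintro p ⟨hp, hbad⟩
    by_contra hno
    simp only [mem_union, not_or] at hno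
    obtain ⟨⟨⟨⟨⟨n1, n2⟩, n3⟩, n4⟩, n5⟩, n6⟩ := hno
    have h2R := norm_sub_le_two_mul hw hp
    obtain ⟨hh, hg⟩ := norm_hostVel_le (p := p) hw hp
    have h4R : ‖hostVel w p - symm₀ (guestVel w p)‖ ≤ 4 * R := by
      refine (norm_sub_le _ _).trans ?_
      rw [norm_symm₀]; linarith
    have hvel : η < ‖p.2 - w‖ := not_le.1 n1
    by_cases hsc : 0 < inner ℝ (p.1 : Vec d) (p.2 - w)
    · set l : ℝ := inner ℝ (p.1 : Vec d) (p.2 - w) with hl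
      have hhost : hostVel w p = w + l • (p.1 : Vec d) := by rw [hostVel, if_pos hsc]
      have hguest : guestVel w p = p.2 - l • (p.1 : Vec d) := by rw [guestVel, if_pos hsc]
      have h6 : τ < ‖(hostVel w p - guestVel w p) -
          inner ℝ (e₁ : Vec d) (hostVel w p - guestVel w p) • (e₁ : Vec d)‖ := by
        have h7 : τ < ‖(p.2 - w) - inner ℝ (f p.1) (p.2 - w) • f p.1‖ := by
          by_contra h'
          exact n6 ⟨h2R, not_lt.1 h'⟩
        refine h7.trans_le (le_of_eq ?_)
        rw [← norm_reflect p.1, ← norm_neg]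
        congr 1
        have hωω : inner ℝ (p.1 : Vec d) (p.1 : Vec d) = (1 : ℝ) :=
          inner_self_eq_one (norm_sphere p.1)
        rw [hhost, hguest]
        simp only [f, inner_sub_left, inner_sub_right, inner_add_right, inner_smul_left,
          inner_smul_right, RCLike.conj_to_real, hωω, hl,
          real_inner_comm (p.1 : Vec d) (e₁ : Vec d)]
        module
      have hk : KeepsFrom 0 D (x, hostVel w p) (mirror (x, guestVel w p)) ∧
          KeepsFrom δ F (x, hostVel w p) (mirror (x, guestVel w p)) := by
        by_contra h'
        exact absurd (hnot _ _ h4R h') (not_le.2 h6)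
      refine hbad ⟨hvel, ?_, ?_, hk.1, hk.2⟩
      · by_contra h'
        refine n3 ⟨h2R, ?_⟩
        rw [hhost, PiLp.add_apply, PiLp.smul_apply, smul_eq_mul] at h'
        exact (not_le.1 h').le
      · by_contra h'
        refine n4 ⟨h2R, ?_⟩
        rw [hguest, PiLp.sub_apply, PiLp.smul_apply, smul_eq_mul] at h'
        rw [PiLp.sub_apply]
        refine le_trans (le_of_eq ?_) (not_le.1 h').le
        congr 1
        ring
    · have hhost : hostVel w p = w := by rw [hostVel, if_neg hsc]
      have hguest : guestVel w p = p.2 := by rw [guestVel, if_neg hsc]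
      have h6 : τ < ‖(hostVel w p - guestVel w p) -
          inner ℝ (e₁ : Vec d) (hostVel w p - guestVel w p) • (e₁ : Vec d)‖ := by
        have h7 : τ < ‖(p.2 - w) - inner ℝ (e₁ : Vec d) (p.2 - w) • (e₁ : Vec d)‖ := by
          by_contra h'
          exact n5 ⟨h2R, not_lt.1 h'⟩
        refine h7.trans_le (le_of_eq ?_)
        rw [← norm_neg, hhost, hguest]
        congr 1
        rw [inner_sub_right, inner_sub_right]
        module
      have hk : KeepsFrom 0 D (x, hostVel w p) (mirror (x, guestVel w p)) ∧
          KeepsFrom δ F (x, hostVel w p) (mirror (x, guestVel w p)) := by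
        by_contra h'
        exact absurd (hnot _ _ h4R h') (not_le.2 h6)
      refine hbad ⟨hvel, by rwa [hhost], ?_, hk.1, hk.2⟩
      by_contra h'
      refine n2 ⟨by rwa [sub_zero], ?_⟩
      rw [sub_zero, inner_e₁, mem_Icc, ← abs_le, ← hguest]
      exact (not_le.1 h').le
  have hH : (2 : ℝ) * (2 * R) = 4 * R := by ring
  have hg : ENNReal.ofReal (d * 2 ^ d) * (ENNReal.ofReal s * ENNReal.ofReal (2 * (2 * R)) ^ d +
        ENNReal.ofReal (2 * α / s) * ENNReal.ofReal (2 * (2 * R)) ^ (d - 1)) =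
      ENNReal.ofReal ((d * 2 ^ d) * (s * (4 * R) ^ d + 2 * α / s * (4 * R) ^ (d - 1))) := by
    rw [hH, ofReal_mul_ofReal_pow (by positivity) (by positivity),
      ofReal_mul_ofReal_pow (by positivity) (by positivity),
      ← ENNReal.ofReal_add (by positivity) (by positivity), ← ENNReal.ofReal_mul (by positivity)]
  have h1 : adjMeasure d S1 ≤ ENNReal.ofReal (d * 2 ^ d * (2 * η) ^ d) := by
    refine (adjMeasure_univ_prod_le _).trans ((mul_le_mul_right (volume_ball_le w η) _).trans
      (le_of_eq ?_))
    rw [ofReal_mul_ofReal_pow (by positivity) (by positivity)]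
  have h2 : adjMeasure d S2 ≤ ENNReal.ofReal (d * 2 ^ d * (2 * α * (2 * R) ^ (d - 1))) := by
    refine (adjMeasure_univ_prod_le _).trans ((mul_le_mul_right
      (volume_slab_le norm_e₁ 0 measurableSet_Icc R) _).trans (le_of_eq ?_))
    rw [Real.volume_Icc, ofReal_mul_ofReal_pow (by linarith) (by positivity),
      ← ENNReal.ofReal_mul (by positivity)]
    congr 3; ring
  have h3 : adjMeasure d S3 ≤ _ := (adjMeasure_component_grazing_le w (H := 2 * R) hs hα _).trans hg.le
  have h4 : adjMeasure d S4 ≤ _ :=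
    (adjMeasure_orthogonal_grazing_le hd w (H := 2 * R) hs hα _).trans hg.le
  have h5 : adjMeasure d S5 ≤ ENNReal.ofReal (d * 2 ^ d * (4 * R * (2 * τ) ^ (d - 1))) := by
    refine (adjMeasure_univ_prod_le _).trans ((mul_le_mul_right
      (volume_cylinder_le norm_e₁ w w (2 * R) τ) _).trans (le_of_eq ?_))
    rw [hH, ofReal_mul_ofReal_pow (by positivity) (by positivity), ← ENNReal.ofReal_mul (by positivity)]
  have h6 : adjMeasure d S6 ≤ ENNReal.ofReal (d * 2 ^ d * (4 * R * (2 * τ) ^ (d - 1))) := by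
    refine (adjMeasure_le_const hS6 fun ω =>
      volume_cylinder_le (hf ω) w w (2 * R) τ).trans (le_of_eq ?_)
    rw [hH, ofReal_mul_ofReal_pow (by positivity) (by positivity), ← ENNReal.ofReal_mul (by positivity)]
  refine (measure_mono hsub).trans ?_
  rw [ENNReal.ofReal_add (by positivity) (by positivity),
    ENNReal.ofReal_add (by positivity) (by positivity),
    ENNReal.ofReal_add (by positivity) (by positivity),
    ENNReal.ofReal_add (by positivity) (by positivity),
    ENNReal.ofReal_add (by positivity) (by positivity)]
  refine (measure_union_le _ _).trans (add_le_add ?_ h6)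
  refine (measure_union_le _ _).trans (add_le_add ?_ h5)
  refine (measure_union_le _ _).trans (add_le_add ?_ h4)
  refine (measure_union_le _ _).trans (add_le_add ?_ h3)
  exact (measure_union_le _ _).trans (add_le_add h1 h2)

lemma mul_max_pow_le {c u v : ℝ} (hc : 0 ≤ c) (hu : 0 ≤ u) (hv : 0 ≤ v) (n : ℕ) :
    (c * max u v) ^ n ≤ c ^ n * (u ^ n + v ^ n) := by
  rw [mul_pow]
  refine mul_le_mul_of_nonneg_left ?_ (by positivity)
  rcases max_cases u v with ⟨h, -⟩ | ⟨h, -⟩ <;> rw [h]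
  · linarith [pow_nonneg hv n]
  · linarith [pow_nonneg hu n]

/-- Homogeneous form, with all velocities measured in units of `R`. The ratio `a / F` carries only
`μ^(-κ)`; the large power of `1 / μ` affects only `F / (δ * R)`, because it comes only from the late
encounters of the scattered host. -/
lemma exists_adjMeasure_not_goodFor_le (hd : 2 ≤ d) {κ : ℝ} (hκ : 0 < κ) (hκ1 : κ < 1) :
    ∃ C > (0 : ℝ), ∀ (x w : Vec d) (Q : Vec d × Vec d) (R a F δ μ : ℝ), 0 < a → 12 * a ≤ F → 0 < δ →
      F ≤ δ * R → ‖w‖ ≤ R → ‖Q.2‖ ≤ R → 0 < μ → μ ≤ 1 → KeepsFrom 0 F (x, w) Q →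
      adjMeasure d ({p | ‖p.2‖ ≤ R ∧ ¬ GoodFor δ F (3 * a) x w Q p} \ grazingSet w R (μ * R)) ≤
        ENNReal.ofReal (C * (R ^ d * ((a / F) ^ (d - 1) * μ ^ (-κ) +
          (F / (δ * R)) ^ (d - 1) * μ ^ (-((d : ℝ) - 2 + κ))))) := by
  refine ⟨(d * 2 ^ d) * 4 * 2 ^ (d - 1) * 24 ^ (d - 1) + 4 ^ (d - 1) * 4 * 48 ^ (d - 1) +
    4 ^ (d - 1) * (2 * 2 ^ κ / κ) * 2 ^ (d - 1) +
    2 * (d * 2 ^ d) * (2 * 4 ^ κ / κ) * 4 ^ (d - 1) * 24 ^ (d - 1), ?_, ?_⟩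
  · have : 0 < d := by omega
    positivity
  intro x w Q R a F δ μ ha haF hδ hFR hw hQ hμ hμ1 hk
  have hF : 0 < F := by linarith
  have hR : 0 < R := by
    by_contra h
    have : δ * R ≤ 0 := mul_nonpos_of_nonneg_of_nonpos hδ.le (not_lt.1 h)
    linarith
  refine (adjMeasure_not_goodFor_le hd (m := μ * R) (by positivity : 0 < 3 * a) (by linarith) hδ hFR
    hw hQ (by positivity) hκ hκ1 hk).trans (ENNReal.ofReal_le_ofReal ?_)
  set T := (a / F) ^ (d - 1) with hT
  set S := (F / (δ * R)) ^ (d - 1) with hS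
  have hT0 : 0 ≤ T := by positivity
  have hS0 : 0 ≤ S := by positivity
  set k := μ ^ (-κ) with hk'
  set k' := μ ^ (-((d : ℝ) - 2 + κ)) with hk''
  have hd' : (2 : ℝ) ≤ d := by exact_mod_cast hd
  have hk1 : 1 ≤ k := Real.one_le_rpow_of_pos_of_le_one_of_nonpos hμ hμ1 (by linarith)
  have hkk : k ≤ k' := Real.rpow_le_rpow_of_exponent_ge hμ hμ1 (by linarith)
  have hk1' : 1 ≤ k' := hk1.trans hkk
  set X := R ^ d * (T * k + S * k') with hX
  have hRR : R * R ^ (d - 1) = R ^ d := by rw [← pow_succ']; congr 1; omega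
  have e1 : (8 * (3 * a) * R / F) ^ (d - 1) = 24 ^ (d - 1) * (R ^ (d - 1) * T) := by
    rw [hT, ← mul_pow, ← mul_pow]; congr 1; ring
  have e2 : (F / δ) ^ (d - 1) = R ^ (d - 1) * S := by
    rw [hS, ← mul_pow]; congr 1; field_simp
  have h24 : (1 : ℝ) ≤ 24 ^ (d - 1) := one_le_pow₀ (by norm_num)
  have hmax : ∀ c : ℝ, 0 ≤ c → (c * max (8 * (3 * a) * R / F) (F / δ)) ^ (d - 1) ≤
      c ^ (d - 1) * (24 ^ (d - 1) * (R ^ (d - 1) * (T + S))) := by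
    intro c hc
    refine (mul_max_pow_le hc (by positivity) (by positivity) _).trans ?_
    rw [e1, e2]
    gcongr
    have : R ^ (d - 1) * S ≤ 24 ^ (d - 1) * (R ^ (d - 1) * S) :=
      le_mul_of_one_le_left (by positivity) h24
    linarith
  have hXs : R ^ d * (T + S) ≤ X := by
    rw [hX]
    gcongr
    · exact le_mul_of_one_le_right hT0 hk1
    · exact le_mul_of_one_le_right hS0 hk1'
  have hXk : k * (R ^ d * (T + S)) ≤ X := by
    rw [hX]
    calc k * (R ^ d * (T + S)) = R ^ d * (T * k + S * k) := by ring
      _ ≤ _ := by gcongr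
  have t1 : d * 2 ^ d * (4 * R * (2 * max (8 * (3 * a) * R / F) (F / δ)) ^ (d - 1)) ≤
      ((d * 2 ^ d) * 4 * 2 ^ (d - 1) * 24 ^ (d - 1)) * X := by
    calc d * 2 ^ d * (4 * R * (2 * max (8 * (3 * a) * R / F) (F / δ)) ^ (d - 1))
        ≤ d * 2 ^ d * (4 * R * (2 ^ (d - 1) * (24 ^ (d - 1) * (R ^ (d - 1) * (T + S))))) := by
          gcongr; exact hmax 2 (by norm_num)
      _ = ((d * 2 ^ d) * 4 * 2 ^ (d - 1) * 24 ^ (d - 1)) * ((R * R ^ (d - 1)) * (T + S)) := by ring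
      _ ≤ _ := by rw [hRR]; gcongr
  have t2 : (4 * R) ^ (d - 1) * (4 * R * (16 * (3 * a) / F) ^ (d - 1)) ≤
      (4 ^ (d - 1) * 4 * 48 ^ (d - 1)) * X := by
    have e3 : (16 * (3 * a) / F) ^ (d - 1) = 48 ^ (d - 1) * T := by
      rw [hT, ← mul_pow]; congr 1; ring
    calc (4 * R) ^ (d - 1) * (4 * R * (16 * (3 * a) / F) ^ (d - 1))
        = (4 ^ (d - 1) * 4 * 48 ^ (d - 1)) * ((R * R ^ (d - 1)) * T) := by
          rw [e3, mul_pow]; ring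
      _ ≤ (4 ^ (d - 1) * 4 * 48 ^ (d - 1)) * (R ^ d * (T + S)) := by rw [hRR]; gcongr; linarith
      _ ≤ _ := by gcongr
  have hRp : ∀ p : ℝ, R ^ (-p) * R ^ p = 1 := fun p => by
    rw [← Real.rpow_add hR, neg_add_cancel, Real.rpow_zero]
  have t3 : (4 * R) ^ (d - 1) * ((μ * R) ^ (-((d : ℝ) - 2 + κ)) *
      (2 * (2 * R) ^ κ / κ * (2 * (F / δ)) ^ (d - 1))) ≤
      (4 ^ (d - 1) * (2 * 2 ^ κ / κ) * 2 ^ (d - 1)) * X := by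
    have e4 : R ^ (d - 1) * (R ^ (-((d : ℝ) - 2 + κ)) * R ^ κ) * R ^ (d - 1) = R ^ d := by
      rw [← Real.rpow_natCast, ← Real.rpow_natCast, ← Real.rpow_add hR, ← Real.rpow_add hR,
        ← Real.rpow_add hR]
      congr 1
      push_cast [Nat.cast_sub (show 1 ≤ d by omega)]; ring
    calc (4 * R) ^ (d - 1) * ((μ * R) ^ (-((d : ℝ) - 2 + κ)) *
          (2 * (2 * R) ^ κ / κ * (2 * (F / δ)) ^ (d - 1)))
        = (4 ^ (d - 1) * (2 * 2 ^ κ / κ) * 2 ^ (d - 1)) *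
          ((R ^ (d - 1) * (R ^ (-((d : ℝ) - 2 + κ)) * R ^ κ) * R ^ (d - 1)) * (S * k')) := by
          rw [mul_pow 2 (F / δ), e2, mul_pow, Real.mul_rpow hμ.le hR.le,
            Real.mul_rpow (by norm_num) hR.le, hk'']
          ring
      _ ≤ _ := by
        rw [e4, hX]
        gcongr
        linarith [mul_nonneg hT0 (zero_le_one.trans hk1)]
  have t4 : 2 * R * (d * 2 ^ d) * ((μ * R) ^ (-κ) * (2 * (2 * (2 * R)) ^ κ / κ *
      (4 * max (8 * (3 * a) * R / F) (F / δ)) ^ (d - 1))) ≤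
      (2 * (d * 2 ^ d) * (2 * 4 ^ κ / κ) * 4 ^ (d - 1) * 24 ^ (d - 1)) * X := by
    calc 2 * R * (d * 2 ^ d) * ((μ * R) ^ (-κ) * (2 * (2 * (2 * R)) ^ κ / κ *
          (4 * max (8 * (3 * a) * R / F) (F / δ)) ^ (d - 1)))
        ≤ 2 * R * (d * 2 ^ d) * ((μ * R) ^ (-κ) * (2 * (2 * (2 * R)) ^ κ / κ *
          (4 ^ (d - 1) * (24 ^ (d - 1) * (R ^ (d - 1) * (T + S)))))) := by
          gcongr; exact hmax 4 (by norm_num)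
      _ = (2 * (d * 2 ^ d) * (2 * 4 ^ κ / κ) * 4 ^ (d - 1) * 24 ^ (d - 1)) *
          ((R ^ (-κ) * R ^ κ) * (k * ((R * R ^ (d - 1)) * (T + S)))) := by
          rw [show 2 * (2 * R) = 4 * R by ring, Real.mul_rpow hμ.le hR.le,
            Real.mul_rpow (by norm_num) hR.le, hk']
          ring
      _ ≤ _ := by rw [hRp, hRR, one_mul]; gcongr
  calc _ ≤ _ := add_le_add (add_le_add (add_le_add t1 t2) t3) t4
    _ = _ := by ring

lemma exists_adjMeasure_grazingSet_le (hd : 2 ≤ d) :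
    ∃ C > (0 : ℝ), ∀ (w : Vec d) (R μ : ℝ), ‖w‖ ≤ R → 0 < μ → μ ≤ 1 →
      adjMeasure d (grazingSet w R (μ * R)) ≤ ENNReal.ofReal (C * (R ^ d * μ)) := by
  have hd0 : 0 < d := by omega
  refine ⟨d * 2 ^ d * 4 ^ (d - 1) + d * 2 ^ d * (4 * 2 ^ (d - 1)), by positivity, ?_⟩
  intro w R μ hw hμ hμ1
  have hR : 0 ≤ R := (norm_nonneg w).trans hw
  refine (adjMeasure_grazingSet_le hw (by positivity)).trans (ENNReal.ofReal_le_ofReal ?_)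
  have hRR : R * R ^ (d - 1) = R ^ d := by rw [← pow_succ']; congr 1; omega
  have h1 : μ ^ (d - 1) ≤ μ := pow_le_of_le_one hμ.le hμ1 (by omega)
  calc d * 2 ^ d * (μ * R * (4 * R) ^ (d - 1)) + d * 2 ^ d * (4 * R * (2 * (μ * R)) ^ (d - 1))
      = d * 2 ^ d * 4 ^ (d - 1) * ((R * R ^ (d - 1)) * μ) +
        d * 2 ^ d * (4 * 2 ^ (d - 1)) * ((R * R ^ (d - 1)) * μ ^ (d - 1)) := by
        simp only [mul_pow]; ring
    _ ≤ d * 2 ^ d * 4 ^ (d - 1) * (R ^ d * μ) + d * 2 ^ d * (4 * 2 ^ (d - 1)) * (R ^ d * μ) := by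
        rw [hRR]; gcongr
    _ = _ := by ring

/-- The choice `s = √α` balances the measure of the excluded directions, of order `s`, with the slab
thickness `2 * α / s` for the others. -/
lemma exists_adjMeasure_not_goodPair_le (hd : 2 ≤ d) :
    ∃ C > (0 : ℝ), ∀ (x w : Vec d) (R a F δ ρ α η : ℝ), 0 < a → 0 < F → 0 < δ → 12 * a ≤ ρ →
      ρ ≤ 2 * x 0 → ‖w‖ ≤ R → 0 < α → α ≤ |w 0| → 0 ≤ η →
      adjMeasure d {p | ‖p.2‖ ≤ R ∧ ¬ GoodPair α η δ F (3 * a) x w p} ≤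
        ENNReal.ofReal (C * (η ^ d + R ^ (d - 1) * α + R ^ d * √α + R ^ (d - 1) * √α +
          R ^ d * (a / ρ) ^ (d - 1) + R ^ d * (F / (δ * R)) ^ (d - 1))) := by
  have hd0 : 0 < d := by omega
  set c : ℝ := d * 2 ^ d with hc
  have hc0 : 0 < c := by positivity
  refine ⟨c * 2 ^ d + c * (2 * 2 ^ (d - 1)) + 2 * c * 4 ^ d + 4 * c * 4 ^ (d - 1) +
    2 * (c * 4 * 2 ^ (d - 1) * 24 ^ (d - 1)), by positivity, ?_⟩
  intro x w R a F δ ρ α η ha hF hδ haρ hx hw hα hwα hη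
  have hR : 0 < R := by
    have h1 := abs_coord_zero_le w
    linarith
  have hρ : 0 < ρ := by linarith
  refine (adjMeasure_not_goodPair_le hd (s := √α) (by positivity : 0 < 3 * a) hF hδ (by linarith) hx
    hw hα.le hwα (Real.sqrt_pos.2 hα) hη).trans (ENNReal.ofReal_le_ofReal ?_)
  have hRR : R * R ^ (d - 1) = R ^ d := by rw [← pow_succ']; congr 1; omega
  set T := (a / ρ) ^ (d - 1) with hT
  set S := (F / (δ * R)) ^ (d - 1) with hS
  set q := √α with hq
  have hq0 : 0 < q := Real.sqrt_pos.2 hα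
  have hT0 : 0 ≤ R ^ d * T := by positivity
  have hS0 : 0 ≤ R ^ d * S := by positivity
  have hαq : 2 * α / q = 2 * q := by
    rw [mul_div_assoc, hq, Real.div_sqrt]
  have e1 : (8 * (3 * a) * R / ρ) ^ (d - 1) = 24 ^ (d - 1) * (R ^ (d - 1) * T) := by
    rw [hT, ← mul_pow, ← mul_pow]; congr 1; ring
  have e2 : (F / δ) ^ (d - 1) = R ^ (d - 1) * S := by
    rw [hS, ← mul_pow]; congr 1; field_simp
  have h24 : (1 : ℝ) ≤ 24 ^ (d - 1) := one_le_pow₀ (by norm_num)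
  have t5 : c * (4 * R * (2 * max (8 * (3 * a) * R / ρ) (F / δ)) ^ (d - 1)) ≤
      (c * 4 * 2 ^ (d - 1) * 24 ^ (d - 1)) * (R ^ d * T + R ^ d * S) := by
    calc c * (4 * R * (2 * max (8 * (3 * a) * R / ρ) (F / δ)) ^ (d - 1))
        ≤ c * (4 * R * (2 ^ (d - 1) * (24 ^ (d - 1) * (R ^ (d - 1) * T) + R ^ (d - 1) * S))) := by
          gcongr
          rw [← e1, ← e2]
          exact mul_max_pow_le (by norm_num) (by positivity) (by positivity) _
      _ = c * 4 * 2 ^ (d - 1) * (24 ^ (d - 1) * ((R * R ^ (d - 1)) * T) +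
          1 * ((R * R ^ (d - 1)) * S)) := by ring
      _ ≤ c * 4 * 2 ^ (d - 1) * (24 ^ (d - 1) * ((R * R ^ (d - 1)) * T) +
          24 ^ (d - 1) * ((R * R ^ (d - 1)) * S)) := by gcongr
      _ = _ := by rw [hRR]; ring
  set A := η ^ d
  set B := R ^ (d - 1) * α
  set D := R ^ d * q
  set E := R ^ (d - 1) * q
  have hA0 : 0 ≤ A := by positivity
  have hB0 : 0 ≤ B := by positivity
  have hD0 : 0 ≤ D := by positivity
  have hE0 : 0 ≤ E := by positivity
  have hsum : ∀ K : ℝ, ∀ Y : ℝ, 0 ≤ K → Y ≤ A + B + D + E + R ^ d * T + R ^ d * S →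
      K * Y ≤ K * (A + B + D + E + R ^ d * T + R ^ d * S) := fun K Y hK hY => by gcongr
  have h1 := hsum (c * 2 ^ d) A (by positivity) (by linarith)
  have h2 := hsum (c * (2 * 2 ^ (d - 1))) B (by positivity) (by linarith)
  have h3 := hsum (2 * c * 4 ^ d) D (by positivity) (by linarith)
  have h4 := hsum (4 * c * 4 ^ (d - 1)) E (by positivity) (by linarith)
  have h5 := hsum (2 * (c * 4 * 2 ^ (d - 1) * 24 ^ (d - 1))) (R ^ d * T + R ^ d * S) (by positivity)
    (by linarith)
  have g1 : c * (2 * η) ^ d = c * 2 ^ d * A := by rw [mul_pow]; ring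
  have g2 : c * (2 * α * (2 * R) ^ (d - 1)) = c * (2 * 2 ^ (d - 1)) * B := by
    rw [mul_pow]; simp only [B]; ring
  have g3 : c * (q * (4 * R) ^ d + 2 * α / q * (4 * R) ^ (d - 1)) =
      c * 4 ^ d * D + 2 * c * 4 ^ (d - 1) * E := by
    rw [hαq, mul_pow, mul_pow]; simp only [D, E]; ring
  rw [g1, g2, g3]
  linarith

/-- Measure of the parameters of the adjunctions that do not lead to a safe configuration. -/
lemma exists_adjMeasure_not_isSafe_le (hd : 2 ≤ d) {κ : ℝ} (hκ : 0 < κ) (hκ1 : κ < 1) :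
    ∃ C > (0 : ℝ), ∀ (n : ℕ) (Z : Config d n) (j : Fin n) (R a F δ ρ α η μ : ℝ),
      IsReady α F R (ρ / 2) j Z → 0 < a → 12 * a ≤ F → 0 < δ → F ≤ δ * R → F ≤ η * δ → 12 * a ≤ ρ →
      0 < α → 0 ≤ η → 0 < μ → μ ≤ 1 →
      adjMeasure d {p | ‖p.2‖ ≤ R ∧ ¬ IsSafe α δ F (3 * a) j (adjoin 0 Z j p)} ≤
        ENNReal.ofReal (C * ((η ^ d + R ^ (d - 1) * α + R ^ d * √α + R ^ (d - 1) * √α +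
          R ^ d * (a / ρ) ^ (d - 1) + R ^ d * (F / (δ * R)) ^ (d - 1)) + R ^ d * μ +
          n * (R ^ d * ((a / F) ^ (d - 1) * μ ^ (-κ) +
            (F / (δ * R)) ^ (d - 1) * μ ^ (-((d : ℝ) - 2 + κ)))))) := by
  obtain ⟨C₁, hC₁, h₁⟩ := exists_adjMeasure_not_goodPair_le hd
  obtain ⟨C₂, hC₂, h₂⟩ := exists_adjMeasure_grazingSet_le hd
  obtain ⟨C₃, hC₃, h₃⟩ := exists_adjMeasure_not_goodFor_le hd hκ hκ1
  refine ⟨C₁ + C₂ + 2 * C₃, by positivity, ?_⟩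
  intro n Z j R a F δ ρ α η μ hZ ha haF hδ hFR hFη haρ hα hη hμ hμ1
  have hR : 0 ≤ R := (norm_nonneg _).trans (hZ.vel_le j)
  have hF : 0 < F := by linarith
  have hρ : 0 < ρ := by linarith
  let G : Fin n → Set (AdjParam d) := fun i => if i = j then ∅ else
    ({p | ‖p.2‖ ≤ R ∧ ¬ GoodFor δ F (3 * a) (Z.1 j) (Z.2 j) (particle Z i) p} \
      grazingSet (Z.2 j) R (μ * R)) ∪
    ({p | ‖p.2‖ ≤ R ∧ ¬ GoodFor δ F (3 * a) (Z.1 j) (Z.2 j) (mirror (particle Z i)) p} \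
      grazingSet (Z.2 j) R (μ * R))
  set X := R ^ d * ((a / F) ^ (d - 1) * μ ^ (-κ) +
            (F / (δ * R)) ^ (d - 1) * μ ^ (-((d : ℝ) - 2 + κ))) with hX
  set Y := η ^ d + R ^ (d - 1) * α + R ^ d * √α + R ^ (d - 1) * √α +
          R ^ d * (a / ρ) ^ (d - 1) + R ^ d * (F / (δ * R)) ^ (d - 1) with hY
  have hX0 : 0 ≤ X := by positivity
  have hY0 : 0 ≤ Y := by positivity
  have hsub : {p | ‖p.2‖ ≤ R ∧ ¬ IsSafe α δ F (3 * a) j (adjoin 0 Z j p)} ⊆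
      ({p | ‖p.2‖ ≤ R ∧ ¬ GoodPair α η δ F (3 * a) (Z.1 j) (Z.2 j) p} ∪
        grazingSet (Z.2 j) R (μ * R)) ∪ ⋃ i, G i := by
    rintro p ⟨hp, hbad⟩
    by_contra hno
    simp only [mem_union, not_or, mem_iUnion, not_exists] at hno
    obtain ⟨⟨n1, n2⟩, n3⟩ := hno
    refine hbad (isSafe_adjoin hZ hδ.le hη (by linarith) hFη (not_not.1 fun h => n1 ⟨hp, h⟩) ?_)
    intro i hij
    have h4 := n3 i
    simp only [G, if_neg hij, mem_union, not_or] at h4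
    exact ⟨not_not.1 fun h => h4.1 ⟨⟨hp, h⟩, n2⟩, not_not.1 fun h => h4.2 ⟨⟨hp, h⟩, n2⟩⟩
  have hG : ∀ i, adjMeasure d (G i) ≤ ENNReal.ofReal (2 * C₃ * X) := by
    intro i
    by_cases hij : i = j
    · simp only [G, if_pos hij, measure_empty, zero_le]
    · simp only [G, if_neg hij]
      have hap := apartFrom_iff.1 (hZ.apart j i (Ne.symm hij))
      refine (measure_union_le _ _).trans ?_
      rw [show 2 * C₃ * X = C₃ * X + C₃ * X by ring, ENNReal.ofReal_add (by positivity) (by positivity)]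
      refine add_le_add ?_ ?_
      · exact h₃ _ _ _ _ _ _ _ _ ha haF hδ hFR (hZ.vel_le j) (hZ.vel_le i) hμ hμ1 hap.1
      · exact h₃ _ _ _ _ _ _ _ _ ha haF hδ hFR (hZ.vel_le j)
          (by simpa [mirror, particle] using hZ.vel_le i) hμ hμ1 hap.2
  have hsum : adjMeasure d (⋃ i, G i) ≤ ENNReal.ofReal (n * (2 * C₃ * X)) := by
    refine (measure_iUnion_fintype_le _ _).trans ((Finset.sum_le_sum fun i _ => hG i).trans ?_)
    rw [Finset.sum_const, Finset.card_univ, Fintype.card_fin, nsmul_eq_mul,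
      ENNReal.ofReal_mul (Nat.cast_nonneg n), ENNReal.ofReal_natCast]
  refine (measure_mono hsub).trans ((measure_union_le _ _).trans
    ((add_le_add (measure_union_le _ _) hsum).trans ?_))
  refine (add_le_add (add_le_add (h₁ (Z.1 j) (Z.2 j) R a F δ ρ α η ha hF hδ haρ
    (by linarith [hZ.far]) (hZ.vel_le j) hα (hZ.vel_zero j) hη)
    (h₂ (Z.2 j) R μ (hZ.vel_le j) hμ hμ1)) le_rfl).trans ?_
  rw [← hY, ← ENNReal.ofReal_add (by positivity) (by positivity),
    ← ENNReal.ofReal_add (by positivity) (by positivity)]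
  refine ENNReal.ofReal_le_ofReal ?_
  have hm : 0 ≤ R ^ d * μ := by positivity
  have hnX : 0 ≤ n * X := by positivity
  have p1 := mul_nonneg hC₁.le hm
  have p2 := mul_nonneg hC₁.le hnX
  have p3 := mul_nonneg hC₂.le hY0
  have p4 := mul_nonneg hC₂.le hnX
  have p5 := mul_nonneg hC₃.le hY0
  have p6 := mul_nonneg hC₃.le hm
  linarith

/-! ### Choice of the intermediate separation `F`. -/

lemma rpow_antitone_exponent {x p q : ℝ} (hx : 0 < x) (hx1 : x ≤ 1) (h : p ≤ q) : x ^ q ≤ x ^ p :=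
  Real.rpow_le_rpow_of_exponent_ge hx hx1 h

/-- The choice of the separation is compatible with late recollisions. -/
lemma late_bound {d : ℕ} (hd : 2 ≤ d) {B₀ b₁ q G N κ : ℝ} (hκ : κ = 1 / (2 * d))
    (hB₀ : 0 < B₀) (hb₁ : 0 < b₁) (hN : 1 ≤ N) (hb : B₀ + N * b₁ ≤ 1) (hq : 0 < q)
    (hqB : q ≤ B₀ ^ 8) (hNq : N * q ^ 2 ≤ 1) (hG : G ≤ b₁ ^ (2 + 1 / ((d : ℝ) - 3 / 2)))
    (hG' : G ≤ B₀ * q ^ (d - 1)) :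
    N * G ≤ (b₁ + B₀ * q ^ 2) * (B₀ + b₁) ^ κ * (B₀ + N * b₁) ^ ((d : ℝ) - 1 + κ) := by
  have hd' : (2 : ℝ) ≤ d := by exact_mod_cast hd
  have hκ0 : 0 < κ := by rw [hκ]; positivity
  have hNb : 0 < N * b₁ := by positivity
  have hB₀1 : B₀ ≤ 1 := by linarith
  have hBB : B₀ ≤ B₀ + b₁ := by linarith
  have hBb : B₀ ≤ B₀ + N * b₁ := by linarith
  set b := B₀ + N * b₁ with hbdef
  set B := B₀ + b₁ with hBdef
  set g := b₁ + B₀ * q ^ 2 with hgdef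
  have hb0 : 0 < b := hB₀.trans_le hBb
  have hg1 : b₁ ≤ g := by rw [hgdef]; nlinarith [sq_nonneg q]
  have hg2 : B₀ * q ^ 2 ≤ g := by rw [hgdef]; linarith
  have hg0 : 0 < g := hb₁.trans_le hg1
  have hBκ : B₀ ^ κ ≤ B ^ κ := Real.rpow_le_rpow hB₀.le hBB hκ0.le
  -- For `d ≥ 6` the second bound on `G` suffices: one factor `q^2` absorbs `N`, another one with
  -- `B₀` is part of `g`, and the remaining `q^(d-5) ≤ B₀^(8(d-5))` has an exponent large enough.
  by_cases h6 : 6 ≤ d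
  · have h6' : (6 : ℝ) ≤ d := by exact_mod_cast h6
    have e1 : q ^ (d - 1) = q ^ 2 * (q ^ 2 * q ^ (d - 5)) := by
      rw [← pow_add, ← pow_add]; congr 1; omega
    have e2 : q ^ (d - 5) ≤ B₀ ^ ((d : ℝ) - 1 + κ) * B₀ ^ κ := by
      calc q ^ (d - 5) ≤ (B₀ ^ 8) ^ (d - 5) := by gcongr
        _ = B₀ ^ ((8 * (d - 5) : ℕ) : ℝ) := by rw [Real.rpow_natCast, pow_mul]
        _ ≤ B₀ ^ (((d : ℝ) - 1 + κ) + κ) := by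
          refine rpow_antitone_exponent hB₀ hB₀1 ?_
          have hκ1 : κ ≤ 1 := by rw [hκ, div_le_one (by positivity)]; linarith
          push_cast [Nat.cast_sub (show 5 ≤ d by omega)]
          linarith
        _ = _ := Real.rpow_add hB₀ _ _
    have e3 : B₀ ^ ((d : ℝ) - 1 + κ) ≤ b ^ ((d : ℝ) - 1 + κ) :=
      Real.rpow_le_rpow hB₀.le hBb (by linarith)
    calc N * G ≤ N * (B₀ * q ^ (d - 1)) := by gcongr
      _ = (N * q ^ 2) * ((B₀ * q ^ 2) * q ^ (d - 5)) := by rw [e1]; ring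
      _ ≤ 1 * (g * (b ^ ((d : ℝ) - 1 + κ) * B ^ κ)) := by
        gcongr
        exact e2.trans (by gcongr)
      _ = _ := by ring
  · have hd5 : (d : ℝ) ≤ 5 := by exact_mod_cast (show d ≤ 5 by omega)
    set Q : ℝ := (d : ℝ) - 2 + 2 * κ with hQ
    have hQ0 : 0 < Q := by linarith
    have hd0 : (0 : ℝ) < (d : ℝ) - 3 / 2 := by linarith
    have hsplit : b ^ ((d : ℝ) - 1 + κ) = b * b ^ ((d : ℝ) - 2 + κ) := by
      rw [← Real.rpow_one_add' hb0.le (by linarith)]; congr 1; ring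
    have e3 : B₀ ^ ((d : ℝ) - 2 + κ) ≤ b ^ ((d : ℝ) - 2 + κ) :=
      Real.rpow_le_rpow hB₀.le hBb (by linarith)
    have e4 : B₀ ^ Q = B₀ ^ κ * B₀ ^ ((d : ℝ) - 2 + κ) := by
      rw [← Real.rpow_add hB₀]; congr 1; rw [hQ]; ring
    have e5 : B₀ ^ Q ≤ B ^ κ * b ^ ((d : ℝ) - 2 + κ) := by rw [e4]; gcongr
    have hNb' : N * b₁ ≤ b := by linarith
    -- Either `b₁` is small compared with a power of `B₀`, and the first bound on `G` suffices, or
    -- `b₁` dominates such a power and the second bound, with `q ≤ B₀^8`, is much smaller than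
    -- `b₁^2`.
    by_cases hA : b₁ ^ (1 / ((d : ℝ) - 3 / 2)) ≤ B₀ ^ Q
    · calc N * G ≤ N * b₁ ^ (2 + 1 / ((d : ℝ) - 3 / 2)) := by gcongr
        _ = b₁ * (N * b₁) * b₁ ^ (1 / ((d : ℝ) - 3 / 2)) := by
          rw [Real.rpow_add hb₁, Real.rpow_two]; ring
        _ ≤ g * b * (B ^ κ * b ^ ((d : ℝ) - 2 + κ)) := by
          gcongr
          exact hA.trans e5
        _ = _ := by rw [hsplit]; ring
    · have hP : B₀ ^ (Q * ((d : ℝ) - 3 / 2)) ≤ b₁ := by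
        have h1 := Real.rpow_le_rpow (by positivity) (not_le.1 hA).le hd0.le
        rwa [← Real.rpow_mul hB₀.le, ← Real.rpow_mul hb₁.le, one_div,
          inv_mul_cancel₀ hd0.ne', Real.rpow_one] at h1
      have e6 : B₀ * q ^ (d - 1) ≤ b₁ * b₁ * (B ^ κ * b ^ ((d : ℝ) - 2 + κ)) := by
        calc B₀ * q ^ (d - 1) ≤ B₀ * (B₀ ^ 8) ^ (d - 1) := by gcongr
          _ = B₀ ^ ((1 + 8 * (d - 1) : ℕ) : ℝ) := by
            rw [Real.rpow_natCast, pow_add, pow_mul, pow_one]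
          -- Since `Q * d = (d - 1)^2`, the comparison of exponents reads `2 (d - 1)^3 / d ≤ 1 + 8
          -- (d - 1)`. It holds for `2 ≤ d ≤ 5` and fails at `d = 6`, hence the separate treatment
          -- of large dimensions.
          _ ≤ B₀ ^ (Q * ((d : ℝ) - 3 / 2) + Q * ((d : ℝ) - 3 / 2) + Q) := by
            refine rpow_antitone_exponent hB₀ hB₀1 ?_
            push_cast [Nat.cast_sub (show 1 ≤ d by omega)]
            have h7 : Q * d = ((d : ℝ) - 1) ^ 2 := by
              rw [hQ, hκ]; field_simp; ring
            have h8 : (Q * ((d : ℝ) - 3 / 2) + Q * ((d : ℝ) - 3 / 2) + Q) * d =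
                2 * ((d : ℝ) - 1) ^ 3 := by
              linear_combination (2 * (d : ℝ) - 2) * h7
            refine le_of_mul_le_mul_right ?_ (by linarith : (0 : ℝ) < d)
            rw [h8]
            nlinarith [mul_nonneg (sub_nonneg.2 hd') (sub_nonneg.2 hd5),
              mul_nonneg (mul_nonneg (sub_nonneg.2 hd') (sub_nonneg.2 hd5)) (sub_nonneg.2 hd')]
          _ = B₀ ^ (Q * ((d : ℝ) - 3 / 2)) * B₀ ^ (Q * ((d : ℝ) - 3 / 2)) * B₀ ^ Q := by
            rw [Real.rpow_add hB₀, Real.rpow_add hB₀]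
          _ ≤ _ := by gcongr
      -- Multiplying by `b₁` makes `N` appear through `N * b₁ ≤ b`.
      refine le_of_mul_le_mul_left ?_ hb₁
      calc b₁ * (N * G) ≤ b₁ * (N * (B₀ * q ^ (d - 1))) := by gcongr
        _ = (N * b₁) * (B₀ * q ^ (d - 1)) := by ring
        _ ≤ b * (b₁ * b₁ * (B ^ κ * b ^ ((d : ℝ) - 2 + κ))) := by gcongr
        _ = b₁ * (b₁ * B ^ κ * (b * b ^ ((d : ℝ) - 2 + κ))) := by ring
        _ ≤ b₁ * (g * B ^ κ * (b * b ^ ((d : ℝ) - 2 + κ))) := by gcongr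
        _ = _ := by rw [hsplit]

set_option maxHeartbeats 800000 in
/-- The choice of the separation `F` that the particles keep. -/
lemma exists_separation {d : ℕ} (hd : 2 ≤ d) {B₀ b₁ κ R α a ε₀ δ δ' ρ : ℝ} (hκ : κ = 1 / (2 * d))
    (hR : 1 ≤ R) (hα : 0 < α) (ha : 0 < a) (hε₀ : a ≤ ε₀) (hδ : 0 < δ) (hρ : 0 < ρ)
    (hδ' : δ ≤ δ') (hρ' : ρ / α ≤ δ')
    (hB₀ : (a / ρ) ^ (d - 1) ≤ B₀) (hαB : α ≤ B₀ ^ 8)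
    (hb₁ : R ^ (d - 1) * (a / ε₀) ^ ((d : ℝ) - 3 / 2) ≤ b₁)
    (hb₁' : R ^ (1 / 2 : ℝ) * (ε₀ / δ) ^ ((d : ℝ) - 3 / 2) ≤ b₁) :
    ∃ F > 0, F ≤ ε₀ ∧ ∀ N : ℝ, 1 ≤ N → N * α ^ 2 ≤ R ^ 2 → B₀ + N * b₁ ≤ (1 / 12) ^ (d - 1) →
      12 * a ≤ F ∧ N * (a / F) ^ (d - 1) ≤ 2 * (B₀ + N * b₁) ^ (1 + κ) ∧
      N * (F / (δ' * R)) ^ (d - 1) ≤ (B₀ + N * b₁) ^ ((d : ℝ) - 1 + κ) := by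
  have hd' : (2 : ℝ) ≤ d := by exact_mod_cast hd
  have hd1 : d - 1 ≠ 0 := by omega
  have hκ0 : 0 < κ := by rw [hκ]; positivity
  have hε₀0 : 0 < ε₀ := ha.trans_le hε₀
  have hR0 : 0 < R := by linarith
  have hδ'0 : 0 < δ' := hδ.trans_le hδ'
  have hB0 : 0 < B₀ := lt_of_lt_of_le (by positivity) hB₀
  have hb0 : 0 < b₁ := lt_of_lt_of_le (by positivity) hb₁
  set x := a / ε₀ with hx
  have hx0 : 0 < x := by positivity
  have hx1 : x ≤ 1 := (div_le_one hε₀0).2 hε₀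
  set q := α / R with hq
  have hq0 : 0 < q := by positivity
  -- `N * q^2 ≤ 1` ensures `N * g ≤ 2 * b`, although `g` does not depend on `N`. The term `B₀ * q^2`
  -- is the one that makes `late_bound` work in large dimension.
  set g := b₁ + B₀ * q ^ 2 with hg
  set B := B₀ + b₁ with hB
  have hg0 : 0 < g := by positivity
  have hBpos : 0 < B := by positivity
  set θ := g * B ^ κ with hθ
  have hθ0 : 0 < θ := by positivity
  -- `F = a / f` is chosen so that `(a / F)^(d-1) = θ = g * B^κ`. After multiplication by `N` this
  -- is at most `2 * b^(1+κ)`.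
  set f := θ ^ ((1 : ℝ) / (d - 1 : ℕ)) with hf
  have hf0 : 0 < f := by positivity
  have hfθ : f ^ (d - 1) = θ := by
    rw [hf, ← Real.rpow_natCast, ← Real.rpow_mul hθ0.le, one_div, inv_mul_cancel₀, Real.rpow_one]
    exact_mod_cast hd1
  have haF : a / (a / f) = f := by field_simp
  have hle : ∀ {u v : ℝ}, 0 ≤ v → u ^ (d - 1) ≤ v ^ (d - 1) → u ≤ v := fun hv h =>
    le_of_pow_le_pow_left₀ hd1 hv h
  refine ⟨a / f, by positivity, ?_, ?_⟩
  · have h1 : x ≤ f := by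
      refine hle hf0.le ?_
      rw [hfθ]
      have h2 : x ^ ((d : ℝ) - 3 / 2) ≤ b₁ := by
        refine le_trans ?_ hb₁
        exact le_mul_of_one_le_left (by positivity) (one_le_pow₀ hR)
      calc x ^ (d - 1) = x ^ ((d - 1 : ℕ) : ℝ) := (Real.rpow_natCast _ _).symm
        _ ≤ x ^ (((d : ℝ) - 3 / 2) * (1 + κ)) := by
          refine rpow_antitone_exponent hx0 hx1 ?_
          push_cast [Nat.cast_sub (show 1 ≤ d by omega)]
          rw [hκ]
          -- The value `κ = 1 / (2 d)` is small enough for this exponent to stay below `d - 1`,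
          -- which is what `F ≤ ε₀` requires.
          have : ((d : ℝ) - 3 / 2) * (1 + 1 / (2 * d)) = d - 1 - 3 / (4 * d) := by
            field_simp; ring
          rw [this]
          have : (0 : ℝ) < 3 / (4 * d) := by positivity
          linarith
        _ = (x ^ ((d : ℝ) - 3 / 2)) ^ (1 + κ) := Real.rpow_mul hx0.le _ _
        _ ≤ b₁ ^ (1 + κ) := Real.rpow_le_rpow (by positivity) h2 (by linarith)
        _ = b₁ * b₁ ^ κ := Real.rpow_one_add' hb0.le (by linarith)
        _ ≤ g * B ^ κ := by
          have h3 : b₁ ≤ g := by rw [hg]; nlinarith [sq_nonneg q]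
          have h4 : b₁ ^ κ ≤ B ^ κ := Real.rpow_le_rpow hb0.le (by linarith) hκ0.le
          gcongr
    rw [div_le_iff₀ hf0]
    rw [hx, div_le_iff₀ hε₀0] at h1
    linarith
  · intro N hN hNα hbc
    set b := B₀ + N * b₁ with hb
    have hBb : B ≤ b := by rw [hb, hB]; nlinarith
    have hbpos : 0 < b := hBpos.trans_le hBb
    have hb1 : b ≤ 1 := hbc.trans (pow_le_one₀ (by norm_num) (by norm_num))
    have hNq : N * q ^ 2 ≤ 1 := by
      rw [hq, div_pow, ← mul_div_assoc, div_le_one (by positivity)]; exact hNα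
    have hq1 : q ^ 2 ≤ 1 := (le_mul_of_one_le_left (sq_nonneg q) hN).trans hNq
    have hBκ : B ^ κ ≤ b ^ κ := Real.rpow_le_rpow hBpos.le hBb hκ0.le
    refine ⟨?_, ?_, ?_⟩
    · have h1 : f ≤ 1 / 12 := by
        refine hle (by norm_num) ?_
        rw [hfθ]
        refine le_trans ?_ hbc
        calc g * B ^ κ ≤ b * 1 := by
              refine mul_le_mul ?_ (Real.rpow_le_one hBpos.le (by linarith) hκ0.le) (by positivity)
                hbpos.le
              rw [hg]; nlinarith
          _ = b := mul_one b
      rw [le_div_iff₀ hf0]; nlinarith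
    · rw [haF, hfθ, Real.rpow_one_add' hbpos.le (by linarith)]
      have h1 : N * g = N * b₁ + B₀ * (N * q ^ 2) := by rw [hg]; ring
      have h2 : B₀ * (N * q ^ 2) ≤ B₀ := mul_le_of_le_one_right hB0.le hNq
      have h3 : N * g ≤ 2 * b := by linarith
      calc N * θ = (N * g) * B ^ κ := (mul_assoc _ _ _).symm
        _ ≤ (2 * b) * b ^ κ := mul_le_mul h3 hBκ (by positivity) (by positivity)
        _ = _ := mul_assoc _ _ _
    · have hqB : q ≤ B₀ ^ 8 := (div_le_self hα.le hR).trans hαB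
      have hd0 : (0 : ℝ) < (d : ℝ) - 3 / 2 := by linarith
      have key := late_bound hd (G := (a / (δ' * R)) ^ (d - 1)) hκ hB0 hb0 hN hb1 hq0 hqB hNq ?_ ?_
      · have e1 : (a / f / (δ' * R)) ^ (d - 1) = (a / (δ' * R)) ^ (d - 1) / θ := by
          rw [← hfθ, ← div_pow]; congr 1; field_simp
        rw [e1, ← mul_div_assoc, div_le_iff₀ hθ0, mul_comm _ θ]
        exact key
      · have h1 : a / (δ' * R) ≤ x * (ε₀ / δ) := by
          rw [hx, div_mul_div_cancel₀ hε₀0.ne']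
          refine div_le_div_of_nonneg_left ha.le hδ ?_
          nlinarith
        have h2 : (x * (ε₀ / δ)) ^ ((d : ℝ) - 3 / 2) ≤ b₁ ^ (2 : ℝ) := by
          rw [Real.mul_rpow hx0.le (by positivity), Real.rpow_two, sq]
          have h3 : x ^ ((d : ℝ) - 3 / 2) ≤ b₁ :=
            le_trans (le_mul_of_one_le_left (by positivity) (one_le_pow₀ hR)) hb₁
          have h4 : (ε₀ / δ) ^ ((d : ℝ) - 3 / 2) ≤ b₁ :=
            le_trans (le_mul_of_one_le_left (by positivity)
              (Real.one_le_rpow hR (by norm_num))) hb₁'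
          gcongr
        calc (a / (δ' * R)) ^ (d - 1) ≤ (x * (ε₀ / δ)) ^ (d - 1) := by gcongr
          _ = (x * (ε₀ / δ)) ^ (((d : ℝ) - 3 / 2) * ((2 + 1 / ((d : ℝ) - 3 / 2)) / 2)) := by
            rw [← Real.rpow_natCast]; congr 1
            push_cast [Nat.cast_sub (show 1 ≤ d by omega)]
            have h5 : ((d : ℝ) - 3 / 2) * (1 / ((d : ℝ) - 3 / 2)) = 1 := mul_one_div_cancel hd0.ne'
            linear_combination -(1 / 2) * h5
          _ = ((x * (ε₀ / δ)) ^ ((d : ℝ) - 3 / 2)) ^ ((2 + 1 / ((d : ℝ) - 3 / 2)) / 2) :=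
            Real.rpow_mul (by positivity) _ _
          _ ≤ (b₁ ^ (2 : ℝ)) ^ ((2 + 1 / ((d : ℝ) - 3 / 2)) / 2) :=
            Real.rpow_le_rpow (by positivity) h2 (by positivity)
          _ = _ := by rw [← Real.rpow_mul hb0.le]; congr 1; ring
      -- Second bound on `G`, from `ρ / α ≤ δ'`. The factor `q = α / R` is the gain obtained by
      -- imposing the gap `ρ / α` between adjunctions.
      · have h1 : a / (δ' * R) ≤ (a / ρ) * q := by
          rw [hq, div_mul_div_comm]
          rw [div_le_div_iff₀ (by positivity) (by positivity)]
          have : ρ ≤ δ' * α := by rwa [div_le_iff₀ hα] at hρ'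
          nlinarith [mul_pos ha hR0]
        calc (a / (δ' * R)) ^ (d - 1) ≤ ((a / ρ) * q) ^ (d - 1) := by gcongr
          _ = (a / ρ) ^ (d - 1) * q ^ (d - 1) := mul_pow _ _ _
          _ ≤ _ := by gcongr

/-! ### The pathological parameters and the pathological times. -/

/-- The bound on the measure of the pathological parameters, up to a constant. -/
def badBound (d : ℕ) (N R η a ε₀ δ ρ α : ℝ) : ℝ :=
  η ^ d + R ^ d * (a / ρ) ^ (d - 1) + N * R ^ (2 * d - 1) * (a / ε₀) ^ ((d : ℝ) - 3 / 2) +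
    N * R ^ ((d : ℝ) + 1 / 2) * (ε₀ / δ) ^ ((d : ℝ) - 3 / 2) + R ^ (d - 1) * α +
    R ^ d * α ^ (1 / 8 : ℝ)

lemma badBound_eq (hd : 2 ≤ d) {N R η a ε₀ δ ρ α : ℝ} (hR : 0 < R) :
    badBound d N R η a ε₀ δ ρ α = R ^ d * (((η / R) ^ d + (a / ρ) ^ (d - 1) + α / R +
      α ^ (1 / 8 : ℝ)) + N * (R ^ (d - 1) * (a / ε₀) ^ ((d : ℝ) - 3 / 2) +
        R ^ (1 / 2 : ℝ) * (ε₀ / δ) ^ ((d : ℝ) - 3 / 2))) := by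
  have h1 : R ^ d * (η / R) ^ d = η ^ d := by rw [← mul_pow]; congr 1; field_simp
  have h2 : R ^ d * (α / R) = R ^ (d - 1) * α := by
    have : R ^ d = R ^ (d - 1) * R := by rw [← pow_succ]; congr 1; omega
    rw [this]; field_simp
  have h3 : R ^ d * R ^ (d - 1) = R ^ (2 * d - 1) := by rw [← pow_add]; congr 1; omega
  have h4 : R ^ d * R ^ (1 / 2 : ℝ) = R ^ ((d : ℝ) + 1 / 2) := by
    rw [Real.rpow_add hR, Real.rpow_natCast]
  rw [badBound, ← h1, ← h2, ← h3, ← h4]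
  ring

set_option maxHeartbeats 400000 in
/-- The pathological parameters of an adjunction. -/
lemma exists_pathological_parameters (hd : 2 ≤ d) :
    ∃ C > (0 : ℝ), ∀ R η a ε₀ δ ρ α : ℝ, 1 ≤ R → 0 < η → η ≤ 1 → 0 < a → a ≤ ε₀ → 0 < δ →
      ε₀ ≤ η * δ → 0 < ρ → 0 < α → α ≤ 1 → ∃ F ≤ ε₀, ∀ (n : ℕ) (j : Fin n) (Z : Config d n),
      ∃ E : Set (AdjParam d), MeasurableSet E ∧
        adjMeasure d E ≤ ENNReal.ofReal (C * badBound d n R η a ε₀ δ ρ α) ∧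
        (IsReady α F R (ρ / 2) j Z → ∀ p ∉ E, ‖p.2‖ ≤ R →
          IsSafe α (max δ (ρ / α)) F (3 * a) j (adjoin 0 Z j p)) := by
  have hd0 : 0 < d := by omega
  have hd' : (2 : ℝ) ≤ d := by exact_mod_cast hd
  set κ : ℝ := 1 / (2 * d) with hκ
  have hκ0 : 0 < κ := by positivity
  have hκ1 : κ < 1 := by rw [hκ, div_lt_one (by positivity)]; linarith
  obtain ⟨C₁, hC₁, h₁⟩ := exists_adjMeasure_not_isSafe_le hd hκ0 hκ1
  set c₀ : ℝ := (1 / 12) ^ (d - 1) with hc₀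
  have hc₀0 : 0 < c₀ := by positivity
  -- The `10` counts multiples of `R^d * b`: six terms for the pair, one for the cutoff `μ = b`,
  -- three for the other particles. The second summand serves when `b > c₀`.
  refine ⟨10 * C₁ + d * 2 ^ d * 2 ^ d / c₀, by positivity, ?_⟩
  intro R η a ε₀ δ ρ α hR hη hη1 ha hε₀ hδ hF hρ hα hα1
  have hR0 : 0 < R := by linarith
  have hε₀0 : 0 < ε₀ := ha.trans_le hε₀
  set B₀ := (η / R) ^ d + (a / ρ) ^ (d - 1) + α / R + α ^ (1 / 8 : ℝ) with hB₀
  set b₁ := R ^ (d - 1) * (a / ε₀) ^ ((d : ℝ) - 3 / 2) +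
        R ^ (1 / 2 : ℝ) * (ε₀ / δ) ^ ((d : ℝ) - 3 / 2) with hb₁
  have p1 : 0 < (η / R) ^ d := by positivity
  have p2 : 0 < (a / ρ) ^ (d - 1) := by positivity
  have p3 : 0 < α / R := by positivity
  have p4 : 0 < α ^ (1 / 8 : ℝ) := by positivity
  have p5 : 0 < R ^ (d - 1) * (a / ε₀) ^ ((d : ℝ) - 3 / 2) := by positivity
  have p6 : 0 < R ^ (1 / 2 : ℝ) * (ε₀ / δ) ^ ((d : ℝ) - 3 / 2) := by positivity
  have hB₀0 : 0 < B₀ := by positivity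
  have hb₁0 : 0 < b₁ := by positivity
  have u1 : (η / R) ^ d ≤ B₀ := by linarith
  have u2 : (a / ρ) ^ (d - 1) ≤ B₀ := by linarith
  have u4 : α ^ (1 / 8 : ℝ) ≤ B₀ := by linarith
  have u5 : R ^ (d - 1) * (a / ε₀) ^ ((d : ℝ) - 3 / 2) ≤ b₁ := by linarith
  have u6 : R ^ (1 / 2 : ℝ) * (ε₀ / δ) ^ ((d : ℝ) - 3 / 2) ≤ b₁ := by linarith
  have hbad : ∀ N : ℝ, badBound d N R η a ε₀ δ ρ α = R ^ d * (B₀ + N * b₁) := fun N =>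
    badBound_eq hd hR0
  clear_value B₀ b₁
  clear hB₀ hb₁ p1 p2 p3 p5 p6
  have hαB : α ≤ B₀ ^ 8 := by
    calc α = (α ^ (1 / 8 : ℝ)) ^ 8 := by
          rw [← Real.rpow_natCast, ← Real.rpow_mul hα.le]; norm_num
      _ ≤ B₀ ^ 8 := by gcongr
  set δ' := max δ (ρ / α) with hδ'
  have hδδ' : δ ≤ δ' := le_max_left _ _
  have hδ'0 : 0 < δ' := hδ.trans_le hδδ'
  obtain ⟨F, hF0, hFε, hsep⟩ := exists_separation hd (B₀ := B₀) (b₁ := b₁) hκ hR hα ha hε₀ hδ hρ hδδ'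
    (le_max_right _ _) u2 hαB u5 u6
  clear_value δ'
  refine ⟨F, hFε, fun n j Z => ?_⟩
  rw [hbad]
  set b := B₀ + n * b₁ with hb
  have hb0 : 0 < b := by positivity
  have hBb : B₀ ≤ b := by rw [hb]; exact le_add_of_nonneg_right (by positivity)
  clear_value b
  -- When `b > c₀` the announced bound exceeds, up to a constant, the measure of all parameters with
  -- velocity at most `R`, and these are all declared pathological.
  by_cases hbc : b ≤ c₀
  · by_cases hZ : IsReady α F R (ρ / 2) j Z
    · refine ⟨toMeasurable (adjMeasure d)
        {p | ‖p.2‖ ≤ R ∧ ¬ IsSafe α δ' F (3 * a) j (adjoin 0 Z j p)}, measurableSet_toMeasurable _ _,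
        ?_, fun _ p hp hpR => by_contra fun h => hp (subset_toMeasurable _ _ ⟨hpR, h⟩)⟩
      rw [measure_toMeasurable]
      have hn : (1 : ℝ) ≤ n := by
        have := j.pos
        exact_mod_cast this
      obtain ⟨hF12, hT, hS⟩ := hsep n hn hZ.card_le (hb ▸ hbc)
      rw [← hb] at hT hS
      have hb1 : b ≤ 1 := hbc.trans (pow_le_one₀ (by norm_num) (by norm_num))
      have hαle : α ^ (1 / 8 : ℝ) ≤ b := u4.trans hBb
      have haρ : 12 * a ≤ ρ := by
        have h2 : a / ρ ≤ 1 / 12 := by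
          refine le_of_pow_le_pow_left₀ (by omega : d - 1 ≠ 0) (by norm_num) ?_
          exact (u2.trans hBb).trans hbc
        rw [div_le_iff₀ hρ] at h2; linarith
      have hηδ : F ≤ η * δ' := hFε.trans (hF.trans (by gcongr))
      have hFR : F ≤ δ' * R := by nlinarith
      -- The cutoff `μ` is `b` itself: the grazing set then costs `R^d * b`, and `F` was chosen for
      -- the negative powers of `b` to be compensated.
      refine (h₁ n Z j R a F δ' ρ α η b hZ ha hF12 hδ'0 hFR hηδ haρ hα hη.le hb0 hb1).trans
        (ENNReal.ofReal_le_ofReal ?_)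
      set S := (F / (δ' * R)) ^ (d - 1) with hSdef
      set T := (a / F) ^ (d - 1) with hTdef
      have hS0 : 0 ≤ S := by positivity
      clear_value S T
      have hRd : 0 ≤ R ^ d := by positivity
      have hRd1 : R ^ (d - 1) ≤ R ^ d := pow_le_pow_right₀ hR (by omega)
      have hsq : √α ≤ b := by
        refine le_trans ?_ hαle
        rw [Real.sqrt_eq_rpow]
        exact Real.rpow_le_rpow_of_exponent_ge hα hα1 (by norm_num)
      have q1 : η ^ d ≤ R ^ d * b := by
        have : η ^ d = R ^ d * (η / R) ^ d := by rw [← mul_pow]; congr 1; field_simp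
        rw [this]; gcongr; exact u1.trans hBb
      have q2 : R ^ (d - 1) * α ≤ R ^ d * b := by
        have h8 : α ≤ √α := by
          rw [Real.le_sqrt' hα]; nlinarith
        exact mul_le_mul hRd1 (h8.trans hsq) hα.le hRd
      have q3 : R ^ d * √α ≤ R ^ d * b := by gcongr
      have q4 : R ^ (d - 1) * √α ≤ R ^ d * b := mul_le_mul hRd1 hsq (by positivity) hRd
      have q5 : R ^ d * (a / ρ) ^ (d - 1) ≤ R ^ d * b := by gcongr; exact u2.trans hBb
      have q6 : R ^ d * S ≤ R ^ d * b := by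
        gcongr
        calc S ≤ n * S := le_mul_of_one_le_left hS0 hn
          _ ≤ b ^ ((d : ℝ) - 1 + κ) := hS
          _ ≤ b ^ (1 : ℝ) := Real.rpow_le_rpow_of_exponent_ge hb0 hb1 (by linarith)
          _ = b := Real.rpow_one b
      have q7 : n * (R ^ d * (T * b ^ (-κ) + S * b ^ (-((d : ℝ) - 2 + κ)))) ≤ 3 * (R ^ d * b) := by
        have r1 : n * T * b ^ (-κ) ≤ 2 * b := by
          calc n * T * b ^ (-κ) ≤ 2 * b ^ (1 + κ) * b ^ (-κ) := by gcongr
            _ = 2 * b := by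
              rw [mul_assoc, ← Real.rpow_add hb0]; norm_num
        have r2 : n * S * b ^ (-((d : ℝ) - 2 + κ)) ≤ b := by
          calc n * S * b ^ (-((d : ℝ) - 2 + κ)) ≤
              b ^ ((d : ℝ) - 1 + κ) * b ^ (-((d : ℝ) - 2 + κ)) := by gcongr
            _ = b ^ (1 : ℝ) := by rw [← Real.rpow_add hb0]; congr 1; ring
            _ = b := Real.rpow_one b
        calc n * (R ^ d * (T * b ^ (-κ) + S * b ^ (-((d : ℝ) - 2 + κ))))
            = R ^ d * (n * T * b ^ (-κ) + n * S * b ^ (-((d : ℝ) - 2 + κ))) := by ring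
          _ ≤ R ^ d * (2 * b + b) := by gcongr
          _ = _ := by ring
      calc _ ≤ C₁ * (10 * (R ^ d * b)) := by gcongr; linarith
        _ = (10 * C₁) * (R ^ d * b) := by ring
        _ ≤ _ := by gcongr; exact le_add_of_nonneg_right (by positivity)
    · exact ⟨∅, MeasurableSet.empty, by simp, fun h => absurd h hZ⟩
  · refine ⟨{p | p.2 ∈ {v : Vec d | ‖v - 0‖ ≤ R}}, ?_, ?_, fun _ p hp hpR => absurd ?_ hp⟩
    · exact measurableSet_le (f := fun p : AdjParam d => ‖p.2 - 0‖) (by fun_prop) measurable_const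
    · refine (adjMeasure_univ_prod_le _).trans ((mul_le_mul_right (volume_ball_le 0 R) _).trans ?_)
      rw [ofReal_mul_ofReal_pow (by positivity) (by positivity)]
      refine ENNReal.ofReal_le_ofReal ?_
      have h9 : 1 ≤ b / c₀ := (one_le_div hc₀0).2 (not_le.1 hbc).le
      calc d * 2 ^ d * (2 * R) ^ d = d * 2 ^ d * 2 ^ d * R ^ d * 1 := by rw [mul_pow]; ring
        _ ≤ d * 2 ^ d * 2 ^ d * R ^ d * (b / c₀) := by gcongr
        _ = d * 2 ^ d * 2 ^ d / c₀ * (R ^ d * b) := by ring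
        _ ≤ _ := by gcongr; exact le_add_of_nonneg_left (by positivity)
    · simpa using hpR

/-- The pathological times of the adjunction next to a particle that has the position `x` and the
velocity `v` at the time `τ`. -/
lemma exists_pathological_times {α ρ : ℝ} (hα : 0 < α) (hρ : 0 < ρ) (T τ : ℝ) (x v : Vec d) :
    ∃ U : Set ℝ, MeasurableSet U ∧ U ⊆ Icc 0 T ∧ volume U ≤ ENNReal.ofReal (2 * (ρ / α)) ∧
      ∀ t ∈ Icc 0 T, t ≤ τ → t ∉ U →
        ρ / α ≤ τ - t ∧ (α ≤ |v 0| → ρ / 2 ≤ |(x - (τ - t) • v) 0|) := by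
  -- The interval forces the gap `ρ / α`. The ball is centred at the time when the unreflected
  -- motion meets the wall, so outside of it the distance to the wall is at least `α * (ρ / α / 2)`.
  -- Each has length `ρ / α`. For `v 0 = 0` the centre is the default value `τ`, which is harmless
  -- because the claim on the wall assumes `α ≤ |v 0|`.
  refine ⟨Icc 0 T ∩ (Icc (τ - ρ / α) τ ∪ Metric.ball (τ - x 0 / v 0) (ρ / α / 2)), ?_,
    inter_subset_left, ?_, ?_⟩
  · exact measurableSet_Icc.inter (measurableSet_Icc.union Metric.isOpen_ball.measurableSet)
  · refine (measure_mono inter_subset_right).trans ((measure_union_le _ _).trans (le_of_eq ?_))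
    rw [Real.volume_Icc, Real.volume_ball, ← ENNReal.ofReal_add (by ring_nf; positivity) (by positivity)]
    congr 1; ring
  · intro t ht htτ htU
    simp only [mem_inter_iff, mem_union, not_and_or, not_or] at htU
    obtain ⟨h1, h2⟩ := htU.resolve_left (not_not.2 ht)
    refine ⟨?_, fun hv => ?_⟩
    · by_contra h
      exact h1 ⟨by linarith [not_le.1 h], htτ⟩
    · have hv0 : v 0 ≠ 0 := by
        intro h
        rw [h, abs_zero] at hv; linarith
      rw [Metric.mem_ball, Real.dist_eq, not_lt] at h2
      have e : (x - (τ - t) • v) 0 = v 0 * (t - (τ - x 0 / v 0)) := by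
        rw [PiLp.sub_apply, PiLp.smul_apply, smul_eq_mul]; field_simp; ring
      rw [e, abs_mul]
      calc ρ / 2 = α * (ρ / α / 2) := by field_simp
        _ ≤ _ := by gcongr

/-! ### Boltzmann flow between adjunctions, and good initial configurations. -/

lemma freeFlow_pos_zero {n : ℕ} (u : ℝ) (Z : Config d n) (i : Fin n) :
    (freeFlow u Z).1 i 0 = |(Z.1 i - u • Z.2 i) 0| := by
  simp only [freeFlow]
  split_ifs with h
  · rw [symm₀_zero_coord, abs_of_neg h]
  · rw [abs_of_nonneg (not_lt.1 h)]

/-- Each particle carries energy at least `α^2`, so the total energy limits the number of particles.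
This is what allows `F` not to depend on that number. -/
lemma card_mul_sq_le {n : ℕ} {Z : Config d n} {α R : ℝ} (hα : 0 ≤ α) (hZ : ∀ i, α ≤ |Z.2 i 0|)
    (hR : velNorm Z ^ 2 ≤ R ^ 2) : n * α ^ 2 ≤ R ^ 2 := by
  refine le_trans ?_ hR
  rw [velNorm_sq]
  have h : ∀ i ∈ Finset.univ, α ^ 2 ≤ ‖Z.2 i‖ ^ 2 := fun i _ => by
    have := (hZ i).trans (abs_coord_zero_le _)
    gcongr
  simpa using Finset.card_nsmul_le_sum _ _ _ h

/-- After a wait of at least `δ`, the separation valid from the time `δ` on becomes a separation at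
all subsequent times. -/
lemma isReady_freeFlow {n : ℕ} {Z : Config d n} {α F R r δ u : ℝ} {j : Fin n} (hα : 0 ≤ α)
    (hR : 0 ≤ R) (hZ : ∀ i, α ≤ |Z.2 i 0|)
    (hF : ∀ i i', i ≠ i' → ApartFrom δ F (particle Z i) (particle Z i'))
    (hV : velNorm Z ^ 2 ≤ R ^ 2) (hu : δ ≤ u) (hr : r ≤ (freeFlow u Z).1 j 0) :
    IsReady α F R r j (freeFlow u Z) where
  apart i i' h := by
    have h1 := ((hF i i' h).freeMove (τ := u)).of_close (close_freeFlow u Z i) (close_freeFlow u Z i')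
    exact h1.mono (by linarith) (by linarith)
  vel_le i := by
    rw [norm_freeFlow_vel]
    exact (norm_vel_le_velNorm Z i).trans (abs_le_of_sq_le_sq' hV hR).2
  vel_zero i := by rw [abs_freeFlow_vel_zero]; exact hZ i
  far := hr
  card_le := card_mul_sq_le hα hZ hV

lemma velNorm_boltzmannAt {s : ℕ} (Z : Config d s) (t : ℕ → ℝ) (J : (l : ℕ) → Fin (s + l))
    (A : ℕ → AdjParam d) (l : ℕ) :
    velNorm (boltzmannAt Z t J A l) ^ 2 = velNorm Z ^ 2 + ∑ i ∈ Finset.range l, ‖(A i).2‖ ^ 2 := by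
  induction l with
  | zero => simp [boltzmannAt]
  | succ l ih =>
    refine (velNorm_adjoin 0 (freeFlow (t l - t (l + 1)) (boltzmannAt Z t J A l)) (J l) (A l)).trans ?_
    rw [velNorm_freeFlow, ih, Finset.sum_range_succ, add_assoc]

lemma distLine_le (w v y : Vec d) (c : ℝ) : distLine w v y ≤ ‖w - (v + c • y)‖ := by
  rw [← dist_eq_norm]
  exact Metric.infDist_le_dist_of_mem ⟨c, rfl⟩

/-- Divided by `u`, the relative position at time `u` is the difference between `Q.2` and the point
of parameter `-1 / u` of the line. -/
lemma mul_distLine_le {P Q : Vec d × Vec d} {u : ℝ} (hu : 0 < u) :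
    u * distLine Q.2 P.2 (P.1 - Q.1) ≤ ‖(P.1 - Q.1) - u • (P.2 - Q.2)‖ := by
  have h := distLine_le Q.2 P.2 (P.1 - Q.1) (-u⁻¹)
  have e : (P.1 - Q.1) - u • (P.2 - Q.2) = u • (Q.2 - (P.2 + (-u⁻¹) • (P.1 - Q.1))) := by
    rw [smul_sub u Q.2, smul_add, smul_smul u, mul_neg, mul_inv_cancel₀ hu.ne']; module
  rw [e, norm_smul, Real.norm_of_nonneg hu.le]
  gcongr

/-- As long as `2 * R * u ≤ ε₀ - 3 * a`, the initial distance `ε₀` leaves `3 * a` by the triangle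
inequality. Later, the distance is at least `u * γ`, and a value below `3 * a` would give `8 (ε₀ - 3
a) < 3 ε₀`, against `ε₀ ≥ 6.8 a`. From the time `δ` on, `u * γ ≥ ε₀` directly. -/
lemma keepsFrom_of_le_distLine {P Q : Vec d × Vec d} {R ε₀ δ γ a : ℝ} (ha : 0 < a)
    (hδ : 0 < δ) (hε₀ : 4 * √3 * a ≤ ε₀) (hγ : max (ε₀ / δ) (16 * R * a / ε₀) ≤ γ)
    (hP : ‖P.2‖ ≤ R) (hQ : ‖Q.2‖ ≤ R) (h : ε₀ ≤ ‖P.1 - Q.1‖)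
    (hd : γ ≤ distLine Q.2 P.2 (P.1 - Q.1)) : KeepsFrom 0 (3 * a) P Q ∧ KeepsFrom δ ε₀ P Q := by
  have h3 : (1.7 : ℝ) ≤ √3 := Real.le_sqrt_of_sq_le (by norm_num)
  have h6 : 6.8 * a ≤ ε₀ := by nlinarith
  have hε₀0 : 0 < ε₀ := by linarith
  have hγ1 : ε₀ / δ ≤ γ := (le_max_left _ _).trans hγ
  have hγ2 : 16 * R * a / ε₀ ≤ γ := (le_max_right _ _).trans hγ
  have hγ0 : 0 ≤ γ := le_trans (by positivity) hγ1
  have key : ∀ u : ℝ, 0 < u → u * γ ≤ ‖(P.1 - Q.1) - u • (P.2 - Q.2)‖ := fun u hu =>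
    (mul_le_mul_of_nonneg_left hd hu.le).trans (mul_distLine_le hu)
  refine ⟨fun u hu => ?_, fun u hu => ?_⟩
  · have hW : ‖P.2 - Q.2‖ ≤ 2 * R := norm_sub_le_two_mul hQ hP
    have h1 : ‖P.1 - Q.1‖ - u * (2 * R) ≤ ‖(P.1 - Q.1) - u • (P.2 - Q.2)‖ := by
      refine le_trans ?_ (norm_sub_norm_le _ _)
      rw [norm_smul, Real.norm_of_nonneg hu]
      gcongr
    by_contra hc
    have h2 : ε₀ - 3 * a < u * (2 * R) := by linarith [not_le.1 hc]
    have hu0 : 0 < u := by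
      rcases hu.eq_or_lt with h' | h'
      · rw [← h'] at h2; linarith
      · exact h'
    have h5 : 16 * R * a ≤ γ * ε₀ := (div_le_iff₀ hε₀0).1 hγ2
    have h7 := (key u hu0).trans (not_le.1 hc).le
    have h8 : u * (16 * R * a) ≤ 3 * a * ε₀ := by
      calc u * (16 * R * a) ≤ u * (γ * ε₀) := by gcongr
        _ = u * γ * ε₀ := by ring
        _ ≤ _ := by gcongr
    have h9 : 8 * a * (ε₀ - 3 * a) < 3 * a * ε₀ := by
      calc 8 * a * (ε₀ - 3 * a) < 8 * a * (u * (2 * R)) := by gcongr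
        _ = u * (16 * R * a) := by ring
        _ ≤ _ := h8
    nlinarith
  · have h2 : ε₀ ≤ γ * δ := (div_le_iff₀ hδ).1 hγ1
    refine le_trans ?_ (key u (by linarith))
    nlinarith

lemma KeepsFrom.symm {Δ D : ℝ} {P Q : Vec d × Vec d} (h : KeepsFrom Δ D P Q) :
    KeepsFrom Δ D Q P := by
  intro u hu
  have e : (Q.1 - P.1) - u • (Q.2 - P.2) = -((P.1 - Q.1) - u • (P.2 - Q.2)) := by module
  rw [e, norm_neg]
  exact h u hu

lemma apartFrom_of_goodInit {s : ℕ} {ε R ε₀ α γ a δ : ℝ} {Z : Config d s}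
    (hZ : Z ∈ goodInit s ε R ε₀ α γ) (hε : 0 < ε) (ha : 0 < a) (hδ : 0 < δ)
    (hε₀ : 4 * √3 * a ≤ ε₀) (hγ : max (ε₀ / δ) (16 * R * a / ε₀) ≤ γ) {i i' : Fin s} (h : i ≠ i') :
    ApartFrom 0 (3 * a) (particle Z i) (particle Z i') ∧
      ApartFrom δ ε₀ (particle Z i) (particle Z i') := by
  obtain ⟨-, hpos, hvel, hdist, -, hl, hl'⟩ := hZ
  have hv : ∀ i, ‖Z.2 i‖ ≤ R := fun i => (norm_vel_le_velNorm Z i).trans hvel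
  have key : ∀ i i', i < i' → ApartFrom 0 (3 * a) (particle Z i') (particle Z i) ∧
      ApartFrom δ ε₀ (particle Z i') (particle Z i) := by
    intro i i' h
    have h1 := keepsFrom_of_le_distLine (P := particle Z i) (Q := particle Z i') ha hδ hε₀ hγ
      (hv i) (hv i') (hdist i i' h) (hl i i' h)
    have h2 := keepsFrom_of_le_distLine (P := mirror (particle Z i)) (Q := particle Z i') ha hδ
      hε₀ hγ (by simpa [mirror, particle] using hv i) (hv i') (by
        refine (hdist i i' h).trans ?_
        simp only [mirror, particle]
        rw [norm_symm₀_sub]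
        exact norm_sub_le_norm_sub_symm₀ (by linarith [hpos i]) (by linarith [hpos i']))
      (hl' i i' h)
    exact ⟨apartFrom_iff.2 ⟨h1.1.symm, h2.1.symm⟩, apartFrom_iff.2 ⟨h1.2.symm, h2.2.symm⟩⟩
  rcases lt_or_gt_of_ne h with h | h
  · exact ⟨(key i i' h).1.symm, (key i i' h).2.symm⟩
  · exact key i' i h

/-! ### Hard-sphere trajectories whose only events are bounces. -/

open Filter Topology

/-- The `i`-th particle, with the positions shifted in such a way that the hard spheres bounce when
the first coordinate vanishes. -/
def shifted {n : ℕ} (ε : ℝ) (Z : Config d n) (i : Fin n) : Vec d × Vec d :=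
  (Z.1 i - (ε / 2) • e₁, Z.2 i)

lemma e₁_zero : (e₁ : Vec d) 0 = 1 := by simp [e₁]

lemma shifted_pos_zero {n : ℕ} (ε : ℝ) (Z : Config d n) (i : Fin n) :
    (shifted ε Z i).1 0 = Z.1 i 0 - ε / 2 := by
  simp only [shifted, PiLp.sub_apply, PiLp.smul_apply, smul_eq_mul, e₁_zero, mul_one]

lemma shifted_sub_shifted {n : ℕ} (ε : ℝ) (Z : Config d n) (i j : Fin n) :
    (shifted ε Z i).1 - (shifted ε Z j).1 = Z.1 i - Z.1 j := by
  simp only [shifted]; abel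

/-- The spheres of the configuration `Z` move freely, apart from the bounces against the wall. -/
structure FreelyFlows {n : ℕ} (ε : ℝ) (Z : Config d n) : Prop where
  mem : Z ∈ phaseSpace ε n
  vel_ne : ∀ i, Z.2 i 0 ≠ 0
  vel_neg : ∀ i, Z.1 i 0 = ε / 2 → Z.2 i 0 < 0
  apart : ∀ i j, i ≠ j → ∀ u : ℝ, 0 < u →
    ε < ‖(freeMove u (shifted ε Z i)).1 - (freeMove u (shifted ε Z j)).1‖ ∧
    ε < ‖(freeMove u (shifted ε Z i)).1 - symm₀ (freeMove u (shifted ε Z j)).1‖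

lemma lt_norm_sub_of_close {ε : ℝ} {P Q P' Q' : Vec d × Vec d} (h : ε < ‖P.1 - Q.1‖)
    (h' : ε < ‖P.1 - symm₀ Q.1‖) (hP : Close 0 P' P) (hQ : Close 0 Q' Q) : ε < ‖P'.1 - Q'.1‖ := by
  rcases hP.eq_or_eq with rfl | rfl <;> rcases hQ.eq_or_eq with rfl | rfl
  · exact h
  · exact h'
  · simp only [mirror]; rwa [norm_symm₀_sub]
  · simp only [mirror]; rwa [norm_symm₀_sub_symm₀]

lemma FreelyFlows.lt_norm_sub {n : ℕ} {ε : ℝ} {Z Y : Config d n} (hZ : FreelyFlows ε Z) {u : ℝ}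
    (hu : 0 < u) (h : ∀ i, Close 0 (shifted ε Y i) (freeMove u (shifted ε Z i))) {i j : Fin n}
    (hij : i ≠ j) : ε < ‖Y.1 i - Y.1 j‖ := by
  rw [← shifted_sub_shifted ε]
  exact lt_norm_sub_of_close (hZ.apart i j hij u hu).1 (hZ.apart i j hij u hu).2 (h i) (h j)

/-- Close particles have the same velocity up to reflection. -/
lemma Close.abs_vel_zero {c : ℝ} {P Q : Vec d × Vec d} (h : Close c P Q) : |P.2 0| = |Q.2 0| := by
  rcases h with ⟨h, -⟩ | ⟨h, -⟩ <;> rw [h]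
  rw [symm₀_zero_coord, abs_neg]

lemma jump_of_apart {n : ℕ} {ε : ℝ} {X V W : Fin n → Vec d} (h : IsJump ε X V W)
    (hX : ∀ i j, i ≠ j → ε < ‖X i - X j‖) (i : Fin n) :
    (X i 0 = ε / 2 ∧ W i = symm₀ (V i)) ∨ (X i 0 ≠ ε / 2 ∧ W i = V i) := by
  by_cases h0 : X i 0 = ε / 2
  · exact Or.inl ⟨h0, ((h i).1 h0).2⟩
  · exact Or.inr ⟨h0, (h i).2.2 h0 fun j hj => (hX i j hj.symm).ne'⟩

lemma isJump_of_apart {n : ℕ} {ε : ℝ} {X V W : Fin n → Vec d}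
    (hX : ∀ i j, i ≠ j → ε < ‖X i - X j‖) (h : ∀ i, X i 0 = ε / 2 → W i = symm₀ (V i))
    (h' : ∀ i, X i 0 ≠ ε / 2 → W i = V i) : IsJump ε X V W := fun i =>
  ⟨fun h0 => ⟨fun j hj => (hX i j hj.symm).ne', h i h0⟩,
    fun j hj h0 => absurd h0 (hX i j hj.symm).ne', fun h0 _ => h' i h0⟩

/-- A trajectory of the hard sphere dynamics from a configuration which flows freely is given by the
free flow, up to reflection. -/
lemma IsHardSphereTrajectory.close {n : ℕ} {ε a b : ℝ} {Y : ℝ → Config d n}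
    (hY : IsHardSphereTrajectory ε Y a b) (hZ : FreelyFlows ε (Y b)) {τ : ℝ} (hτ : τ ∈ Icc a b)
    (i : Fin n) : Close 0 (shifted ε (Y τ) i) (freeMove (b - τ) (shifted ε (Y b) i)) := by
  obtain ⟨-, h2, h3⟩ := hY
  -- Induction on a continuum, downwards from `b`: the supremum `σ` of the bad times is itself good,
  -- through the jump condition, and then the free piece on its left makes the times just below
  -- good, which is absurd.
  set S : Set ℝ := {τ | τ ∈ Icc a b ∧
    ¬ ∀ i, Close 0 (shifted ε (Y τ) i) (freeMove (b - τ) (shifted ε (Y b) i))} with hS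
  suffices hne : ¬ S.Nonempty by
    by_contra h
    exact hne ⟨τ, hτ, fun h' => h (h' i)⟩
  intro hne
  have hbd : BddAbove S := ⟨b, fun x hx => hx.1.2⟩
  set σ := sSup S with hσ
  have hab : σ ∈ Icc a b := by
    obtain ⟨x, hx⟩ := hne
    exact ⟨hx.1.1.trans (le_csSup hbd hx), csSup_le ⟨x, hx⟩ fun y hy => hy.1.2⟩
  have hgood : ∀ u, σ < u → u ≤ b →
      ∀ i, Close 0 (shifted ε (Y u) i) (freeMove (b - u) (shifted ε (Y b) i)) := by
    intro u hu hub
    by_contra h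
    exact absurd (le_csSup hbd (show u ∈ S from ⟨⟨hab.1.trans hu.le, hub⟩, h⟩)) (not_le.2 hu)
  have hσgood : ∀ i, Close 0 (shifted ε (Y σ) i) (freeMove (b - σ) (shifted ε (Y b) i)) := by
    rcases hab.2.eq_or_lt with hσb | hσb
    · intro i
      rw [hσb, sub_self, freeMove_zero]
      exact Close.refl _
    · obtain ⟨h, hh, V, hV, hJ⟩ := h3 σ ⟨hab.1, hσb⟩
      obtain ⟨u, hu1, hu2⟩ := exists_between (lt_min (by linarith : σ < σ + h) hσb)
      have hu3 : u < σ + h := hu2.trans_le (min_le_left _ _)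
      have hub : u ≤ b := (hu2.trans_le (min_le_right _ _)).le
      have key : ∀ i, Close 0 ((Y σ).1 i - (ε / 2) • (e₁ : Vec d), V i)
          (freeMove (b - σ) (shifted ε (Y b) i)) := by
        intro i
        have h5 := (hgood u hu1 hub i).freeMove (u - σ)
        rw [freeMove_freeMove, show b - u + (u - σ) = b - σ by ring] at h5
        convert h5 using 1
        rw [hV u ⟨hu1, hu3⟩ hub]
        simp only [freeMove, shifted, Prod.mk.injEq, and_true]
        module
      -- The motion on the later side of `σ` already determines the positions at `σ` up to
      -- reflection, hence no two spheres touch and the jump consists of bounces only.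
      have hfar : ∀ i j, i ≠ j → ε < ‖(Y σ).1 i - (Y σ).1 j‖ := fun i j hij =>
        hZ.lt_norm_sub (Y := ((Y σ).1, V)) (sub_pos.2 hσb) key hij
      intro i
      rcases jump_of_apart hJ hfar i with ⟨h0, hW⟩ | ⟨-, hW⟩
      · have h6 : Close 0 (shifted ε (Y σ) i) ((Y σ).1 i - (ε / 2) • (e₁ : Vec d), V i) := by
          have h7 := shifted_pos_zero ε (Y σ) i
          rw [h0, sub_self] at h7
          refine Or.inr ⟨hW, ?_⟩
          have h8 := symm₀_of_zero h7
          simp only [shifted] at h8 ⊢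
          rw [h8, sub_self, norm_zero]
        simpa using h6.trans (key i)
      · have h6 : shifted ε (Y σ) i = ((Y σ).1 i - (ε / 2) • (e₁ : Vec d), V i) := by
          simp only [shifted, hW]
        rw [h6]; exact key i
  have hmem : σ ∉ S := fun h => h.2 hσgood
  have hlt : ∀ x ∈ S, x < σ := fun x hx => lt_of_le_of_ne (le_csSup hbd hx)
    (fun h => hmem (h ▸ hx))
  have haσ : a < σ := by
    obtain ⟨x, hx⟩ := hne
    exact hx.1.1.trans_lt (hlt x hx)
  obtain ⟨h, hh, hfree⟩ := h2 σ ⟨haσ, hab.2⟩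
  obtain ⟨x, hx, hxσ⟩ := exists_lt_of_lt_csSup hne (by linarith : σ - h < σ)
  refine hx.2 fun i => ?_
  have h5 := (hσgood i).freeMove (σ - x)
  rw [freeMove_freeMove, show b - σ + (σ - x) = b - x by ring] at h5
  convert h5 using 1
  rw [hfree x ⟨hxσ, hlt x hx⟩ hx.1.1]
  simp only [freeMove, shifted, Prod.mk.injEq, and_true]
  module

/-- In a trajectory, a particle which has just bounced moves away from the wall. -/
lemma IsHardSphereTrajectory.vel_nonpos {n : ℕ} {ε a b : ℝ} {Y : ℝ → Config d n}
    (hY : IsHardSphereTrajectory ε Y a b) (hZ : FreelyFlows ε (Y b)) {τ : ℝ} (hτ : τ ∈ Ico a b)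
    {i : Fin n} (h0 : (Y τ).1 i 0 = ε / 2) : (Y τ).2 i 0 ≤ 0 := by
  obtain ⟨h, hh, V, hV, hJ⟩ := hY.2.2 τ hτ
  have hfar : ∀ i j, i ≠ j → ε < ‖(Y τ).1 i - (Y τ).1 j‖ := fun i j hij =>
    hZ.lt_norm_sub (sub_pos.2 hτ.2) (fun i => hY.close hZ ⟨hτ.1, hτ.2.le⟩ i) hij
  obtain ⟨u, hu1, hu2⟩ := exists_between (lt_min (by linarith : τ < τ + h) hτ.2)
  have hu3 : u < τ + h := hu2.trans_le (min_le_left _ _)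
  have hub : u ≤ b := (hu2.trans_le (min_le_right _ _)).le
  -- At the slightly later time `u` the sphere is in the half-space, so the velocity on the later
  -- side of the bounce points away from the wall; the reflection reverses it.
  have h5 := (hY.1 u ⟨hτ.1.trans hu1.le, hub⟩).1 i
  rw [hV u ⟨hu1, hu3⟩ hub] at h5
  simp only [PiLp.add_apply, PiLp.smul_apply, smul_eq_mul, h0] at h5
  have h6 : 0 ≤ V i 0 := by
    by_contra h'
    have := mul_neg_of_pos_of_neg (sub_pos.2 hu1) (not_le.1 h')
    linarith
  rcases jump_of_apart hJ hfar i with ⟨-, hW⟩ | ⟨h', -⟩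
  · rw [hW, symm₀_zero_coord]; linarith
  · exact absurd h0 h'

open Classical in
/-- Backward motion of a particle of a half-space, with reflection at the boundary. -/
def bounceMove (u : ℝ) (P : Vec d × Vec d) : Vec d × Vec d :=
  if 0 < P.2 0 ∧ P.1 0 ≤ u * P.2 0 then mirror (freeMove u P) else freeMove u P

lemma close_bounceMove (u : ℝ) (P : Vec d × Vec d) : Close 0 (bounceMove u P) (freeMove u P) := by
  rw [bounceMove]
  split_ifs
  · exact close_mirror _
  · exact Close.refl _

lemma freeMove_pos_zero (u : ℝ) (P : Vec d × Vec d) : (freeMove u P).1 0 = P.1 0 - u * P.2 0 := by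
  simp [freeMove]

lemma mirror_pos_zero (P : Vec d × Vec d) : (mirror P).1 0 = - P.1 0 := symm₀_zero_coord _

lemma bounceMove_pos_nonneg {u : ℝ} (hu : 0 ≤ u) {P : Vec d × Vec d} (hP : 0 ≤ P.1 0) :
    0 ≤ (bounceMove u P).1 0 := by
  rw [bounceMove]
  split_ifs with h
  · rw [mirror_pos_zero, freeMove_pos_zero]; linarith [h.2]
  · rw [freeMove_pos_zero]
    by_cases h1 : 0 < P.2 0
    · have := not_le.1 fun h2 => h ⟨h1, h2⟩
      linarith
    · have := mul_nonpos_of_nonneg_of_nonpos hu (not_lt.1 h1)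
      linarith

lemma bounceMove_pos_zero {u : ℝ} {P : Vec d × Vec d} :
    (bounceMove u P).1 0 = 0 ↔ P.1 0 = u * P.2 0 := by
  rw [bounceMove]
  split_ifs
  · rw [mirror_pos_zero, freeMove_pos_zero, neg_eq_zero, sub_eq_zero]
  · rw [freeMove_pos_zero, sub_eq_zero]

/-- The parameter is the time elapsed backwards, so the right of `u` is the earlier side. The
non-strict inequality in `bounceMove` makes its value at a bounce carry the velocity of that side,
as `IsHardSphereTrajectory` requires. -/
lemma eventually_bounceMove_before (u : ℝ) (P : Vec d × Vec d) :
    ∀ᶠ s in 𝓝[>] u, bounceMove s P = freeMove (s - u) (bounceMove u P) := by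
  by_cases h : 0 < P.2 0 ∧ P.1 0 ≤ u * P.2 0
  · filter_upwards [self_mem_nhdsWithin] with s hs
    have hs' : u < s := hs
    rw [bounceMove, bounceMove, if_pos h, if_pos ⟨h.1, h.2.trans (by gcongr; exact h.1.le)⟩,
      freeMove_mirror, freeMove_freeMove, add_sub_cancel]
  · have h2 : ∀ᶠ s in 𝓝[>] u, ¬ (0 < P.2 0 ∧ P.1 0 ≤ s * P.2 0) := by
      by_cases h1 : 0 < P.2 0
      · have h3 : u * P.2 0 < P.1 0 := not_le.1 fun h2 => h ⟨h1, h2⟩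
        have h4 : ContinuousAt (fun s : ℝ => s * P.2 0) u := by fun_prop
        filter_upwards [nhdsWithin_le_nhds (h4.eventually_lt_const h3)] with s hs h5
        exact absurd h5.2 (not_le.2 hs)
      · exact Eventually.of_forall fun s hs => h1 hs.1
    filter_upwards [h2] with s hs
    rw [bounceMove, bounceMove, if_neg h, if_neg hs, freeMove_freeMove, add_sub_cancel]

open Classical in
/-- The particle at the time `u` of its backward motion, before the possible reflection. -/
def bounceMove' (u : ℝ) (P : Vec d × Vec d) : Vec d × Vec d :=
  if 0 < P.2 0 ∧ P.1 0 < u * P.2 0 then mirror (freeMove u P) else freeMove u P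

lemma eventually_bounceMove_after (u : ℝ) (P : Vec d × Vec d) :
    ∀ᶠ s in 𝓝[<] u, bounceMove s P = freeMove (s - u) (bounceMove' u P) := by
  by_cases h : 0 < P.2 0 ∧ P.1 0 < u * P.2 0
  · have h4 : ContinuousAt (fun s : ℝ => s * P.2 0) u := by fun_prop
    filter_upwards [nhdsWithin_le_nhds (h4.eventually_const_lt h.2)] with s hs
    rw [bounceMove, bounceMove', if_pos h, if_pos ⟨h.1, hs.le⟩, freeMove_mirror, freeMove_freeMove,
      add_sub_cancel]
  · filter_upwards [self_mem_nhdsWithin] with s hs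
    have hs' : s < u := hs
    have h2 : ¬ (0 < P.2 0 ∧ P.1 0 ≤ s * P.2 0) := fun h2 =>
      h ⟨h2.1, h2.2.trans_lt (by gcongr; exact h2.1)⟩
    rw [bounceMove, bounceMove', if_neg h, if_neg h2, freeMove_freeMove, add_sub_cancel]

lemma bounceMove'_pos {u : ℝ} {P : Vec d × Vec d} : (bounceMove' u P).1 = (bounceMove u P).1 := by
  by_cases h : P.1 0 = u * P.2 0
  · have h0 : (freeMove u P).1 0 = 0 := by rw [freeMove_pos_zero, h, sub_self]
    have h1 : (mirror (freeMove u P)).1 = (freeMove u P).1 := symm₀_of_zero h0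
    rw [bounceMove, bounceMove', if_neg (fun h' => h'.2.ne h)]
    split_ifs
    · exact h1.symm
    · rfl
  · rw [bounceMove, bounceMove']
    simp only [le_iff_lt_or_eq, h, or_false]

lemma bounceMove_vel_of_eq {u : ℝ} (hu : 0 < u) {P : Vec d × Vec d} (hP : 0 ≤ P.1 0)
    (hv : P.2 0 ≠ 0) (h : P.1 0 = u * P.2 0) : (bounceMove u P).2 = symm₀ (bounceMove' u P).2 := by
  have h1 : 0 < P.2 0 := by
    refine lt_of_le_of_ne ?_ hv.symm
    by_contra h'
    have := mul_neg_of_pos_of_neg hu (not_le.1 h')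
    linarith
  rw [bounceMove, if_pos ⟨h1, h.le⟩, bounceMove', if_neg (fun h' => h'.2.ne h)]
  rfl

lemma bounceMove_vel_of_ne {u : ℝ} {P : Vec d × Vec d} (h : P.1 0 ≠ u * P.2 0) :
    (bounceMove u P).2 = (bounceMove' u P).2 := by
  rw [bounceMove, bounceMove']
  simp only [le_iff_lt_or_eq, h, or_false]

/-- The backward flow of hard spheres which do not collide. -/
def hardFlow {n : ℕ} (ε u : ℝ) (Z : Config d n) : Config d n :=
  (fun i => (bounceMove u (shifted ε Z i)).1 + (ε / 2) • e₁,
    fun i => (bounceMove u (shifted ε Z i)).2)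

lemma shifted_hardFlow {n : ℕ} (ε u : ℝ) (Z : Config d n) (i : Fin n) :
    shifted ε (hardFlow ε u Z) i = bounceMove u (shifted ε Z i) := by
  simp [shifted, hardFlow]

lemma FreelyFlows.hardFlow_zero {n : ℕ} {ε : ℝ} {Z : Config d n} (hZ : FreelyFlows ε Z) :
    hardFlow ε 0 Z = Z := by
  have h : ∀ i, bounceMove 0 (shifted ε Z i) = shifted ε Z i := by
    intro i
    rw [bounceMove, if_neg, freeMove_zero]
    rintro ⟨h1, h2⟩
    rw [zero_mul, shifted_pos_zero] at h2
    -- A sphere that touches the wall at the start has a negative normal velocity, so it leaves the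
    -- wall backwards and must not be reflected at once.
    have h3 := hZ.vel_neg i (le_antisymm (by linarith) (hZ.mem.1 i))
    exact absurd h1 (not_lt.2 h3.le)
  simp only [hardFlow, h]
  simp only [shifted, sub_add_cancel]

lemma exists_Ioo_left {p : ℝ → Prop} {τ : ℝ} (h : ∀ᶠ u in 𝓝[<] τ, p u) :
    ∃ h > 0, ∀ u ∈ Ioo (τ - h) τ, p u := by
  obtain ⟨l, hl, h'⟩ := (mem_nhdsLT_iff_exists_Ioo_subset).1 h
  exact ⟨τ - l, sub_pos.2 hl, fun u hu => h' ⟨by linarith [hu.1], hu.2⟩⟩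

lemma exists_Ioo_right {p : ℝ → Prop} {τ : ℝ} (h : ∀ᶠ u in 𝓝[>] τ, p u) :
    ∃ h > 0, ∀ u ∈ Ioo τ (τ + h), p u := by
  obtain ⟨l, hl, h'⟩ := (mem_nhdsGT_iff_exists_Ioo_subset).1 h
  exact ⟨l - τ, sub_pos.2 hl, fun u hu => h' ⟨hu.1, by linarith [hu.2]⟩⟩

lemma tendsto_const_sub_left (b τ : ℝ) : Tendsto (fun u => b - u) (𝓝[<] τ) (𝓝[>] (b - τ)) := by
  refine tendsto_nhdsWithin_iff.2 ⟨?_, ?_⟩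
  · exact ((continuous_const.sub continuous_id).tendsto τ).mono_left nhdsWithin_le_nhds
  · filter_upwards [self_mem_nhdsWithin] with u hu
    have : u < τ := hu
    exact (by linarith : b - τ < b - u)

lemma tendsto_const_sub_right (b τ : ℝ) : Tendsto (fun u => b - u) (𝓝[>] τ) (𝓝[<] (b - τ)) := by
  refine tendsto_nhdsWithin_iff.2 ⟨?_, ?_⟩
  · exact ((continuous_const.sub continuous_id).tendsto τ).mono_left nhdsWithin_le_nhds
  · filter_upwards [self_mem_nhdsWithin] with u hu
    have : τ < u := hu
    exact (by linarith : b - u < b - τ)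

/-- Existence: since distances stay above `ε`, bouncing each sphere independently of the others
obeys the whole dynamics. -/
lemma FreelyFlows.isHardSphereTrajectory {n : ℕ} {ε : ℝ} {Z : Config d n} (hZ : FreelyFlows ε Z)
    (a b : ℝ) : IsHardSphereTrajectory ε (fun τ => hardFlow ε (b - τ) Z) a b := by
  have hpos : ∀ i, 0 ≤ (shifted ε Z i).1 0 := fun i => by
    rw [shifted_pos_zero]; linarith [hZ.mem.1 i]
  have hfar : ∀ u, 0 < u → ∀ i j, i ≠ j →
      ε < ‖(hardFlow ε u Z).1 i - (hardFlow ε u Z).1 j‖ := fun u hu i j hij =>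
    hZ.lt_norm_sub hu (fun i => by rw [shifted_hardFlow]; exact close_bounceMove _ _) hij
  refine ⟨fun τ hτ => ⟨fun i => ?_, fun i j hij => ?_⟩, fun τ hτ => ?_, fun τ hτ => ?_⟩
  · have h := bounceMove_pos_nonneg (sub_nonneg.2 hτ.2) (hpos i)
    rw [← shifted_hardFlow, shifted_pos_zero] at h
    linarith
  · rcases hτ.2.eq_or_lt with h | h
    · simp only [h, sub_self, hZ.hardFlow_zero]
      exact hZ.mem.2 i j hij
    · exact (hfar _ (sub_pos.2 h) i j hij).le
  · have h1 : ∀ᶠ u in 𝓝[<] τ, ∀ i, bounceMove (b - u) (shifted ε Z i) =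
        freeMove (τ - u) (bounceMove (b - τ) (shifted ε Z i)) := by
      refine eventually_all.2 fun i => ?_
      filter_upwards [(tendsto_const_sub_left b τ).eventually
        (eventually_bounceMove_before (b - τ) (shifted ε Z i))] with u hu
      rw [hu]; congr 1; ring
    obtain ⟨h, hh, h2⟩ := exists_Ioo_left h1
    refine ⟨h, hh, fun u hu _ => Prod.ext (funext fun i => ?_) (funext fun i => ?_)⟩
    · simp only [hardFlow, h2 u hu i, freeMove]; module
    · simp only [hardFlow, h2 u hu i, freeMove]
  · have h1 : ∀ᶠ u in 𝓝[>] τ, ∀ i, bounceMove (b - u) (shifted ε Z i) =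
        freeMove (τ - u) (bounceMove' (b - τ) (shifted ε Z i)) := by
      refine eventually_all.2 fun i => ?_
      filter_upwards [(tendsto_const_sub_right b τ).eventually
        (eventually_bounceMove_after (b - τ) (shifted ε Z i))] with u hu
      rw [hu]; congr 1; ring
    obtain ⟨h, hh, h2⟩ := exists_Ioo_right h1
    have h0 : 0 < b - τ := sub_pos.2 hτ.2
    refine ⟨h, hh, fun i => (bounceMove' (b - τ) (shifted ε Z i)).2, fun u hu _ =>
      Prod.ext (funext fun i => ?_) (funext fun i => ?_), ?_⟩
    · simp only [hardFlow, h2 u hu i, freeMove, bounceMove'_pos]; module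
    · simp only [hardFlow, h2 u hu i, freeMove]
    · have hiff : ∀ i, (hardFlow ε (b - τ) Z).1 i 0 = ε / 2 ↔
          (shifted ε Z i).1 0 = (b - τ) * (shifted ε Z i).2 0 := by
        intro i
        rw [← bounceMove_pos_zero, ← shifted_hardFlow, shifted_pos_zero, sub_eq_zero]
      refine isJump_of_apart (hfar _ h0) (fun i hi => ?_) (fun i hi => ?_)
      · exact bounceMove_vel_of_eq h0 (hpos i) (hZ.vel_ne i) ((hiff i).1 hi)
      · exact bounceMove_vel_of_ne fun h' => hi ((hiff i).2 h')

/-! ### Comparison of the hard spheres with the Boltzmann pseudo-trajectory. -/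

lemma norm_half_smul_e₁ {ε : ℝ} (hε : 0 < ε) : ‖(ε / 2) • (e₁ : Vec d)‖ = ε / 2 := by
  rw [norm_smul, norm_e₁, mul_one, Real.norm_of_nonneg (by positivity)]

lemma close_shifted {n : ℕ} {ε : ℝ} (hε : 0 < ε) (Z : Config d n) (i : Fin n) :
    Close (ε / 2) (shifted ε Z i) (particle Z i) := by
  refine Or.inl ⟨rfl, le_of_eq ?_⟩
  simp only [shifted, particle]
  rw [sub_sub_cancel_left, norm_neg, norm_half_smul_e₁ hε]

/-- The cross term of the squared norm is nonnegative for a pre-collisional pair, and `v ≠ 0` makes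
the inequality strict. The contact at the adjunction is thus immediately lost. -/
lemma lt_norm_smul_sub_smul {ε u : ℝ} (hε : 0 < ε) (hu : 0 < u) {ω v : Vec d} (hω : ‖ω‖ = 1)
    (hv : v ≠ 0) (h : inner ℝ ω v ≤ (0 : ℝ)) : ε < ‖ε • ω - u • v‖ := by
  refine lt_of_pow_lt_pow_left₀ 2 (norm_nonneg _) ?_
  rw [norm_sub_sq_real, norm_smul, norm_smul, inner_smul_left, inner_smul_right, hω, mul_one,
    Real.norm_of_nonneg hε.le, Real.norm_of_nonneg hu.le]
  have h1 : 0 < u * ‖v‖ := mul_pos hu (norm_pos_iff.2 hv)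
  have h2 : ε * (u * inner ℝ ω v) ≤ 0 :=
    mul_nonpos_of_nonneg_of_nonpos hε.le (mul_nonpos_of_nonneg_of_nonpos hu.le h)
  simp only [RCLike.conj_to_real]
  nlinarith

/-- An adjunction which is safe for the Boltzmann dynamics is followed by a free motion of the hard
spheres. -/
lemma freelyFlows_adjoin {n : ℕ} {Y Z : Config d n} {j : Fin n} {p : AdjParam d}
    {α δ F D c ε : ℝ} (hε : 0 < ε) (hα : 0 < α) (hY : ∀ i, ε / 2 ≤ Y.1 i 0)
    (hv : ∀ i, Y.1 i 0 = ε / 2 → Y.2 i 0 ≤ 0)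
    (h : ∀ i, Close c (shifted ε Y i) (particle Z i)) (hfar : c + ε < Z.1 j 0)
    (hS : IsSafe α δ F D j (adjoin 0 Z j p)) (hD : 2 * (c + ε) + ε < D) :
    (∀ i, Close (c + ε) (shifted ε (adjoin ε Y j p) i) (particle (adjoin 0 Z j p) i)) ∧
      FreelyFlows ε (adjoin ε Y j p) ∧
      ∀ i i', i ≠ i' → ¬ (i = j.castSucc ∧ i' = Fin.last n) →
        ¬ (i' = j.castSucc ∧ i = Fin.last n) →
        ε < ‖(adjoin ε Y j p).1 i - (adjoin ε Y j p).1 i'‖ := by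
  have hYs : ∀ i, 0 ≤ (shifted ε Y i).1 0 := fun i => by
    rw [shifted_pos_zero]; linarith [hY i]
  -- The host is too far from the wall to be compared with a mirror image: its two versions have
  -- exactly the same velocity, so the same parameters scatter them in the same way.
  obtain ⟨hjv, hjx⟩ := (h j).eq_of_far (hYs j) (lt_of_le_of_lt (by linarith) hfar)
  have hjv' : Y.2 j = Z.2 j := hjv
  have hω : ‖(p.1 : Vec d)‖ = 1 := norm_sphere p.1
  set Y' := adjoin ε Y j p with hY'
  set Z' := adjoin 0 Z j p with hZ'
  have hguest : (shifted ε Y' (Fin.last n)).2 = (particle Z' (Fin.last n)).2 ∧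
      ‖(shifted ε Y' (Fin.last n)).1 - (particle Z' (Fin.last n)).1‖ ≤ c + ε := by
    refine ⟨by simp only [shifted, particle, hY', hZ', adjoin_vel_last, hjv'], ?_⟩
    simp only [shifted, particle, hY', hZ', adjoin_pos_last, zero_smul, add_zero]
    have e : Y.1 j + ε • (p.1 : Vec d) - (ε / 2) • e₁ - Z.1 j =
        (Y.1 j - (ε / 2) • e₁ - Z.1 j) + ε • (p.1 : Vec d) := by abel
    rw [e]
    refine (norm_add_le _ _).trans (add_le_add hjx ?_)
    rw [norm_smul, hω, mul_one, Real.norm_of_nonneg hε.le]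
  have hhost : (shifted ε Y' j.castSucc).2 = (particle Z' j.castSucc).2 ∧
      ‖(shifted ε Y' j.castSucc).1 - (particle Z' j.castSucc).1‖ ≤ c + ε := by
    refine ⟨by simp only [shifted, particle, hY', hZ', adjoin_vel_host, hjv'], ?_⟩
    simp only [shifted, particle, hY', hZ', adjoin_pos_castSucc]
    exact hjx.trans (by linarith)
  have hold : ∀ i, i ≠ j → shifted ε Y' i.castSucc = shifted ε Y i := fun i hij => by
    simp only [shifted, hY', adjoin_pos_castSucc, adjoin_vel_of_ne _ _ _ _ hij]
  have hclose : ∀ i, Close (c + ε) (shifted ε Y' i) (particle Z' i) := by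
    intro i
    refine Fin.lastCases (Or.inl hguest) (fun i => ?_) i
    by_cases hij : i = j
    · rw [hij]; exact Or.inl hhost
    · have e2 : particle Z' i.castSucc = particle Z i := by
        simp only [particle, hZ', adjoin_pos_castSucc, adjoin_vel_of_ne _ _ _ _ hij]
      rw [hold i hij, e2]
      exact (h i).mono (by linarith)
  have hsep : ∀ i i', i ≠ i' → ¬ (i = j.castSucc ∧ i' = Fin.last n) →
      ¬ (i' = j.castSucc ∧ i = Fin.last n) → ∀ u : ℝ, 0 ≤ u →
      ε < ‖(freeMove u (shifted ε Y' i)).1 - (freeMove u (shifted ε Y' i')).1‖ ∧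
      ε < ‖(freeMove u (shifted ε Y' i)).1 - symm₀ (freeMove u (shifted ε Y' i')).1‖ := by
    intro i i' h1 h2 h3 u hu
    have h4 := (hS.apart i i' h1 h2 h3).of_close (hclose i) (hclose i') u hu
    exact ⟨lt_of_lt_of_le (by linarith) h4.1, lt_of_lt_of_le (by linarith) h4.2⟩
  -- The Boltzmann host and guest start at the same point, so their own distance gives no
  -- information. The direct distance comes from the pre-collisional velocities, and only the
  -- distance to the mirror image is inherited from safety.
  have hpair : ∀ u : ℝ, 0 < u →
      ε < ‖(freeMove u (shifted ε Y' j.castSucc)).1 -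
        (freeMove u (shifted ε Y' (Fin.last n))).1‖ ∧
      ε < ‖(freeMove u (shifted ε Y' j.castSucc)).1 -
        symm₀ (freeMove u (shifted ε Y' (Fin.last n))).1‖ := by
    intro u hu
    constructor
    · have e : (freeMove u (shifted ε Y' j.castSucc)).1 - (freeMove u (shifted ε Y' (Fin.last n))).1 =
          -(ε • (p.1 : Vec d) - u • (guestVel (Y.2 j) p - hostVel (Y.2 j) p)) := by
        simp only [freeMove, shifted, hY', adjoin_pos_castSucc, adjoin_pos_last, adjoin_vel_host,
          adjoin_vel_last]
        module
      rw [e, norm_neg]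
      refine lt_norm_smul_sub_smul hε hu hω ?_ (inner_guestVel_sub_hostVel_nonpos _ _)
      have := hS.vel_ne
      rw [adjoin_vel_last, adjoin_vel_host] at this
      rw [hjv']
      exact sub_ne_zero.2 this
    · have h1 := hS.pair u hu.le
      have e : (particle Z' j.castSucc).1 - (mirror (particle Z' (Fin.last n))).1 -
          u • ((particle Z' j.castSucc).2 - (mirror (particle Z' (Fin.last n))).2) =
          (freeMove u (particle Z' j.castSucc)).1 -
            symm₀ (freeMove u (particle Z' (Fin.last n))).1 := by
        simp only [freeMove, mirror, symm₀_sub, symm₀_smul]; module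
      rw [e] at h1
      have hmove : ∀ {P Q : Vec d × Vec d}, P.2 = Q.2 → ‖P.1 - Q.1‖ ≤ c + ε →
          ‖(freeMove u P).1 - (freeMove u Q).1‖ ≤ c + ε := fun h h' => by simpa [freeMove, h] using h'
      have h2 := hmove hhost.1 hhost.2
      have h3 := hmove hguest.1 hguest.2
      rw [← norm_symm₀_sub_symm₀] at h3
      set A := (freeMove u (shifted ε Y' j.castSucc)).1
      set B := symm₀ (freeMove u (shifted ε Y' (Fin.last n))).1
      set A' := (freeMove u (particle Z' j.castSucc)).1
      set B' := symm₀ (freeMove u (particle Z' (Fin.last n))).1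
      have h4 : ‖A' - B'‖ ≤ ‖A - A'‖ + ‖A - B‖ + ‖B - B'‖ := by
        calc ‖A' - B'‖ = ‖-(A - A') + (A - B) + (B - B')‖ := by congr 1; abel
          _ ≤ ‖-(A - A')‖ + ‖A - B‖ + ‖B - B'‖ := norm_add₃_le
          _ = _ := by rw [norm_neg]
      linarith
  have hpos : ∀ i, (i = Fin.last n ∨ i = j.castSucc) → ε / 2 < Y'.1 i 0 := by
    intro i hi
    have h1 : (particle Z' i).1 = Z.1 j := by
      rcases hi with rfl | rfl
      · simp only [particle, hZ', adjoin_pos_last, zero_smul, add_zero]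
      · simp only [particle, hZ', adjoin_pos_castSucc]
    have h2 : ‖(shifted ε Y' i).1 - (particle Z' i).1‖ ≤ c + ε := by
      rcases hi with rfl | rfl
      · exact hguest.2
      · exact hhost.2
    have h3 := (neg_abs_le _).trans' (neg_le_neg ((abs_coord_zero_le _).trans h2))
    rw [PiLp.sub_apply, h1, shifted_pos_zero] at h3
    linarith
  have hinit : ∀ i i', i ≠ i' → ¬ (i = j.castSucc ∧ i' = Fin.last n) →
      ¬ (i' = j.castSucc ∧ i = Fin.last n) → ε < ‖Y'.1 i - Y'.1 i'‖ := by
    intro i i' h1 h2 h3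
    have h4 := (hsep i i' h1 h2 h3 0 le_rfl).1
    rwa [freeMove_zero, freeMove_zero, shifted_sub_shifted] at h4
  have hrefl : ‖Y'.1 j.castSucc - Y'.1 (Fin.last n)‖ = ε := by
    rw [hY', adjoin_pos_castSucc, adjoin_pos_last, sub_add_cancel_left, norm_neg, norm_smul, hω,
      mul_one, Real.norm_of_nonneg hε.le]
  refine ⟨hclose, ⟨⟨fun i => ?_, fun i i' hii => ?_⟩, fun i => ?_, fun i hi => ?_,
    fun i i' hii u hu => ?_⟩, hinit⟩
  · refine Fin.lastCases (hpos _ (Or.inl rfl)).le (fun i => ?_) i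
    rw [hY', adjoin_pos_castSucc]
    exact hY i
  · by_cases h2 : i = j.castSucc ∧ i' = Fin.last n
    · rw [h2.1, h2.2, hrefl]
    · by_cases h3 : i' = j.castSucc ∧ i = Fin.last n
      · rw [h3.1, h3.2, norm_sub_rev, hrefl]
      · exact (hinit i i' hii h2 h3).le
  · have h1 : |Y'.2 i 0| = |Z'.2 i 0| := (hclose i).abs_vel_zero
    have h2 := hS.vel_zero i
    intro h0
    rw [h0, abs_zero] at h1
    linarith
  · by_cases h1 : i = Fin.last n ∨ i = j.castSucc
    · exact absurd hi (hpos i h1).ne'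
    · have h2 : |Y'.2 i 0| = |Z'.2 i 0| := (hclose i).abs_vel_zero
      have h3 := hS.vel_zero i
      have h4 : Y'.2 i 0 ≠ 0 := fun h0 => by rw [h0, abs_zero] at h2; linarith
      refine lt_of_le_of_ne ?_ h4
      clear h2 h3 h4
      induction i using Fin.lastCases with
      | last => exact absurd (Or.inl rfl) h1
      | cast i =>
        have hij : i ≠ j := fun h => h1 (Or.inr (by rw [h]))
        rw [hY', adjoin_pos_castSucc] at hi
        rw [hY', adjoin_vel_of_ne _ _ _ _ hij]
        exact hv i hi
  · by_cases h2 : i = j.castSucc ∧ i' = Fin.last n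
    · rw [h2.1, h2.2]; exact hpair u hu
    · by_cases h3 : i' = j.castSucc ∧ i = Fin.last n
      · rw [h3.1, h3.2]
        have h4 := hpair u hu
        refine ⟨by rw [norm_sub_rev]; exact h4.1, ?_⟩
        rw [← norm_symm₀_sub, norm_sub_rev]; exact h4.2
      · exact hsep i i' hii h2 h3 u hu.le

/-- The configuration of the hard spheres that follows the first `l` adjunctions stays close to the
one of the Boltzmann pseudo-trajectory. -/
structure Follows {s : ℕ} (ε : ℝ) (Z : Config d s) (t : ℕ → ℝ) (J : (l : ℕ) → Fin (s + l))
    (A : ℕ → AdjParam d) (l : ℕ) (Y : Config d (s + l)) : Prop where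
  close : ∀ i, Close (ε / 2 + l * ε) (shifted ε Y i) (particle (boltzmannAt Z t J A l) i)
  free : FreelyFlows ε Y
  apart : ∀ m m' : Fin (s + l), m ≠ m' → (∀ i, l = i + 1 →
    ¬ ((m.val = (J i).val ∧ m'.val = s + i) ∨ (m'.val = (J i).val ∧ m.val = s + i))) →
    ε < ‖Y.1 m - Y.1 m'‖

lemma close_boltzmann {s : ℕ} {ε : ℝ} {Z : Config d s} {t : ℕ → ℝ} {J : (l : ℕ) → Fin (s + l)}
    {A : ℕ → AdjParam d} {l : ℕ} {Y : ℝ → Config d (s + l)}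
    (h : Follows ε Z t J A l (Y (t l))) {a : ℝ} (hY : IsHardSphereTrajectory ε Y a (t l)) {τ : ℝ}
    (hτ : τ ∈ Icc a (t l)) (i : Fin (s + l)) :
    Close (ε / 2 + l * ε) (shifted ε (Y τ) i) (particle (boltzmann Z t J A l τ) i) := by
  have h1 := (hY.close h.free hτ i).trans (((h.close i).freeMove (t l - τ)).trans
    (close_freeFlow (t l - τ) (boltzmannAt Z t J A l) i).symm)
  simpa [boltzmann] using h1

/-- The flow preserves the error up to reflection, and the adjunction adds at most `ε`, because the
sphere is placed at `ε ω` from its host whereas the Boltzmann particle is placed on it. -/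
lemma Follows.succ {s : ℕ} {ε α δ F D : ℝ} {Z : Config d s} {t : ℕ → ℝ}
    {J : (l : ℕ) → Fin (s + l)} {A : ℕ → AdjParam d} {l : ℕ} {Y : ℝ → Config d (s + l)}
    (h : Follows ε Z t J A l (Y (t l))) (hε : 0 < ε) (hα : 0 < α) (ht : t (l + 1) < t l)
    (hY : IsHardSphereTrajectory ε Y (t (l + 1)) (t l))
    (hfar : ε / 2 + (l + 1) * ε < (boltzmann Z t J A l (t (l + 1))).1 (J l) 0)
    (hS : IsSafe α δ F D (J l) (boltzmannAt Z t J A (l + 1)))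
    (hD : 2 * (ε / 2 + (l + 1) * ε) + ε < D) :
    Follows ε Z t J A (l + 1) (adjoin ε (Y (t (l + 1))) (J l) (A l)) := by
  have hl : ε / 2 + l * ε + ε = ε / 2 + (l + 1) * ε := by ring
  obtain ⟨h1, h2, h3⟩ := freelyFlows_adjoin (Z := boltzmann Z t J A l (t (l + 1)))
    (p := A l) hε hα (fun i => (hY.1 _ ⟨le_rfl, ht.le⟩).1 i)
    (fun i hi => hY.vel_nonpos h.free ⟨le_rfl, ht⟩ hi)
    (fun i => close_boltzmann h hY ⟨le_rfl, ht.le⟩ i) (by rw [hl]; exact hfar) hS (by rw [hl]; exact hD)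
  refine ⟨fun i => ?_, h2, fun m m' hm hp => h3 m m' hm ?_ ?_⟩
  · have h4 := h1 i
    rw [hl] at h4
    push_cast
    exact h4
  · rintro ⟨rfl, rfl⟩
    exact hp l rfl (Or.inl ⟨rfl, rfl⟩)
  · rintro ⟨rfl, rfl⟩
    exact hp l rfl (Or.inr ⟨rfl, rfl⟩)

/-- The configuration of the hard spheres without recollision just after the first `l`
adjunctions. -/
def hardStart {s : ℕ} (ε : ℝ) (Z : Config d s) (t : ℕ → ℝ) (J : (l : ℕ) → Fin (s + l))
    (A : ℕ → AdjParam d) : (l : ℕ) → Config d (s + l)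
  | 0 => Z
  | l + 1 => adjoin ε (hardFlow ε (t l - t (l + 1)) (hardStart ε Z t J A l)) (J l) (A l)

section pseudo
variable {s k : ℕ} {ε α δ F D r : ℝ} {Z : Config d s} {t : ℕ → ℝ} {J : (l : ℕ) → Fin (s + l)}
  {A : ℕ → AdjParam d}

/-- Every pseudo-trajectory is covered, since between adjunctions the dynamics from a freely flowing
configuration is determined up to reflection. -/
lemma IsBBGKYPseudoTrajectory.follows (hε : 0 < ε) (hα : 0 < α) (hZ : Follows ε Z t J A 0 Z)
    (ht : ∀ l < k, t (l + 1) < t l)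
    (hfar : ∀ l < k, r ≤ (boltzmann Z t J A l (t (l + 1))).1 (J l) 0)
    (hS : ∀ l < k, IsSafe α δ F D (J l) (boltzmannAt Z t J A (l + 1)))
    (hr : ε / 2 + k * ε < r) (hD : 2 * (ε / 2 + k * ε) + ε < D)
    {Y : (l : ℕ) → ℝ → Config d (s + l)} (hY : IsBBGKYPseudoTrajectory ε k Z t J A Y) :
    ∀ l ≤ k, Follows ε Z t J A l (Y l (t l)) := by
  intro l
  induction l with
  | zero => intro _; rw [hY.1]; exact hZ
  | succ l ih =>
    intro hl
    have hlk : l < k := hl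
    have hle : ((l : ℝ) + 1) * ε ≤ k * ε := by
      gcongr
      exact_mod_cast hl
    rw [hY.2.2 l hlk]
    exact (ih hlk.le).succ hε hα (ht l hlk) (hY.2.1 l hlk.le)
      (lt_of_lt_of_le (by linarith) (hfar l hlk)) (hS l hlk) (by linarith)

/-- The same induction, run on the explicit candidate `hardStart`, shows that its flow never meets a
collision. -/
lemma exists_isBBGKYPseudoTrajectory (hε : 0 < ε) (hα : 0 < α) (hZ : Follows ε Z t J A 0 Z)
    (ht : ∀ l < k, t (l + 1) < t l)
    (hfar : ∀ l < k, r ≤ (boltzmann Z t J A l (t (l + 1))).1 (J l) 0)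
    (hS : ∀ l < k, IsSafe α δ F D (J l) (boltzmannAt Z t J A (l + 1)))
    (hr : ε / 2 + k * ε < r) (hD : 2 * (ε / 2 + k * ε) + ε < D) :
    ∃ Y, IsBBGKYPseudoTrajectory ε k Z t J A Y := by
  have key : ∀ l ≤ k, Follows ε Z t J A l (hardStart ε Z t J A l) := by
    intro l
    induction l with
    | zero => exact fun _ => hZ
    | succ l ih =>
      intro hl
      have hlk : l < k := hl
      have hle : ((l : ℝ) + 1) * ε ≤ k * ε := by
        gcongr
        exact_mod_cast hl
      have h1 := ih hlk.le
      have h2 : Follows ε Z t J A l (hardFlow ε (t l - t l) (hardStart ε Z t J A l)) := by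
        rwa [sub_self, h1.free.hardFlow_zero]
      exact h2.succ (Y := fun τ => hardFlow ε (t l - τ) (hardStart ε Z t J A l)) hε hα (ht l hlk)
        (h1.free.isHardSphereTrajectory _ _) (lt_of_lt_of_le (by linarith) (hfar l hlk)) (hS l hlk)
        (by linarith)
  refine ⟨fun l τ => hardFlow ε (t l - τ) (hardStart ε Z t J A l), ?_, fun l hl => ?_,
    fun l hl => ?_⟩
  · simp only [sub_self]
    exact hZ.free.hardFlow_zero
  · exact (key l hl).free.isHardSphereTrajectory _ _
  · simp only [sub_self]
    exact (key (l + 1) hl).free.hardFlow_zero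

end pseudo

/-! ### Compact subsets of `convDomain`. -/

open Filter Topology

lemma exists_uniform_lower_bound {X ι : Type*} [TopologicalSpace X] [Finite ι] {K : Set X}
    (hK : IsCompact K) {f : ι → X → ℝ} (hf : ∀ i, ContinuousOn (f i) K)
    (hpos : ∀ i, ∀ x ∈ K, 0 < f i x) : ∃ c > (0 : ℝ), ∀ i, ∀ x ∈ K, c ≤ f i x := by
  have h : ∀ᶠ c in 𝓝[>] (0 : ℝ), ∀ i, ∀ x ∈ K, c ≤ f i x := by
    refine eventually_all.2 fun i => ?_
    obtain ⟨c, hc, h⟩ := hK.exists_forall_le' (hf i) (hpos i)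
    filter_upwards [Ioo_mem_nhdsGT hc] with b hb x hx
    exact hb.2.le.trans (h x hx)
  obtain ⟨c, hc, hc0⟩ := (h.and self_mem_nhdsWithin).exists
  exact ⟨c, hc0, hc⟩

/-- The distance to a line of direction `y ≠ 0`. -/
def lineGap (w v y : Vec d) : ℝ :=
  ‖(w - v) - (inner ℝ (‖y‖⁻¹ • y) (w - v) : ℝ) • (‖y‖⁻¹ • y)‖

/-- The part of `w - (v + c y)` orthogonal to `y` does not depend on `c`. Unlike the infimum,
`lineGap` is an explicit formula, continuous where `y ≠ 0`. -/
lemma lineGap_le_distLine {w v y : Vec d} (hy : y ≠ 0) : lineGap w v y ≤ distLine w v y := by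
  refine (Metric.le_infDist (s := {u | ∃ c : ℝ, u = v + c • y}) ⟨v, 0, by simp⟩).2 ?_
  rintro u ⟨c, rfl⟩
  have h0 : ‖y‖ ≠ 0 := norm_ne_zero_iff.2 hy
  have he : ‖‖y‖⁻¹ • y‖ = 1 := norm_inv_norm_smul (norm_pos_iff.2 hy)
  have h1 := norm_sub_inner_smul_le he (w - v - (c * ‖y‖) • (‖y‖⁻¹ • y))
  rw [dist_eq_norm, ← sub_sub, lineGap]
  have e : (c * ‖y‖) • (‖y‖⁻¹ • y) = c • y := by
    rw [smul_smul, mul_assoc, mul_inv_cancel₀ h0, mul_one]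
  refine le_trans (le_of_eq ?_) (h1.trans (le_of_eq (by rw [e])))
  rw [inner_sub_right (‖y‖⁻¹ • y) (w - v), inner_smul_right, inner_self_eq_one he]
  congr 1
  module

lemma lineGap_pos {w v y : Vec d} (h : ¬ ∃ c : ℝ, w = v + c • y) : 0 < lineGap w v y := by
  refine norm_pos_iff.2 fun h0 => h ⟨inner ℝ (‖y‖⁻¹ • y) (w - v) * ‖y‖⁻¹, ?_⟩
  rw [smul_smul, sub_eq_zero] at h0
  rw [← h0]; abel

lemma continuousOn_lineGap {X : Type*} [TopologicalSpace X] {K : Set X} {w v y : X → Vec d}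
    (hw : Continuous w) (hv : Continuous v) (hy : Continuous y) (h : ∀ x ∈ K, y x ≠ 0) :
    ContinuousOn (fun x => lineGap (w x) (v x) (y x)) K := by
  have h1 : ContinuousOn (fun x => ‖y x‖⁻¹ • y x) K :=
    (hy.norm.continuousOn.inv₀ fun x hx => norm_ne_zero_iff.2 (h x hx)).smul hy.continuousOn
  have h2 : ContinuousOn (fun x => w x - v x) K := (hw.sub hv).continuousOn
  have h3 : ContinuousOn (fun x => (inner ℝ (‖y x‖⁻¹ • y x) (w x - v x) : ℝ)) K :=
    ContinuousOn.inner (𝕜 := ℝ) h1 h2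
  have h4 : ContinuousOn (fun x => (inner ℝ (‖y x‖⁻¹ • y x) (w x - v x) : ℝ) • (‖y x‖⁻¹ • y x)) K :=
    h3.smul h1
  exact (h2.sub h4).norm

lemma continuous_symm₀ : Continuous (symm₀ : Vec d → Vec d) := by
  unfold symm₀; fun_prop

/-- A compact subset of the domain of local uniform convergence is made of good initial
configurations. -/
lemma exists_subset_goodInit {s : ℕ} {K : Set (Config d s)} (hK : IsCompact K)
    (h : K ⊆ convDomain s) :
    ∃ εb > (0 : ℝ), ∃ ε₀b > (0 : ℝ), ∃ αb > (0 : ℝ), ∃ γb > (0 : ℝ), ∃ Rb > (0 : ℝ),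
      ∀ ε ε₀ α γ R : ℝ, 0 < ε → 0 < ε₀ → 0 < α → 0 < γ → 0 < R →
        ε ≤ εb → ε₀ ≤ ε₀b → α ≤ αb → γ ≤ γb → Rb ≤ R → K ⊆ goodInit s ε R ε₀ α γ := by
  have hx : ∀ i, Continuous fun Z : Config d s => Z.1 i := fun i => by fun_prop
  have hv : ∀ i, Continuous fun Z : Config d s => Z.2 i := fun i => by fun_prop
  have hx0 : ∀ i, Continuous fun Z : Config d s => Z.1 i 0 := fun i => by fun_prop
  have hv0 : ∀ i, Continuous fun Z : Config d s => Z.2 i 0 := fun i => by fun_prop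
  let I := {p : Fin s × Fin s // p.1 ≠ p.2}
  -- The mirror image of a particle lies strictly on the other side of the wall, so this direction
  -- never vanishes.
  have hmir : ∀ p : I, ∀ Z ∈ K, symm₀ (Z.1 p.1.1) - Z.1 p.1.2 ≠ 0 := by
    intro p Z hZ h0
    have h1 := congrArg (fun x : Vec d => x 0) h0
    simp only [PiLp.sub_apply, symm₀_zero_coord, PiLp.zero_apply] at h1
    linarith [(h hZ).1 p.1.1, (h hZ).1 p.1.2]
  have hsub : ∀ p : I, ∀ Z ∈ K, Z.1 p.1.1 - Z.1 p.1.2 ≠ 0 := fun p Z hZ =>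
    sub_ne_zero.2 ((h hZ).2.1 _ _ p.2)
  obtain ⟨c₁, hc₁, h₁⟩ := exists_uniform_lower_bound hK (f := fun i Z => Z.1 i 0)
    (fun i => (hx0 i).continuousOn) fun i Z hZ => (h hZ).1 i
  obtain ⟨c₂, hc₂, h₂⟩ := exists_uniform_lower_bound hK
    (f := fun (p : I) (Z : Config d s) => ‖Z.1 p.1.1 - Z.1 p.1.2‖)
    (fun p => ((hx _).sub (hx _)).norm.continuousOn) fun p Z hZ => norm_pos_iff.2 (hsub p Z hZ)
  obtain ⟨c₃, hc₃, h₃⟩ := exists_uniform_lower_bound hK (f := fun i Z => |Z.2 i 0|)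
    (fun i => (hv0 i).abs.continuousOn) fun i Z hZ => abs_pos.2 ((h hZ).2.2.1 i)
  obtain ⟨c₄, hc₄, h₄⟩ := exists_uniform_lower_bound hK
    (f := fun (p : I) (Z : Config d s) =>
      lineGap (Z.2 p.1.2) (Z.2 p.1.1) (Z.1 p.1.1 - Z.1 p.1.2))
    (fun p => continuousOn_lineGap (hv _) (hv _) ((hx _).sub (hx _)) (hsub p))
    fun p Z hZ => lineGap_pos ((h hZ).2.2.2.1 _ _ p.2)
  obtain ⟨c₅, hc₅, h₅⟩ := exists_uniform_lower_bound hK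
    (f := fun (p : I) (Z : Config d s) =>
      lineGap (Z.2 p.1.2) (symm₀ (Z.2 p.1.1)) (symm₀ (Z.1 p.1.1) - Z.1 p.1.2))
    (fun p => continuousOn_lineGap (hv _) (continuous_symm₀.comp (hv _))
      ((continuous_symm₀.comp (hx _)).sub (hx _)) (hmir p))
    fun p Z hZ => lineGap_pos ((h hZ).2.2.2.2 _ _ p.2)
  have hvel : Continuous fun Z : Config d s => velNorm Z := by unfold velNorm; fun_prop
  obtain ⟨R₀, hR₀⟩ := (hK.image hvel).bddAbove
  refine ⟨min c₁ c₂, lt_min hc₁ hc₂, c₂, hc₂, c₃, hc₃, min c₄ c₅, lt_min hc₄ hc₅, max R₀ 1,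
    lt_max_of_lt_right one_pos, ?_⟩
  intro ε ε₀ α γ R hε _ _ _ _ hε' hε₀' hα' hγ' hR' Z hZ
  have hε1 : ∀ i, ε / 2 < Z.1 i 0 := fun i => by
    linarith [h₁ i Z hZ, hε'.trans (min_le_left _ _)]
  refine ⟨⟨fun i => (hε1 i).le, fun i j hij => ?_⟩, hε1, ?_, fun i j hij => ?_, fun i => ?_,
    fun i j hij => ?_, fun i j hij => ?_⟩
  · exact (hε'.trans (min_le_right _ _)).trans (h₂ ⟨(i, j), hij⟩ Z hZ)
  · exact (hR₀ (mem_image_of_mem _ hZ)).trans ((le_max_left _ _).trans hR')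
  · exact hε₀'.trans (h₂ ⟨(i, j), hij.ne⟩ Z hZ)
  · exact hα'.trans (h₃ i Z hZ)
  · exact ((hγ'.trans (min_le_left _ _)).trans (h₄ ⟨(i, j), hij.ne⟩ Z hZ)).trans
      (lineGap_le_distLine (hsub ⟨(i, j), hij.ne⟩ Z hZ))
  · exact ((hγ'.trans (min_le_right _ _)).trans (h₅ ⟨(i, j), hij.ne⟩ Z hZ)).trans
      (lineGap_le_distLine (hmir ⟨(i, j), hij.ne⟩ Z hZ))

/-! ### Start of the induction, safety of the Boltzmann pseudo-trajectory, and conclusion. -/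

/-- Shifting the two positions by `ε / 2` costs `ε` in the separation `3 * a`, and `2 * ε < 3 * a`
leaves more than `ε`. -/
lemma follows_zero {s : ℕ} {ε R ε₀ α γ a δ : ℝ} {Z : Config d s} (hZ : Z ∈ goodInit s ε R ε₀ α γ)
    (hε : 0 < ε) (hα : 0 < α) (ha : 2 * ε < 3 * a) (hδ : 0 < δ) (hε₀ : 4 * √3 * a ≤ ε₀)
    (hγ : max (ε₀ / δ) (16 * R * a / ε₀) ≤ γ) (t : ℕ → ℝ) (J : (l : ℕ) → Fin (s + l))
    (A : ℕ → AdjParam d) : Follows ε Z t J A 0 Z := by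
  have hfar : ∀ i j, i ≠ j → ∀ u : ℝ, 0 ≤ u →
      ε < ‖(freeMove u (shifted ε Z i)).1 - (freeMove u (shifted ε Z j)).1‖ ∧
      ε < ‖(freeMove u (shifted ε Z i)).1 - symm₀ (freeMove u (shifted ε Z j)).1‖ := by
    intro i j hij u hu
    have h := (apartFrom_of_goodInit hZ hε (by linarith) hδ hε₀ hγ hij).1.of_close
      (close_shifted hε Z i) (close_shifted hε Z j) u hu
    exact ⟨lt_of_lt_of_le (by linarith) h.1, lt_of_lt_of_le (by linarith) h.2⟩
  refine ⟨fun i => ?_, ⟨hZ.1, fun i => ?_, fun i hi => absurd hi (hZ.2.1 i).ne',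
    fun i j hij u hu => hfar i j hij u hu.le⟩, fun i j hij _ => ?_⟩
  · exact (close_shifted hε Z i).mono (by simp)
  · exact abs_pos.1 (hα.trans_le (hZ.2.2.2.2.1 i))
  · have h := (hfar i j hij 0 le_rfl).1
    rwa [freeMove_zero, freeMove_zero, shifted_sub_shifted] at h

/-- Outside of the pathological times and parameters, the Boltzmann pseudo-trajectory remains safe. -/
lemma boltzmann_safe {s k : ℕ} {α R F D δ r : ℝ} {Z : Config d s} {t : ℕ → ℝ}
    {J : (l : ℕ) → Fin (s + l)} {A : ℕ → AdjParam d} (hα : 0 ≤ α) (hR : 0 ≤ R)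
    (hv : ∀ i, α ≤ |Z.2 i 0|)
    (hF : ∀ i i', i ≠ i' → ApartFrom δ F (particle Z i) (particle Z i'))
    (hE : velNorm Z ^ 2 + ∑ l ∈ Finset.range k, ‖(A l).2‖ ^ 2 ≤ R ^ 2)
    (ht : ∀ l < k, δ ≤ t l - t (l + 1))
    (hfar : ∀ l < k, α ≤ |(boltzmannAt Z t J A l).2 (J l) 0| →
      r ≤ (boltzmann Z t J A l (t (l + 1))).1 (J l) 0)
    (hS : ∀ l < k, IsReady α F R r (J l) (boltzmann Z t J A l (t (l + 1))) → ‖(A l).2‖ ≤ R →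
      IsSafe α δ F D (J l) (adjoin 0 (boltzmann Z t J A l (t (l + 1))) (J l) (A l))) :
    ∀ l < k, r ≤ (boltzmann Z t J A l (t (l + 1))).1 (J l) 0 ∧
      IsSafe α δ F D (J l) (boltzmannAt Z t J A (l + 1)) := by
  have hA : ∀ l < k, ‖(A l).2‖ ≤ R := fun l hl => by
    refine (abs_le_of_sq_le_sq' ?_ hR).2
    refine le_trans ?_ ((le_add_of_nonneg_left (sq_nonneg (velNorm Z))).trans hE)
    exact Finset.single_le_sum (f := fun l => ‖(A l).2‖ ^ 2) (fun _ _ => sq_nonneg _)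
      (Finset.mem_range.2 hl)
  have hV : ∀ l ≤ k, velNorm (boltzmannAt Z t J A l) ^ 2 ≤ R ^ 2 := fun l hl => by
    rw [velNorm_boltzmannAt]
    refine le_trans (add_le_add le_rfl ?_) hE
    exact Finset.sum_le_sum_of_subset_of_nonneg (Finset.range_mono hl) fun _ _ _ => sq_nonneg _
  have step : ∀ l < k, (∀ i, α ≤ |(boltzmannAt Z t J A l).2 i 0|) →
      (∀ i i', i ≠ i' → ApartFrom δ F (particle (boltzmannAt Z t J A l) i)
        (particle (boltzmannAt Z t J A l) i')) →
      r ≤ (boltzmann Z t J A l (t (l + 1))).1 (J l) 0 ∧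
      IsSafe α δ F D (J l) (boltzmannAt Z t J A (l + 1)) := by
    intro l hl h1 h2
    have h3 := hfar l hl (h1 (J l))
    exact ⟨h3, hS l hl (isReady_freeFlow hα hR h1 h2 (hV l hl.le) (ht l hl) h3) (hA l hl)⟩
  -- The induction closes because the same `F` appears before and after each adjunction.
  have key : ∀ l ≤ k, (∀ i, α ≤ |(boltzmannAt Z t J A l).2 i 0|) ∧
      (∀ i i', i ≠ i' → ApartFrom δ F (particle (boltzmannAt Z t J A l) i)
        (particle (boltzmannAt Z t J A l) i')) := by
    intro l
    induction l with
    | zero => exact fun _ => ⟨hv, hF⟩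
    | succ l ih =>
      intro hl
      have h := (step l hl (ih (Nat.le_of_succ_le hl)).1 (ih (Nat.le_of_succ_le hl)).2).2
      exact ⟨h.vel_zero, h.late⟩
  exact fun l hl => step l hl (key l hl.le).1 (key l hl.le).2

/-- A pseudo-trajectory of the hard spheres which follows a safe Boltzmann pseudo-trajectory has no
recollision and stays close to it. -/
lemma no_recollision {s k : ℕ} {ε : ℝ} {Z : Config d s} {t : ℕ → ℝ} {J : (l : ℕ) → Fin (s + l)}
    {A : ℕ → AdjParam d} {Y : (l : ℕ) → ℝ → Config d (s + l)} (hε : 0 < ε) (hk : 1 ≤ k)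
    (htk : 0 ≤ t k) (htk' : t (k + 1) = 0) (hY : IsBBGKYPseudoTrajectory ε k Z t J A Y)
    (h : ∀ l ≤ k, Follows ε Z t J A l (Y l (t l))) :
    (∀ l ≤ k, ∀ τ ∈ Icc (t (l + 1)) (t l), ∀ m m' : Fin (s + l), m ≠ m' →
      (τ = t l → ∀ i, l = i + 1 →
        ¬ ((m.val = (J i).val ∧ m'.val = s + i) ∨ (m'.val = (J i).val ∧ m.val = s + i))) →
      ε < ‖(Y l τ).1 m - (Y l τ).1 m'‖) ∧
    ∀ m : Fin (s + k), ‖(Y k 0).1 m - (boltzmann Z t J A k 0).1 m‖ ≤ 2 * k * ε := by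
  refine ⟨fun l hl τ hτ m m' hm hp => ?_, fun m => ?_⟩
  · rcases hτ.2.eq_or_lt with h1 | h1
    · rw [h1]
      exact (h l hl).apart m m' hm (hp h1)
    · exact (h l hl).free.lt_norm_sub (sub_pos.2 h1)
        (fun i => (hY.2.1 l hl).close (h l hl).free hτ i) hm
  · have h0 : (0 : ℝ) ∈ Icc (t (k + 1)) (t k) := ⟨htk'.le, htk⟩
    have h1 := close_boltzmann (h k le_rfl) (hY.2.1 k le_rfl) h0 m
    have h2 := h1.norm_sub_le (by rw [shifted_pos_zero]; linarith [((hY.2.1 k le_rfl).1 0 h0).1 m])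
      (freeFlow_pos_nonneg _ _ _)
    have e : (Y k 0).1 m - (boltzmann Z t J A k 0).1 m =
        ((shifted ε (Y k 0) m).1 - (particle (boltzmann Z t J A k 0) m).1) +
          (ε / 2) • (e₁ : Vec d) := by
      simp only [shifted, particle]; abel
    -- The total error is `ε / 2 + k * ε` for the shifted spheres plus `ε / 2` for the shift, that
    -- is `(k + 1) * ε ≤ 2 * k * ε`.
    have hk' : ε ≤ k * ε := le_mul_of_one_le_left hε.le (by exact_mod_cast hk)
    rw [e]
    refine (norm_add_le _ _).trans ?_
    rw [norm_half_smul_e₁ hε]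
    linarith

end HalfSpace

end

theorem mainTheorem6 (d : ℕ) [NeZero d] (hd : 2 ≤ d) :
    (∀ s : ℕ, 1 ≤ s → ∀ K : Set (Config d s), IsCompact K → K ⊆ convDomain s →
      ∃ εb > (0 : ℝ), ∃ ε₀b > (0 : ℝ), ∃ αb > (0 : ℝ), ∃ γb > (0 : ℝ), ∃ Rb > (0 : ℝ),
        ∀ ε ε₀ α γ R : ℝ, 0 < ε → 0 < ε₀ → 0 < α → 0 < γ → 0 < R →
          ε ≤ εb → ε₀ ≤ ε₀b → α ≤ αb → γ ≤ γb → Rb ≤ R →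
          K ⊆ goodInit s ε R ε₀ α γ) ∧
    (∃ C > (0 : ℝ), ∃ c > (0 : ℝ), ∀ s k : ℕ, 1 ≤ s → 1 ≤ k →
      ∀ T ε ε₀ α γ R η a δ ρ : ℝ,
        0 < T → 0 < ε → 0 < ε₀ → 0 < α → 0 < γ → 0 < η → 0 < a → 0 < δ → 0 < ρ →
        1 ≤ R → η ≤ 1 → 2 * k * ε ≤ a → 4 * Real.sqrt 3 * a ≤ ε₀ → ε₀ ≤ η * δ →
        3 * a ≤ ρ → α ≤ c → max (ε₀ / δ) (16 * R * a / ε₀) ≤ γ →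
        ∃ (U : (l : ℕ) → Fin (s + l) → ℝ → Config d (s + l) → Set ℝ)
          (E : (l : ℕ) → Fin (s + l) → Config d (s + l) → Set (AdjParam d)),
          (∀ l < k, ∀ j τ Z,
            MeasurableSet (U l j τ Z) ∧ U l j τ Z ⊆ Set.Icc 0 T ∧
            MeasureTheory.volume (U l j τ Z) ≤ ENNReal.ofReal (2 * (ρ / α))) ∧
          (∀ l < k, ∀ j Z,
            MeasurableSet (E l j Z) ∧
            adjMeasure d (E l j Z) ≤ ENNReal.ofReal (C *
              (η ^ d + R ^ d * (a / ρ) ^ (d - 1)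
                + (s + l : ℕ) * R ^ (2 * d - 1) * (a / ε₀) ^ ((d : ℝ) - 3 / 2)
                + (s + l : ℕ) * R ^ ((d : ℝ) + 1 / 2) * (ε₀ / δ) ^ ((d : ℝ) - 3 / 2)
                + R ^ (d - 1) * α + R ^ d * α ^ (1 / 8 : ℝ)))) ∧
          (∀ Z ∈ goodInit s ε R ε₀ α γ,
            ∀ (t : ℕ → ℝ) (J : (l : ℕ) → Fin (s + l)) (A : ℕ → AdjParam d),
            t 0 ≤ T → (∀ l < k, δ ≤ t l - t (l + 1)) → 0 ≤ t k → t (k + 1) = 0 →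
            velNorm Z ^ 2 + ∑ l ∈ Finset.range k, ‖(A l).2‖ ^ 2 ≤ R ^ 2 →
            (∀ l < k, t (l + 1) ∉ U l (J l) (t l) (boltzmannAt Z t J A l) ∧
              A l ∉ E l (J l) (boltzmann Z t J A l (t (l + 1)))) →
            (∃ Y, IsBBGKYPseudoTrajectory ε k Z t J A Y) ∧
            ∀ Y, IsBBGKYPseudoTrajectory ε k Z t J A Y →
              (∀ l ≤ k, ∀ τ ∈ Set.Icc (t (l + 1)) (t l), ∀ m m' : Fin (s + l), m ≠ m' →
                (τ = t l → ∀ i, l = i + 1 →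
                  ¬ ((m.val = (J i).val ∧ m'.val = s + i) ∨
                     (m'.val = (J i).val ∧ m.val = s + i))) →
                ε < ‖(Y l τ).1 m - (Y l τ).1 m'‖) ∧
              (∀ m : Fin (s + k),
                ‖(Y k 0).1 m - (boltzmann Z t J A k 0).1 m‖ ≤ 2 * k * ε))) := by
  refine ⟨fun s _ K hK h => exists_subset_goodInit hK h, ?_⟩
  obtain ⟨C, hC, hbad⟩ := exists_pathological_parameters hd
  -- `c = 1` suffices: `α ≤ 1` serves only to compare powers of `α`.
  refine ⟨C, hC, 1, one_pos, ?_⟩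
  intro s k _ hk T ε ε₀ α γ R η a δ ρ hT hε hε₀ hα hγ hη ha hδ hρ hR hη1 hka haε hεδ haρ hα1 hγ'
  have hk1 : (1 : ℝ) ≤ k := by exact_mod_cast hk
  have hkε : ε ≤ k * ε := le_mul_of_one_le_left hε.le hk1
  have h3 : (1.7 : ℝ) ≤ √3 := Real.le_sqrt_of_sq_le (by norm_num)
  have haε' : a ≤ ε₀ := by nlinarith
  obtain ⟨F, hFε, hF⟩ := hbad R η a ε₀ δ ρ α hR hη hη1 ha haε' hδ hεδ hρ hα hα1
  choose E hEm hEb hES using hF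
  choose U hUm hUs hUv hU using fun (τ : ℝ) (x v : Vec d) =>
    exists_pathological_times hα hρ T τ x v
  refine ⟨fun l j τ Z => U τ (Z.1 j) (Z.2 j), fun l j Z => E (s + l) j Z,
    fun l _ j τ Z => ⟨hUm _ _ _, hUs _ _ _, hUv _ _ _⟩, fun l _ j Z => ⟨hEm _ _ _, hEb _ _ _⟩, ?_⟩
  intro Z hZ t J A hT0 hgap htk htk' hen hout
  have htpos : ∀ i l, l + i = k → 0 ≤ t l := by
    intro i
    induction i with
    | zero => rintro l rfl; exact htk
    | succ i ih =>
      intro l hl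
      linarith [ih (l + 1) (by omega), hgap l (by omega)]
  have htT : ∀ l ≤ k, t l ≤ T := by
    intro l
    induction l with
    | zero => exact fun _ => hT0
    | succ l ih => intro hl; linarith [ih (Nat.le_of_succ_le hl), hgap l hl]
  have hlt : ∀ l < k, t (l + 1) < t l := fun l hl => by linarith [hgap l hl]
  have htime : ∀ l < k, ρ / α ≤ t l - t (l + 1) ∧
      (α ≤ |(boltzmannAt Z t J A l).2 (J l) 0| →
        ρ / 2 ≤ (boltzmann Z t J A l (t (l + 1))).1 (J l) 0) := by
    intro l hl
    rw [boltzmann, freeFlow_pos_zero]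
    exact hU _ _ _ _ ⟨htpos (k - (l + 1)) _ (by omega), htT _ hl⟩ (hlt l hl).le (hout l hl).1
  -- The waiting time is `max δ (ρ / α)`, which the gap hypothesis and the removed times guarantee
  -- together.
  have hsafe := boltzmann_safe (δ := max δ (ρ / α)) (F := F) (D := 3 * a) hα.le (by linarith)
    hZ.2.2.2.2.1 (fun i i' h => (apartFrom_of_goodInit hZ hε ha hδ haε hγ' h).2.mono
      (le_max_left _ _) hFε) hen (fun l hl => max_le (hgap l hl) (htime l hl).1)
    (fun l hl => (htime l hl).2)
    fun l hl hr hA => hES _ _ _ hr _ (hout l hl).2 hA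
  have hZ0 := follows_zero hZ hε hα (by linarith) hδ haε hγ' t J A
  have hr : ε / 2 + k * ε < ρ / 2 := by linarith
  -- The left side equals `2 * k * ε + 2 * ε`, at most `4 * k * ε ≤ 2 * a`.
  have hD : 2 * (ε / 2 + k * ε) + ε < 3 * a := by linarith
  exact ⟨exists_isBBGKYPseudoTrajectory hε hα hZ0 hlt (fun l hl => (hsafe l hl).1)
    (fun l hl => (hsafe l hl).2) hr hD, fun Y hY => no_recollision hε hk htk htk' hY
      (hY.follows hε hα hZ0 hlt (fun l hl => (hsafe l hl).1) (fun l hl => (hsafe l hl).2) hr hD)⟩
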